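/- Let $m\ge 2$ be an integer and $$\chi_m(X)=\prod_{k=m}^{2m-1}(X+k)-\frac{(2m)!}{m!}.$$ For $A\in\mathbb C$ let $\mathcal M_2(A)$ be the set of probability laws on $\mathbb C$ with mean $A$ and finite second moment. **(i)** Let $\lambda\in\mathbb C$ be a root of $\chi_m$ with $\Re\lambda>\frac12$, and let $A\in\mathbb C$. Each of the two equations in law $$\text{(D)}_\lambda\quad W\overset{\mathcal L}{=}B_1^{\lambda}W^{(1)}+B_2^{\lambda}W^{(2)},\qquad\qquad \text{(C)}_\lambda\quad W\overset{\mathcal L}{=}B^{\lambda}\left(W^{(1)}+W^{(2)}\right)$$ has exactly one solution in $\mathcal M_2(A)$. Here $W^{(1)},W^{(2)}$ are independent copies of $W$; in (D)$_\lambda$ the vector $(B_1,B_2)$ is independent of $(W^{(1)},W^{(2)})$ and has the Dirichlet law with parameters $(m,m)$ (that is, $B_2=1-B_1$ and $B_1$ is Beta$(m,m)$); in (C)$_\lambda$ the variable $B$ is independent of $(W^{(1)},W^{(2)})$ and has the Beta$(m,m)$ law. Now let $m\ge 60$. There is exactly one root $\lambda_2=\sigma_2+i\tau_2$ of $\chi_m$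 with $\tau_2>0$ such that $\Re z\le\sigma_2$ for every root $z\neq1$ of $\chi_m$. Let $e_1,\dots,e_m$ be the canonical basis of $\mathbb R^m$, let $w_k=e_{k+1}-e_k$ for $1\le k\le m-1$ and $w_m=2e_1-e_m$, let $P=\mathrm{Diag}(m,m+1,\dots,2m-1)$, and for $\lambda\in\mathbb C$ put $$u(\lambda)(x)=\sum_{k=1}^m\Bigl(\prod_{j=0}^{k-2}\frac{\lambda+m+j}{1+m+j}\Bigr)x_k,\qquad v(\lambda)_k=\Bigl((m+\lambda)\sum_{j=0}^{m-1}\frac1{m+\lambda+j}\Bigr)^{-1}\prod_{j=1}^{k-1}\frac{m+j}{m+j+\lambda}.$$ **(ii)** Let $(L_n)_{n\ge0}$ be the fringe node process of the B-tree with parameter $m$ (optimistic insertion, random permutation model): the Markov chain with $L_0=e_1$ which jumps from $x$ to $x+w_k$ with probability $(m+k-1)x_k/\sum_{j=1}^m(m+j-1)x_j$. Then $n^{-\lambda_2}\,u(\lambda_2)(PL_n)$ converges almost surely to a complex random variable $W_m^{B\text{-tree}}$. Any $W$ such that, almost surely as $n\to\infty$, $$L_n=nP^{-1}v(1)+2\Re\left(n^{\lambda_2}W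 P^{-1}v(\lambda_2)\right)+o(n^{\sigma_2})$$ equals $W_m^{B\text{-tree}}$ almost surely. The law of $W_m^{B\text{-tree}}$ is the unique solution of (D)$_{\lambda_2}$ with mean $m!/\Gamma(m+\lambda_2)$ and finite second moment. **(iii)** Let $(L(t))_{t\ge0}$ be the continuous-time fringe node process with $L(0)=e_1$, i.e. the right-continuous Markov jump process which jumps from $x$ to $x+w_k$ at rate $(m+k-1)x_k$, $1\le k\le m$. Then $e^{-\lambda_2t}\,u(\lambda_2)(PL(t))$ converges almost surely, as $t\to\infty$, to a complex random variable $\mathcal W^{CT}$. Any $W$ such that, almost surely as $t\to\infty$, for some real random $\xi$ and with scalar real factors $1+o(1)$, $$L(t)=e^t\xi P^{-1}v(1)(1+o(1))+2\Re\left(e^{\lambda_2t}W P^{-1}v(\lambda_2)\right)(1+o(1))+o(e^{\sigma_2t})$$ equals $\mathcal W^{CT}$ almost surely. The law of $\mathcal W^{CT}$ is the unique solution of (C)$_{\lambda_2}$ with mean $m$ and finite second moment. -/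

import Mathlib

open MeasureTheory ProbabilityTheory Filter Topology Asymptotics
open scoped NNReal ENNReal Nat

namespace BTreeUrn

noncomputable section

/-- `χ_m(X) = ∏_{k=m}^{2m-1} (X + k) - (2m)! / m!`. -/
def chi (m : ℕ) : Polynomial ℂ :=
  (∏ k ∈ Finset.Ico m (2 * m), (Polynomial.X + Polynomial.C (k : ℂ)))
    - Polynomial.C (((2 * m)! : ℂ) / (m ! : ℂ))

/-- `l` is the root of `χ_m` with the second largest real part (the largest one being the real part
of the root `1`) and with positive imaginary part. -/
def IsLambda2 (m : ℕ) (l : ℂ) : Prop :=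
  (chi m).IsRoot l ∧ 0 < l.im ∧ ∀ z : ℂ, (chi m).IsRoot z → z ≠ 1 → z.re ≤ l.re

/-! ### The two smoothing equations -/

/-- Probability laws on `ℂ` with mean `A` and finite second moment. -/
def M2 (A : ℂ) : Set (Measure ℂ) :=
  {μ | IsProbabilityMeasure μ ∧ MemLp (fun z : ℂ => z) 2 μ ∧ ∫ z, z ∂μ = A}

/-- The Dirichlet law with parameters `(m, m)`, i.e. the law of `(B, 1 - B)`, `B ∼ Beta(m, m)`. -/
def dirichletLaw (m : ℕ) : Measure (ℝ × ℝ) :=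
  (betaMeasure (m : ℝ) (m : ℝ)).map (fun b => (b, 1 - b))

/-- The law of `B₁ ^ l * W₁ + B₂ ^ l * W₂`, where `(B₁, B₂) ∼ Dirichlet(m, m)`, `W₁ ∼ μ` and `W₂ ∼ μ`
are independent. -/
def smoothDirichlet (m : ℕ) (l : ℂ) (μ : Measure ℂ) : Measure ℂ :=
  ((dirichletLaw m).prod (μ.prod μ)).map
    (fun p => (p.1.1 : ℂ) ^ l * p.2.1 + (p.1.2 : ℂ) ^ l * p.2.2)

/-- The law of `B ^ l * (W₁ + W₂)`, where `B ∼ Beta(m, m)`, `W₁ ∼ μ` and `W₂ ∼ μ` are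
independent. -/
def smoothBeta (m : ℕ) (l : ℂ) (μ : Measure ℂ) : Measure ℂ :=
  ((betaMeasure (m : ℝ) (m : ℝ)).prod (μ.prod μ)).map
    (fun p => (p.1 : ℂ) ^ l * (p.2.1 + p.2.2))

/-! ### The fringe node processes

Fringe nodes of type `k ∈ {1, …, m}` are indexed by `i = k - 1 : Fin m`; such a node has
`m + k - 1 = m + i` gaps. -/

/-- The increment `w_k`: `-e_k + e_{k+1}` for `k < m`, and `-e_m + 2 e_1` for `k = m`. -/
def incr (m : ℕ) (i : Fin m) : Fin m → ℤ := fun j =>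
  (if j = i then -1 else 0) + (if (j : ℕ) = i + 1 then 1 else 0)
    + (if (i : ℕ) + 1 = m ∧ (j : ℕ) = 0 then 2 else 0)

/-- The vector `e_1 = (1, 0, …, 0)`: a single fringe node, of type `1`. -/
def e1 (m : ℕ) : Fin m → ℤ := fun i => if (i : ℕ) = 0 then 1 else 0

/-- Number of gaps of type `i`; also the total rate of the clocks of the particles of type `i`. -/
def gaps {m : ℕ} (x : Fin m → ℤ) (i : Fin m) : ℝ := ((m : ℝ) + (i : ℕ)) * (x i : ℝ)

/-- Total number of gaps. -/
def totalGaps {m : ℕ} (x : Fin m → ℤ) : ℝ := ∑ i, gaps x i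

/-- The discrete-time fringe node process started from `V`: the Markov chain that jumps from
`x` to `x + w_k` with probability `(m + k - 1) x_k / K`, where `K` is the total number of gaps. -/
structure IsFringeChain {Ω : Type*} [MeasurableSpace Ω] (P : Measure Ω) (m : ℕ)
    (V : Fin m → ℤ) (L : ℕ → Ω → Fin m → ℤ) : Prop where
  measurable : ∀ n, Measurable (L n)
  init : ∀ᵐ ω ∂P, L 0 ω = V
  step : ∀ (n : ℕ) (i : Fin m) (A : Set (Fin (n + 1) → Fin m → ℤ)), MeasurableSet A →
    P {ω | (fun a : Fin (n + 1) => L a ω) ∈ A ∧ L (n + 1) ω = L n ω + incr m i}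
      = ∫⁻ ω in {ω | (fun a : Fin (n + 1) => L a ω) ∈ A},
          ENNReal.ofReal (gaps (L n ω) i / totalGaps (L n ω)) ∂P

/-- The continuous-time fringe node process started from `V`: the right-continuous Markov jump
process with generator `f ↦ (x ↦ ∑_k (m + k - 1) x_k (f (x + w_k) - f x))`, described by its jump times
`T n` and its successive states `Y n`. Given the past up to the `n`-th jump, the waiting time until
the next jump is exponential with parameter the total rate `q = ∑_k (m + k - 1) x_k` of the current
state `x = Y n`, and, independently, the next state is `x + w_k` with probability
`(m + k - 1) x_k / q`. -/
structure IsFringeJumpProcess {Ω : Type*} [MeasurableSpace Ω] (P : Measure Ω) (m : ℕ)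
    (V : Fin m → ℤ) (X : ℝ≥0 → Ω → Fin m → ℤ) : Prop where
  measurable : ∀ t, Measurable (X t)
  jumps : ∃ (T : ℕ → Ω → ℝ) (Y : ℕ → Ω → Fin m → ℤ),
    (∀ n, Measurable (T n)) ∧ (∀ n, Measurable (Y n)) ∧
    (∀ᵐ ω ∂P, T 0 ω = 0 ∧ Y 0 ω = V) ∧
    (∀ᵐ ω ∂P, ∀ (n : ℕ) (t : ℝ≥0), T n ω ≤ t → (t : ℝ) < T (n + 1) ω → X t ω = Y n ω) ∧
    ∀ (n : ℕ) (i : Fin m) (s : ℝ), 0 ≤ s →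
      ∀ A : Set (Fin (n + 1) → ℝ × (Fin m → ℤ)), MeasurableSet A →
        P {ω | (fun a : Fin (n + 1) => (T a ω, Y a ω)) ∈ A ∧
            s < T (n + 1) ω - T n ω ∧ Y (n + 1) ω = Y n ω + incr m i}
          = ∫⁻ ω in {ω | (fun a : Fin (n + 1) => (T a ω, Y a ω)) ∈ A},
              ENNReal.ofReal (Real.exp (-(totalGaps (Y n ω) * s))
                * (gaps (Y n ω) i / totalGaps (Y n ω))) ∂P

/-! ### Spectral data and the limit variables -/

/-- The linear form `u(l)`. -/
def uForm (m : ℕ) (l : ℂ) (x : Fin m → ℂ) : ℂ :=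
  ∑ i : Fin m, (∏ j ∈ Finset.range i, (l + m + j) / (1 + m + j)) * x i

/-- `H_{m+1}(X) = ∑_{k=1}^m 1 / (X + k)`. -/
def harm (m : ℕ) (X : ℂ) : ℂ := ∑ k ∈ Finset.Icc 1 m, 1 / (X + k)

/-- The vector `v(l)`. -/
def vVec (m : ℕ) (l : ℂ) (i : Fin m) : ℂ :=
  1 / ((m + l) * harm m (m + l - 1)) * ∏ j ∈ Finset.Icc 1 (i : ℕ), ((m : ℂ) + j) / (m + j + l)

/-- The coordinates of `P⁻¹ v(l)`, with `P = Diag(m, m + 1, …, 2m - 1)`. -/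
def pInvV (m : ℕ) (l : ℂ) (i : Fin m) : ℂ := vVec m l i / ((m : ℂ) + (i : ℕ))

/-- `u(l)(P x)`: the form `u(l)` evaluated at the gap composition vector of `x`. -/
def uGap (m : ℕ) (l : ℂ) (x : Fin m → ℤ) : ℂ := uForm m l (fun i => (gaps x i : ℂ))

/-- `W = lim n ^ (-l) u(l)(P L_n)` almost surely. -/
def IsDiscreteLimit {Ω : Type*} [MeasurableSpace Ω] (P : Measure Ω) (m : ℕ) (l : ℂ)
    (L : ℕ → Ω → Fin m → ℤ) (W : Ω → ℂ) : Prop :=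
  ∀ᵐ ω ∂P, Tendsto (fun n : ℕ => (n : ℂ) ^ (-l) * uGap m l (L n ω)) atTop (𝓝 (W ω))

/-- `L_n = n P⁻¹ v(1) + 2 Re (n ^ l W P⁻¹ v(l)) + o(n ^ Re l)` almost surely. -/
def HasDiscreteExpansion {Ω : Type*} [MeasurableSpace Ω] (P : Measure Ω) (m : ℕ) (l : ℂ)
    (L : ℕ → Ω → Fin m → ℤ) (W : Ω → ℂ) : Prop :=
  ∀ᵐ ω ∂P, ∀ i : Fin m,
    (fun n : ℕ => (L n ω i : ℂ) - (n * pInvV m 1 i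
        + 2 * (((n : ℂ) ^ l * W ω * pInvV m l i).re : ℂ)))
      =o[atTop] (fun n : ℕ => (n : ℝ) ^ l.re)

/-- `W = lim e ^ (-l t) u(l)(P L(t))` almost surely. -/
def IsContinuousLimit {Ω : Type*} [MeasurableSpace Ω] (P : Measure Ω) (m : ℕ) (l : ℂ)
    (X : ℝ≥0 → Ω → Fin m → ℤ) (W : Ω → ℂ) : Prop :=
  ∀ᵐ ω ∂P, Tendsto (fun t : ℝ≥0 => Complex.exp (-(l * (t : ℝ))) * uGap m l (X t ω)) atTop
    (𝓝 (W ω))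

/-- `L(t) = e ^ t ξ P⁻¹ v(1) (1 + o(1)) + 2 Re (e ^ (l t) W P⁻¹ v(l)) (1 + o(1)) + o(e ^ (t Re l))`
almost surely, for some random `ξ`; the factors `1 + o(1)` are scalar. -/
def HasContinuousExpansion {Ω : Type*} [MeasurableSpace Ω] (P : Measure Ω) (m : ℕ) (l : ℂ)
    (X : ℝ≥0 → Ω → Fin m → ℤ) (W : Ω → ℂ) : Prop :=
  ∀ᵐ ω ∂P, ∃ (ξ : ℝ) (a b : ℝ≥0 → ℝ), Tendsto a atTop (𝓝 0) ∧ Tendsto b atTop (𝓝 0) ∧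
    ∀ i : Fin m,
      (fun t : ℝ≥0 => (X t ω i : ℂ)
          - ((Real.exp t * ξ * (1 + a t) : ℝ) * pInvV m 1 i
            + 2 * ((Complex.exp (l * (t : ℝ)) * W ω * pInvV m l i).re : ℂ) * ((1 + b t : ℝ) : ℂ)))
        =o[atTop] (fun t : ℝ≥0 => Real.exp (l.re * t))

end

end BTreeUrn

namespace BTreeUrn

noncomputable section

open ComplexConjugate

/-! Both equations are instances of `W = a₁ W₁ + a₂ W₂` in law. A root of `χ_m` is exactly an
exponent with `E B^λ = 1/2`, so `E (a₁ + a₂) = 1` and the mean is preserved; and `Re λ > 1/2` gives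
`E |B^λ|² < E B = 1/2`, so `q = E |a₁|² + E |a₂|² < 1`. Two solutions with the same mean have
characteristic functions differing by `O(|z|²)`, and each use of the equation multiplies the
constant by `q`: this is uniqueness (`smooth_unique`). Existence (`smooth_exists`) is an
L²-contraction on a probability space that contains a root weight and two independent copies of
itself.

For `m ≥ 60` a second root with real part above `1/2` is found by following the curve on which `∏ (m
+ z + k)` has argument `2π`. On it the modulus is too small at `Re z = 1/2` and large enough at `Re
z = 1` (`exists_root_re_gt_half`). Monotonicity of the modulus in `Re z` and `|Im z|` then singles
out `λ₂`.

The form `u(λ)` is a left eigenvector of the urn, so `u(λ)(P L_n)` divided by a product of Gamma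
type is a martingale, bounded in L² because `Re λ > 1/2` (`IsFringeChain.exists_limit`).
Biorthogonality of the `u` and `v` shows that any `W` in an asymptotic expansion is this limit.

The Dirichlet equation for the limit comes from branching. From `e₁` the first `m` steps lead
deterministically to `2 e₁`, and then two independent urns compete like the colours of a Pólya urn
started from `(m, m)`; the numbers of steps they receive are Beta-binomial. For characters of the
state space this is an exact identity between iterates of the kernel
(`iterate_kern_add_eq_integral`), and the limit `n → ∞` is Bernstein approximation
(`IsFringeChain.charFun_limit`).

In continuous time the total rate after `n` jumps is the deterministic number `m + n`, so jump times
and jump chain are independent. Moreover `log n - T_n` converges to the logarithm `X` of a Gamma(m)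
variable, and the limit is `e^{λX} D` with `D` the discrete limit, independent of `X`. The equation
(C) follows from (D) by the beta-gamma identity: `(B ξ₁, B ξ₂)` and `(B ξ, (1 - B) ξ)` have the same
law (`smoothBeta_exp_mul`). -/

/-- The law of `a₁ * W₁ + a₂ * W₂`, where `(a₁, a₂) ∼ κ`, `W₁ ∼ μ` and `W₂ ∼ μ` are independent. -/
def smooth (κ : Measure (ℂ × ℂ)) (μ : Measure ℂ) : Measure ℂ :=
  (κ.prod (μ.prod μ)).map (fun p => p.1.1 * p.2.1 + p.1.2 * p.2.2)

/-! ### Uniqueness of fixed points, by characteristic functions -/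

lemma inner_mul_left_eq (a w z : ℂ) : inner ℝ (a * w) z = inner ℝ w (conj a * z) := by
  simp only [Complex.inner, map_mul]
  congr 1
  ring

lemma charFun_smooth (κ : Measure (ℂ × ℂ)) [IsProbabilityMeasure κ] (μ : Measure ℂ)
    [IsProbabilityMeasure μ] (z : ℂ) :
    charFun (smooth κ μ) z = ∫ a, charFun μ (conj a.1 * z) * charFun μ (conj a.2 * z) ∂κ := by
  rw [smooth, charFun_apply, integral_map (by fun_prop) (by fun_prop), integral_prod]
  · refine integral_congr_ae (Eventually.of_forall fun a => ?_)
    simp only [charFun_apply]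
    rw [← integral_prod_mul]
    refine integral_congr_ae (Eventually.of_forall fun w => ?_)
    simp only
    rw [inner_add_left, inner_mul_left_eq, inner_mul_left_eq, Complex.ofReal_add, add_mul,
      Complex.exp_add]
  · refine Integrable.of_bound (by fun_prop) 1 (Eventually.of_forall fun p => ?_)
    rw [Complex.norm_exp_ofReal_mul_I]

instance isProbabilityMeasure_smooth (κ : Measure (ℂ × ℂ)) [IsProbabilityMeasure κ]
    (μ : Measure ℂ) [IsProbabilityMeasure μ] : IsProbabilityMeasure (smooth κ μ) :=
  Measure.isProbabilityMeasure_map (by fun_prop)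

lemma norm_exp_mul_I_sub_le (x : ℝ) : ‖Complex.exp (x * Complex.I) - 1 - x * Complex.I‖ ≤ 3 * x ^ 2 := by
  rcases le_or_gt |x| 1 with h | h
  · have := Complex.norm_exp_sub_one_sub_id_le (x := x * Complex.I) (by simpa using h)
    simp only [norm_mul, Complex.norm_real, Complex.norm_I, mul_one, Real.norm_eq_abs,
      sq_abs] at this
    nlinarith [sq_nonneg x]
  · calc _ ≤ ‖Complex.exp (x * Complex.I)‖ + ‖(1 : ℂ)‖ + ‖(x * Complex.I : ℂ)‖ :=
        (norm_sub_le _ _).trans (add_le_add (norm_sub_le _ _) le_rfl)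
      _ = 2 + |x| := by
        rw [Complex.norm_exp_ofReal_mul_I]; simp; norm_num
      _ ≤ 3 * x ^ 2 := by rw [← sq_abs]; nlinarith

/-- Since the first-order term depends on the mean alone, two laws in `M2 A` have characteristic
functions differing by `O(‖z‖²)`; the value of the constant plays no role. -/
lemma norm_charFun_sub_le {A : ℂ} {μ : Measure ℂ} (hμ : μ ∈ M2 A) (z : ℂ) :
    ‖charFun μ z - 1 - (inner ℝ A z : ℝ) * Complex.I‖ ≤ 3 * (∫ w, ‖w‖ ^ 2 ∂μ) * ‖z‖ ^ 2 := by
  obtain ⟨hp, hL, hA⟩ := hμ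
  have hint : Integrable (fun w : ℂ => w) μ := hL.integrable (by norm_num)
  have h2 : Integrable (fun w : ℂ => ‖w‖ ^ 2) μ := hL.integrable_norm_pow (by norm_num)
  have hin : Integrable (fun w : ℂ => ((inner ℝ w z : ℝ) : ℂ) * Complex.I) μ :=
    ((hint.inner_const z).ofReal).mul_const _
  have he : Integrable (fun w : ℂ => Complex.exp ((inner ℝ w z : ℝ) * Complex.I)) μ := by
    refine Integrable.of_bound (by fun_prop) 1 (Eventually.of_forall fun p => ?_)
    rw [Complex.norm_exp_ofReal_mul_I]
  have hA' : ∫ w : ℂ, ((inner ℝ w z : ℝ) : ℂ) * Complex.I ∂μ = (inner ℝ A z : ℝ) * Complex.I := by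
    rw [integral_mul_const, integral_complex_ofReal]
    congr 2
    rw [← hA, real_inner_comm, ← integral_inner hint z]
    simp only [real_inner_comm]
  have : charFun μ z - 1 - (inner ℝ A z : ℝ) * Complex.I
      = ∫ w : ℂ, (Complex.exp ((inner ℝ w z : ℝ) * Complex.I) - 1
        - (inner ℝ w z : ℝ) * Complex.I) ∂μ := by
    have e := integral_sub (he.sub (integrable_const (1 : ℂ))) hin
    simp only [Pi.sub_apply] at e
    rw [e, integral_sub he (integrable_const _), hA', charFun_apply]
    simp
  rw [this]
  calc _ ≤ ∫ w : ℂ, 3 * ‖z‖ ^ 2 * ‖w‖ ^ 2 ∂μ := by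
        refine norm_integral_le_of_norm_le (h2.const_mul _) (Eventually.of_forall fun w => ?_)
        refine (norm_exp_mul_I_sub_le _).trans ?_
        have := abs_real_inner_le_norm w z
        have h3 : (inner ℝ w z : ℝ) ^ 2 ≤ (‖w‖ * ‖z‖) ^ 2 := by
          rw [← sq_abs]; gcongr
        nlinarith
    _ = _ := by rw [integral_const_mul]; ring

lemma norm_mul_sub_mul_le {a b c d : ℂ} (ha : ‖a‖ ≤ 1) (hd : ‖d‖ ≤ 1) :
    ‖a * b - c * d‖ ≤ ‖b - d‖ + ‖a - c‖ := by
  have : a * b - c * d = a * (b - d) + (a - c) * d := by ring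
  rw [this]
  refine (norm_add_le _ _).trans (add_le_add ?_ ?_) <;> rw [norm_mul]
  · exact mul_le_of_le_one_left (norm_nonneg _) ha
  · exact mul_le_of_le_one_right (norm_nonneg _) hd

/-- The equation sends a bound `D ‖z‖²` on the difference of the characteristic functions to `q D
‖z‖²`, because products of numbers of modulus at most one are 1-Lipschitz in each factor. Iterating
from the bound given by the equal means leaves zero. -/
lemma smooth_unique {κ : Measure (ℂ × ℂ)} [IsProbabilityMeasure κ]
    (h1 : Integrable (fun a : ℂ × ℂ => ‖a.1‖ ^ 2) κ) (h2 : Integrable (fun a : ℂ × ℂ => ‖a.2‖ ^ 2) κ)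
    (hq : ∫ a, ‖a.1‖ ^ 2 ∂κ + ∫ a, ‖a.2‖ ^ 2 ∂κ < 1) {A : ℂ} {μ ν : Measure ℂ}
    (hμ : μ ∈ M2 A) (hν : ν ∈ M2 A) (eμ : smooth κ μ = μ) (eν : smooth κ ν = ν) : μ = ν := by
  have := hμ.1
  have := hν.1
  set q := ∫ a, ‖a.1‖ ^ 2 ∂κ + ∫ a, ‖a.2‖ ^ 2 ∂κ with hqdef
  have hq0 : 0 ≤ q := add_nonneg (integral_nonneg fun _ => by positivity)
    (integral_nonneg fun _ => by positivity)
  have step : ∀ D : ℝ, (∀ z, ‖charFun μ z - charFun ν z‖ ≤ D * ‖z‖ ^ 2) →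
      ∀ z, ‖charFun μ z - charFun ν z‖ ≤ q * D * ‖z‖ ^ 2 := by
    intro D hD z
    have hi : ∀ ρ : Measure ℂ, IsProbabilityMeasure ρ → Integrable (fun a : ℂ × ℂ =>
        charFun ρ (conj a.1 * z) * charFun ρ (conj a.2 * z)) κ := by
      intro ρ hρ
      refine Integrable.of_bound ?_ 1 (Eventually.of_forall fun a => ?_)
      · have := measurable_charFun (μ := ρ)
        have hm : ∀ f : ℂ × ℂ → ℂ, Measurable f → Measurable fun a => charFun ρ (conj (f a) * z) :=
          fun f hf => this.comp (by fun_prop)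
        exact ((hm _ measurable_fst).mul (hm _ measurable_snd)).aestronglyMeasurable
      · rw [norm_mul]
        exact mul_le_one₀ (norm_charFun_le_one _) (norm_nonneg _) (norm_charFun_le_one _)
    rw [← eμ, ← eν, charFun_smooth, charFun_smooth, ← integral_sub (hi μ inferInstance) (hi ν inferInstance)]
    calc _ ≤ ∫ a, (D * ‖z‖ ^ 2 * ‖a.2‖ ^ 2 + D * ‖z‖ ^ 2 * ‖a.1‖ ^ 2) ∂κ := by
          refine norm_integral_le_of_norm_le ((h2.const_mul _).add (h1.const_mul _))
            (Eventually.of_forall fun a => ?_)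
          refine (norm_mul_sub_mul_le (norm_charFun_le_one _) (norm_charFun_le_one _)).trans ?_
          refine (add_le_add (hD _) (hD _)).trans (le_of_eq ?_)
          simp only [norm_mul, RCLike.norm_conj]
          ring
      _ = _ := by
        rw [integral_add (h2.const_mul _) (h1.const_mul _), integral_const_mul,
          integral_const_mul, hqdef]
        ring
  obtain ⟨D, hD⟩ : ∃ D : ℝ, ∀ z, ‖charFun μ z - charFun ν z‖ ≤ D * ‖z‖ ^ 2 := by
    refine ⟨3 * (∫ w, ‖w‖ ^ 2 ∂μ) + 3 * (∫ w, ‖w‖ ^ 2 ∂ν), fun z => ?_⟩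
    have e : charFun μ z - charFun ν z = (charFun μ z - 1 - (inner ℝ A z : ℝ) * Complex.I)
      - (charFun ν z - 1 - (inner ℝ A z : ℝ) * Complex.I) := by ring
    rw [e, add_mul]
    exact (norm_sub_le _ _).trans
      (add_le_add (norm_charFun_sub_le hμ z) (norm_charFun_sub_le hν z))
  have hn : ∀ n : ℕ, ∀ z, ‖charFun μ z - charFun ν z‖ ≤ q ^ n * D * ‖z‖ ^ 2 := by
    intro n
    induction n with
    | zero => simpa using hD
    | succ n ih =>
      intro z
      refine (step _ ih z).trans (le_of_eq ?_)
      ring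
  refine Measure.ext_of_charFun (funext fun z => ?_)
  have ht : Tendsto (fun n : ℕ => q ^ n * D * ‖z‖ ^ 2) atTop (𝓝 (0 * D * ‖z‖ ^ 2)) :=
    ((tendsto_pow_atTop_nhds_zero_of_lt_one hq0 hq).mul_const _).mul_const _
  have := ge_of_tendsto' ht fun n => hn n z
  rw [zero_mul, zero_mul] at this
  exact sub_eq_zero.mp (norm_le_zero_iff.mp this)

/-! ### Existence of fixed points, by an L² iteration on a self-similar space -/

/-- The space of independent weights carries a root weight and two independent copies of itself. -/
lemma exists_branching_space {E : Type*} [MeasurableSpace E] (κ : Measure E) [IsProbabilityMeasure κ] :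
    ∃ (P : Measure (ℕ → E)) (a : (ℕ → E) → E) (l r : (ℕ → E) → (ℕ → E)),
      IsProbabilityMeasure P ∧ Measurable a ∧ Measurable l ∧ Measurable r ∧
      P.map (fun ω => (a ω, (l ω, r ω))) = κ.prod (P.prod P) := by
  let P : Measure (ℕ → E) := Measure.infinitePi fun _ => κ
  -- The injection selects three disjoint infinite families of coordinates. Of family 0 only the
  -- first coordinate serves, as the root weight; families 1 and 2 are the two copies of the whole
  -- space.
  obtain ⟨f⟩ : Nonempty ((Fin 3 × ℕ) ↪ ℕ) := ⟨Encodable.encode' _⟩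
  let X : Fin 3 → (ℕ → E) → (ℕ → E) := fun i ω j => ω (f (i, j))
  have hX : ∀ i, Measurable (X i) := fun i => by fun_prop
  have hlaw : ∀ i, P.map (X i) = P := fun i => by
    have hinj : Function.Injective fun j => f (i, j) := fun j k h => by
      simpa using f.injective h
    exact Measure.map_infinitePi_infinitePi_of_inj (P := fun _ : ℕ => κ) hinj
  have hind : iIndepFun X P := by
    rw [iIndepFun_iff_map_fun_eq_infinitePi_map hX]
    simp_rw [hlaw]
    have h1 := Measure.map_infinitePi_infinitePi_of_inj (P := fun _ : ℕ => κ) f.injective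
    have h2 := Measure.infinitePi_map_curry (fun (_ : Fin 3) (_ : ℕ) => κ)
    rw [← h1, Measure.map_map (by fun_prop) (by fun_prop)] at h2
    exact h2
  refine ⟨P, fun ω => X 0 ω 0, X 1, X 2, inferInstance, by fun_prop, hX 1, hX 2, ?_⟩
  have hi : IndepFun (X 0) (fun ω => (X 1 ω, X 2 ω)) P :=
    (hind.indepFun_prodMk hX 1 2 0 (by decide) (by decide)).symm
  have hi' : IndepFun (fun ω => X 0 ω 0) (fun ω => (X 1 ω, X 2 ω)) P :=
    hi.comp (measurable_pi_apply 0) measurable_id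
  rw [hi'.map_prod_eq_prod_map_map (by fun_prop) (by fun_prop),
    (hind.indepFun (i := 1) (j := 2) (by decide)).map_prod_eq_prod_map_map (by fun_prop)
      (by fun_prop), hlaw, hlaw]
  congr 1
  have : (fun ω : ℕ → E => X 0 ω 0) = (fun w : ℕ → E => w 0) ∘ X 0 := rfl
  rw [this, ← Measure.map_map (by fun_prop) (hX 0), hlaw]
  exact Measure.infinitePi_map_eval (fun _ : ℕ => κ) 0

lemma integral_prod_mul_mul {X Y Z : Type*} [MeasurableSpace X] [MeasurableSpace Y]
    [MeasurableSpace Z] {κ : Measure X} {P : Measure Y} {Q : Measure Z} [SFinite κ] [SFinite P]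
    [SFinite Q] (f : X → ℂ) (g : Y → ℂ) (h : Z → ℂ) :
    ∫ p, f p.1 * (g p.2.1 * h p.2.2) ∂(κ.prod (P.prod Q))
      = (∫ x, f x ∂κ) * ((∫ y, g y ∂P) * ∫ z, h z ∂Q) := by
  rw [← integral_prod_mul, ← integral_prod_mul f (fun p : Y × Z => g p.1 * h p.2)]

lemma memLp_two_mul_prod {X Y : Type*} [MeasurableSpace X] [MeasurableSpace Y]
    {κ : Measure X} {P : Measure Y} [SFinite P] {f : X → ℂ} {g : Y → ℂ} (hf : MemLp f 2 κ) (hg : MemLp g 2 P) :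
    MemLp (fun p : X × Y => f p.1 * g p.2) 2 (κ.prod P) := by
  have hm : AEStronglyMeasurable (fun p : X × Y => f p.1 * g p.2) (κ.prod P) :=
    hf.1.comp_fst.mul hg.1.comp_snd
  rw [memLp_two_iff_integrable_sq_norm hm]
  refine ((hf.integrable_norm_pow (by norm_num)).mul_prod
    (hg.integrable_norm_pow (by norm_num))).congr (Eventually.of_forall fun p => ?_)
  simp [mul_pow]

section Step

variable {X Y : Type*} [MeasurableSpace X] [MeasurableSpace Y] {κ : Measure X} {P : Measure Y}
  [IsProbabilityMeasure P] {a b : X → ℂ} {h : Y → ℂ}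

/-- The linear combination of two copies of `h` with random weights `a` and `b`. -/
def weighted (a b : X → ℂ) (h : Y → ℂ) (p : X × Y × Y) : ℂ := a p.1 * h p.2.1 + b p.1 * h p.2.2

lemma memLp_weighted (ha : MemLp a 2 κ) (hb : MemLp b 2 κ) (hh : MemLp h 2 P) :
    MemLp (weighted a b h) 2 (κ.prod (P.prod P)) :=
  (memLp_two_mul_prod ha (hh.comp_fst P)).add (memLp_two_mul_prod hb (hh.comp_snd P))

lemma integral_weighted [IsFiniteMeasure κ] (ha : MemLp a 2 κ) (hb : MemLp b 2 κ) (hh : MemLp h 2 P) :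
    ∫ p, weighted a b h p ∂(κ.prod (P.prod P)) = (∫ x, a x + b x ∂κ) * ∫ y, h y ∂P := by
  have h1 := (memLp_two_mul_prod ha (hh.comp_fst P)).integrable (by norm_num)
  have h2 := (memLp_two_mul_prod hb (hh.comp_snd P)).integrable (by norm_num)
  unfold weighted
  rw [integral_add h1 h2, integral_add (ha.integrable (by norm_num)) (hb.integrable (by norm_num)),
    integral_prod_mul a (fun p : Y × Y => h p.1), integral_prod_mul b (fun p : Y × Y => h p.2),
    integral_fun_fst, integral_fun_snd]
  simp [add_mul]

/-- The cross term factors by independence and contains `∫ h = 0`; centring is what turns the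
weights into a contraction by `q`. -/
lemma integral_norm_sq_weighted [IsFiniteMeasure κ] (ha : MemLp a 2 κ) (hb : MemLp b 2 κ) (hh : MemLp h 2 P)
    (h0 : ∫ y, h y ∂P = 0) :
    ∫ p, ‖weighted a b h p‖ ^ 2 ∂(κ.prod (P.prod P))
      = (∫ x, ‖a x‖ ^ 2 ∂κ + ∫ x, ‖b x‖ ^ 2 ∂κ) * ∫ y, ‖h y‖ ^ 2 ∂P := by
  have m1 := memLp_two_mul_prod ha (hh.comp_fst P)
  have m2 := memLp_two_mul_prod hb (hh.comp_snd P)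
  have i1 := m1.integrable_norm_pow (p := 2) (by norm_num)
  have i2 := m2.integrable_norm_pow (p := 2) (by norm_num)
  have hc : ∫ p : X × Y × Y, (a p.1 * h p.2.1) * conj (b p.1 * h p.2.2) ∂(κ.prod (P.prod P))
      = 0 := by
    have : ∀ p : X × Y × Y, (a p.1 * h p.2.1) * conj (b p.1 * h p.2.2)
        = (a p.1 * conj (b p.1)) * (h p.2.1 * conj (h p.2.2)) := fun p => by
      rw [map_mul]; ring
    simp_rw [this]
    rw [integral_prod_mul_mul (fun x => a x * conj (b x)) h (fun y => conj (h y)), h0]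
    simp
  have i3 : Integrable (fun p : X × Y × Y => (a p.1 * h p.2.1) * conj (b p.1 * h p.2.2))
      (κ.prod (P.prod P)) := m1.integrable_mul m2.star
  have e : ∀ p : X × Y × Y, ‖weighted a b h p‖ ^ 2 = ‖a p.1 * h p.2.1‖ ^ 2
      + ‖b p.1 * h p.2.2‖ ^ 2 + 2 * ((a p.1 * h p.2.1) * conj (b p.1 * h p.2.2)).re := fun p => by
    unfold weighted
    rw [← Complex.normSq_eq_norm_sq, Complex.normSq_add, Complex.normSq_eq_norm_sq,
      Complex.normSq_eq_norm_sq]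
  simp_rw [e]
  have hre : ∫ p : X × Y × Y, ((a p.1 * h p.2.1) * conj (b p.1 * h p.2.2)).re ∂(κ.prod (P.prod P))
      = 0 := by
    have := integral_re i3
    simp only [RCLike.re_to_complex] at this
    rw [this, hc, Complex.zero_re]
  have i12 : Integrable (fun p : X × Y × Y => ‖a p.1 * h p.2.1‖ ^ 2 + ‖b p.1 * h p.2.2‖ ^ 2)
      (κ.prod (P.prod P)) := i1.add i2
  have i4 : Integrable (fun p : X × Y × Y =>
      2 * ((a p.1 * h p.2.1) * conj (b p.1 * h p.2.2)).re) (κ.prod (P.prod P)) := i3.re.const_mul 2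
  rw [integral_add i12 i4, integral_add i1 i2, integral_const_mul, hre]
  simp only [norm_mul, mul_pow]
  rw [integral_prod_mul (fun x => ‖a x‖ ^ 2) (fun p : Y × Y => ‖h p.1‖ ^ 2),
    integral_prod_mul (fun x => ‖b x‖ ^ 2) (fun p : Y × Y => ‖h p.2‖ ^ 2),
    integral_fun_fst (fun y => ‖h y‖ ^ 2), integral_fun_snd (fun y => ‖h y‖ ^ 2)]
  simp [add_mul]

end Step

section SquareIntegrable

variable {Ω : Type*} [MeasurableSpace Ω] {P : Measure Ω}

lemma integral_norm_le_sqrt [IsProbabilityMeasure P] {f : Ω → ℂ} (hf : MemLp f 2 P) :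
    ∫ ω, ‖f ω‖ ∂P ≤ √(∫ ω, ‖f ω‖ ^ 2 ∂P) := by
  have h1 := (hf.integrable (by norm_num)).norm
  have h2 := hf.integrable_norm_pow (p := 2) (by norm_num)
  apply Real.le_sqrt_of_sq_le
  set c := ∫ ω, ‖f ω‖ ∂P
  have h : 0 ≤ ∫ ω, (‖f ω‖ ^ 2 - 2 * c * ‖f ω‖ + c ^ 2) ∂P :=
    integral_nonneg fun ω => by
      have : ‖f ω‖ ^ 2 - 2 * c * ‖f ω‖ + c ^ 2 = (‖f ω‖ - c) ^ 2 := by ring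
      simp only [this]
      positivity
  have h12 : Integrable (fun ω => ‖f ω‖ ^ 2 - 2 * c * ‖f ω‖) P := h2.sub (h1.const_mul _)
  rw [integral_add h12 (integrable_const _), integral_sub h2 (h1.const_mul _),
    integral_const_mul] at h
  simp only [integral_const, probReal_univ, one_smul] at h
  change 0 ≤ _ - 2 * c * c + c ^ 2 at h
  linarith

/-- Fatou's lemma applied to the squared norms. -/
lemma memLp_two_of_tendsto_ae {X : ℕ → Ω → ℂ} {Y : Ω → ℂ} {C : ℝ} (hX : ∀ n, MemLp (X n) 2 P)
    (hC : ∀ n, ∫ ω, ‖X n ω‖ ^ 2 ∂P ≤ C) (h : ∀ᵐ ω ∂P, Tendsto (fun n => X n ω) atTop (𝓝 (Y ω))) :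
    MemLp Y 2 P ∧ ∫ ω, ‖Y ω‖ ^ 2 ∂P ≤ C := by
  have hY : AEStronglyMeasurable Y P := aestronglyMeasurable_of_tendsto_ae _ (fun n => (hX n).1) h
  have hC0 : 0 ≤ C := (integral_nonneg fun ω => by positivity).trans (hC 0)
  have hl : ∫⁻ ω, ENNReal.ofReal (‖Y ω‖ ^ 2) ∂P ≤ ENNReal.ofReal C := by
    calc _ ≤ liminf (fun n => ∫⁻ ω, ENNReal.ofReal (‖X n ω‖ ^ 2) ∂P) atTop := by
          have : ∀ᵐ ω ∂P, ENNReal.ofReal (‖Y ω‖ ^ 2)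
              = liminf (fun n => ENNReal.ofReal (‖X n ω‖ ^ 2)) atTop := by
            filter_upwards [h] with ω hω
            exact ((ENNReal.tendsto_ofReal (hω.norm.pow 2)).liminf_eq).symm
          rw [lintegral_congr_ae this]
          exact lintegral_liminf_le' fun n => ((hX n).1.norm.aemeasurable.pow_const 2).ennreal_ofReal
      _ ≤ ENNReal.ofReal C := by
          refine liminf_le_of_le (by isBoundedDefault) fun b hb => ?_
          obtain ⟨n, hn⟩ := hb.exists
          refine hn.trans ?_
          rw [← ofReal_integral_eq_lintegral_ofReal ((hX n).integrable_norm_pow (by norm_num))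
            (Eventually.of_forall fun ω => by positivity)]
          exact ENNReal.ofReal_le_ofReal (hC n)
  have hi : Integrable (fun ω => ‖Y ω‖ ^ 2) P := by
    refine ⟨hY.norm.pow 2, ?_⟩
    rw [hasFiniteIntegral_iff_ofReal (Eventually.of_forall fun ω => by positivity)]
    exact hl.trans_lt ENNReal.ofReal_lt_top
  refine ⟨(memLp_two_iff_integrable_sq_norm hY).2 hi, ?_⟩
  rw [← ofReal_integral_eq_lintegral_ofReal hi (Eventually.of_forall fun ω => by positivity)] at hl
  exact (ENNReal.ofReal_le_ofReal_iff hC0).1 hl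

lemma le_min_add_sq_div {x K : ℝ} (hK : 0 < K) (hx : 0 ≤ x) : x ≤ min x K + x ^ 2 / K := by
  rcases le_total x K with h | h
  · rw [min_eq_left h]
    have : 0 ≤ x ^ 2 / K := by positivity
    linarith
  · have : x ≤ x ^ 2 / K := by rw [le_div_iff₀ hK]; nlinarith
    rw [min_eq_right h]
    linarith

/-- An L² bound gives uniform integrability: the truncation `min x K` is handled by dominated
convergence, and the excess is at most `x² / K`. -/
lemma tendsto_integral_norm_sub [IsProbabilityMeasure P] {X : ℕ → Ω → ℂ} {Y : Ω → ℂ} {C : ℝ} (hX : ∀ n, MemLp (X n) 2 P)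
    (hC : ∀ n, ∫ ω, ‖X n ω‖ ^ 2 ∂P ≤ C) (h : ∀ᵐ ω ∂P, Tendsto (fun n => X n ω) atTop (𝓝 (Y ω))) :
    Tendsto (fun n => ∫ ω, ‖X n ω - Y ω‖ ∂P) atTop (𝓝 0) := by
  obtain ⟨hY, hYC⟩ := memLp_two_of_tendsto_ae hX hC h
  have hC0 : 0 ≤ C := (integral_nonneg fun ω => by positivity).trans (hC 0)
  have hD : ∀ n, MemLp (fun ω => X n ω - Y ω) 2 P := fun n => (hX n).sub hY
  have hDC : ∀ n, ∫ ω, ‖X n ω - Y ω‖ ^ 2 ∂P ≤ 4 * C := fun n => by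
    have i1 := (hX n).integrable_norm_pow (p := 2) (by norm_num)
    have i2 := hY.integrable_norm_pow (p := 2) (by norm_num)
    calc _ ≤ ∫ ω, (2 * ‖X n ω‖ ^ 2 + 2 * ‖Y ω‖ ^ 2) ∂P := by
          refine integral_mono ((hD n).integrable_norm_pow (by norm_num))
            ((i1.const_mul 2).add (i2.const_mul 2)) fun ω => ?_
          have := norm_sub_le (X n ω) (Y ω)
          have h3 : ‖X n ω - Y ω‖ ^ 2 ≤ (‖X n ω‖ + ‖Y ω‖) ^ 2 := by gcongr
          simp only
          nlinarith [sq_nonneg (‖X n ω‖ - ‖Y ω‖)]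
      _ ≤ _ := by
          rw [integral_add (i1.const_mul 2) (i2.const_mul 2), integral_const_mul,
            integral_const_mul]
          linarith [hC n]
  rw [Metric.tendsto_atTop]
  intro ε hε
  -- Chosen so that `4 C / K ≤ ε / 2`, where `4 C` bounds the second moments of `X n - Y`; the `+ 1`
  -- keeps `K` positive when `C = 0`.
  set K := 8 * C / ε + 1 with hKdef
  have hK : 0 < K := by positivity
  have hCK : 4 * C / K ≤ ε / 2 := by
    rw [div_le_iff₀ hK, hKdef]
    field_simp
    nlinarith
  have hm : Tendsto (fun n => ∫ ω, min ‖X n ω - Y ω‖ K ∂P) atTop (𝓝 (∫ _, (0 : ℝ) ∂P)) := by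
    refine tendsto_integral_of_dominated_convergence (fun _ => K)
      (fun n => ((hD n).1.norm.aemeasurable.min aemeasurable_const).aestronglyMeasurable)
      (integrable_const _) (fun n => Eventually.of_forall fun ω => ?_) ?_
    · rw [Real.norm_of_nonneg (le_min (norm_nonneg _) hK.le)]
      exact min_le_right _ _
    · filter_upwards [h] with ω hω
      have h1 : Tendsto (fun n => ‖X n ω - Y ω‖) atTop (𝓝 0) := by
        simpa using (hω.sub_const (Y ω)).norm
      simpa [hK.le] using h1.min (tendsto_const_nhds (x := K))
  rw [integral_zero] at hm
  obtain ⟨N, hN⟩ := (Metric.tendsto_atTop.1 hm) (ε / 2) (by positivity)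
  refine ⟨N, fun n hn => ?_⟩
  have h1 := hN n hn
  rw [Real.dist_eq, sub_zero] at h1 ⊢
  rw [abs_of_nonneg (integral_nonneg fun ω => norm_nonneg _)]
  have i0 := ((hD n).integrable (by norm_num)).norm
  have i1 := (hD n).integrable_norm_pow (p := 2) (by norm_num)
  have i2 : Integrable (fun ω => min ‖X n ω - Y ω‖ K) P :=
    Integrable.inf i0 (integrable_const K)
  calc _ ≤ ∫ ω, (min ‖X n ω - Y ω‖ K + ‖X n ω - Y ω‖ ^ 2 / K) ∂P :=
        integral_mono i0 (i2.add (i1.div_const K)) fun ω => le_min_add_sq_div hK (norm_nonneg _)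
    _ = ∫ ω, min ‖X n ω - Y ω‖ K ∂P + (∫ ω, ‖X n ω - Y ω‖ ^ 2 ∂P) / K := by
        rw [integral_add i2 (i1.div_const K), integral_div]
    _ < ε / 2 + ε / 2 := by
        have h3 : (∫ ω, ‖X n ω - Y ω‖ ^ 2 ∂P) / K ≤ 4 * C / K := by gcongr; exact hDC n
        have := le_abs_self (∫ ω, min ‖X n ω - Y ω‖ K ∂P)
        linarith
    _ = ε := by ring

lemma tendsto_integral_of_sq_bounded [IsProbabilityMeasure P] {X : ℕ → Ω → ℂ} {Y : Ω → ℂ} {C : ℝ}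
    (hX : ∀ n, MemLp (X n) 2 P) (hC : ∀ n, ∫ ω, ‖X n ω‖ ^ 2 ∂P ≤ C)
    (h : ∀ᵐ ω ∂P, Tendsto (fun n => X n ω) atTop (𝓝 (Y ω))) :
    Tendsto (fun n => ∫ ω, X n ω ∂P) atTop (𝓝 (∫ ω, Y ω ∂P)) := by
  obtain ⟨hY, -⟩ := memLp_two_of_tendsto_ae hX hC h
  rw [tendsto_iff_norm_sub_tendsto_zero]
  refine squeeze_zero (fun n => norm_nonneg _) (fun n => ?_) (tendsto_integral_norm_sub hX hC h)
  rw [← integral_sub ((hX n).integrable (by norm_num)) (hY.integrable (by norm_num))]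
  exact norm_integral_le_integral_norm _

lemma ae_summable_norm_of_summable_integral {D : ℕ → Ω → ℂ} (hD : ∀ n, Integrable (D n) P)
    (hs : Summable fun n => ∫ ω, ‖D n ω‖ ∂P) : ∀ᵐ ω ∂P, Summable fun n => ‖D n ω‖ := by
  have h1 : ∫⁻ ω, ∑' n, ‖D n ω‖ₑ ∂P < ∞ := by
    rw [lintegral_tsum fun n => (hD n).1.enorm]
    have : ∀ n, ∫⁻ ω, ‖D n ω‖ₑ ∂P = ENNReal.ofReal (∫ ω, ‖D n ω‖ ∂P) := fun n =>
      (ofReal_integral_norm_eq_lintegral_enorm (hD n)).symm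
    simp_rw [this]
    rw [← ENNReal.ofReal_tsum_of_nonneg (fun n => integral_nonneg fun ω => norm_nonneg _) hs]
    exact ENNReal.ofReal_lt_top
  filter_upwards [ae_lt_top' (AEMeasurable.tsum fun n => (hD n).1.enorm) h1.ne]
    with ω hω
  have : Summable fun n => ‖D n ω‖₊ := ENNReal.tsum_coe_ne_top_iff_summable.1 hω.ne
  exact NNReal.summable_coe.2 this

end SquareIntegrable

lemma exists_bound_of_affine_le {x : ℕ → ℝ} {r c : ℝ} (hr0 : 0 ≤ r) (hr : r < 1)
    (hx : ∀ n, x (n + 1) ≤ r * x n + c) : ∃ C, ∀ n, x n ≤ C := by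
  refine ⟨max (x 0) (c / (1 - r)), fun n => ?_⟩
  induction n with
  | zero => exact le_max_left _ _
  | succ n ih =>
    refine (hx n).trans ?_
    have h1 : c / (1 - r) ≤ max (x 0) (c / (1 - r)) := le_max_right _ _
    have h2 : c ≤ max (x 0) (c / (1 - r)) * (1 - r) := (div_le_iff₀ (by linarith)).1 h1
    nlinarith [mul_le_mul_of_nonneg_left ih hr0]

lemma norm_add_sq_le_weighted {u v : ℂ} {ε : ℝ} (hε : 0 < ε) :
    ‖u + v‖ ^ 2 ≤ (1 + ε) * ‖u‖ ^ 2 + (1 + 1 / ε) * ‖v‖ ^ 2 := by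
  have h1 : ‖u + v‖ ^ 2 ≤ (‖u‖ + ‖v‖) ^ 2 := by gcongr; exact norm_add_le u v
  have h2 : 0 ≤ ε * (‖u‖ - ‖v‖ / ε) ^ 2 := by positivity
  have h3 : ε * (‖u‖ - ‖v‖ / ε) ^ 2 = ε * ‖u‖ ^ 2 - 2 * ‖u‖ * ‖v‖ + 1 / ε * ‖v‖ ^ 2 := by
    field_simp
    ring
  nlinarith

/-- Starting from the constant `A`, the linear operator `S` that combines the copies of a variable
on the two subtrees is iterated. It preserves means, so the increments are centred and their second
moments decay like `q ^ n`. The iterates converge almost surely, and the limit satisfies the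
equation pointwise. -/
lemma smooth_exists {κ : Measure (ℂ × ℂ)} [IsProbabilityMeasure κ]
    (h1 : MemLp (fun a : ℂ × ℂ => a.1) 2 κ) (h2 : MemLp (fun a : ℂ × ℂ => a.2) 2 κ)
    (hm : ∫ a, (a.1 + a.2) ∂κ = 1)
    (hq : ∫ a, ‖a.1‖ ^ 2 ∂κ + ∫ a, ‖a.2‖ ^ 2 ∂κ < 1) (A : ℂ) :
    ∃ μ ∈ M2 A, smooth κ μ = μ := by
  obtain ⟨P, a, l, r, hP, ha, hl, hr, hlaw⟩ := exists_branching_space κ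
  set q := ∫ a, ‖a.1‖ ^ 2 ∂κ + ∫ a, ‖a.2‖ ^ 2 ∂κ with hqdef
  have hq0 : 0 ≤ q := add_nonneg (integral_nonneg fun _ => by positivity)
    (integral_nonneg fun _ => by positivity)
  have hτm : Measurable fun ω => (a ω, (l ω, r ω)) := by fun_prop
  have hτ : MeasurePreserving (fun ω => (a ω, (l ω, r ω))) P (κ.prod (P.prod P)) := ⟨hτm, hlaw⟩
  have hlp : MeasurePreserving l P P :=
    (measurePreserving_fst.comp measurePreserving_snd).comp hτ
  have hrp : MeasurePreserving r P P :=
    (measurePreserving_snd.comp measurePreserving_snd).comp hτ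
  let S : ((ℕ → ℂ × ℂ) → ℂ) → (ℕ → ℂ × ℂ) → ℂ := fun h ω =>
    weighted Prod.fst Prod.snd h (a ω, (l ω, r ω))
  have Smeas : ∀ h, Measurable h → Measurable (S h) := fun h hh => by
    have : Measurable (weighted Prod.fst Prod.snd h : (ℂ × ℂ) × _ → ℂ) := by
      unfold weighted; fun_prop
    exact this.comp hτm
  have SL : ∀ h, MemLp h 2 P → MemLp (S h) 2 P := fun h hh =>
    (memLp_weighted h1 h2 hh).comp_measurePreserving hτ
  have Sint : ∀ h, MemLp h 2 P → ∫ ω, S h ω ∂P = ∫ ω, h ω ∂P := fun h hh => by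
    have e := integral_map (μ := P) hτm.aemeasurable (f := weighted Prod.fst Prod.snd h)
      (by rw [hlaw]; exact (memLp_weighted h1 h2 hh).1)
    rw [hlaw, integral_weighted h1 h2 hh, hm, one_mul] at e
    exact e.symm
  have Ssq : ∀ h, MemLp h 2 P → ∫ ω, h ω ∂P = 0 →
      ∫ ω, ‖S h ω‖ ^ 2 ∂P = q * ∫ ω, ‖h ω‖ ^ 2 ∂P := fun h hh h0 => by
    have e := integral_map (μ := P) hτm.aemeasurable
      (f := fun p => ‖weighted Prod.fst Prod.snd h p‖ ^ 2)
      (by rw [hlaw]; exact (memLp_weighted h1 h2 hh).1.norm.pow 2)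
    rw [hlaw, integral_norm_sq_weighted h1 h2 hh h0] at e
    exact e.symm
  let W : ℕ → (ℕ → ℂ × ℂ) → ℂ := fun n => Nat.rec (fun _ => A) (fun _ h => S h) n
  have W0 : W 0 = fun _ => A := rfl
  have Ws : ∀ n, W (n + 1) = S (W n) := fun n => rfl
  have Wm : ∀ n, Measurable (W n) := fun n => by
    induction n with
    | zero => exact measurable_const
    | succ n ih => exact Smeas _ ih
  have WL : ∀ n, MemLp (W n) 2 P := fun n => by
    induction n with
    | zero => exact memLp_const A
    | succ n ih => exact SL _ ih
  have WA : ∀ n, ∫ ω, W n ω ∂P = A := fun n => by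
    induction n with
    | zero => simp [W0]
    | succ n ih => rw [Ws, Sint _ (WL n), ih]
  have Ssub : ∀ g h ω, S g ω - S h ω = S (fun ω => g ω - h ω) ω := fun g h ω => by
    simp only [S, weighted]; ring
  let D : ℕ → (ℕ → ℂ × ℂ) → ℂ := fun n ω => W (n + 1) ω - W n ω
  have DL : ∀ n, MemLp (D n) 2 P := fun n => (WL (n + 1)).sub (WL n)
  have D0 : ∀ n, ∫ ω, D n ω ∂P = 0 := fun n => by
    simp only [D]
    rw [integral_sub ((WL (n + 1)).integrable (by norm_num)) ((WL n).integrable (by norm_num)),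
      WA (n + 1), WA n, sub_self]
  have Dsq : ∀ n, ∫ ω, ‖D n ω‖ ^ 2 ∂P = q ^ n * ∫ ω, ‖D 0 ω‖ ^ 2 ∂P := fun n => by
    induction n with
    | zero => simp
    | succ n ih =>
      have : D (n + 1) = S (D n) := funext fun ω => Ssub _ _ _
      rw [this, Ssq _ (DL n) (D0 n), ih]
      ring
  have Dsum : Summable fun n => ∫ ω, ‖D n ω‖ ∂P := by
    have hs : Summable fun n : ℕ => √q ^ n * √(∫ ω, ‖D 0 ω‖ ^ 2 ∂P) :=
      (summable_geometric_of_lt_one (Real.sqrt_nonneg _)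
        (by rw [Real.sqrt_lt' one_pos]; simpa using hq)).mul_right _
    refine Summable.of_nonneg_of_le (fun n => integral_nonneg fun _ => norm_nonneg _)
      (fun n => ?_) hs
    refine (integral_norm_le_sqrt (DL n)).trans (le_of_eq ?_)
    rw [Dsq, Real.sqrt_mul (by positivity), Real.sqrt_eq_rpow, Real.sqrt_eq_rpow q,
      ← Real.rpow_natCast, ← Real.rpow_natCast, ← Real.rpow_mul hq0, ← Real.rpow_mul hq0,
      mul_comm (n : ℝ)]
  obtain ⟨C, hC⟩ : ∃ C, ∀ n, ∫ ω, ‖W n ω - A‖ ^ 2 ∂P ≤ C := by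
    -- Any `ε > 0` with `(1 + ε) q < 1` would do; here `1 - (1 + ε) q = (1 - q) (2 - q) / 2`.
    let ε := (1 - q) / 2
    have hε : 0 < ε := by simp only [ε]; linarith
    refine exists_bound_of_affine_le (r := (1 + ε) * q) (c := (1 + 1 / ε) * ∫ ω, ‖D 0 ω‖ ^ 2 ∂P)
      (by positivity) (by simp only [ε]; nlinarith) fun n => ?_
    have hL : MemLp (fun ω => W n ω - A) 2 P := (WL n).sub (memLp_const A)
    have hL' : MemLp (fun ω => W (n + 1) ω - A) 2 P := (WL (n + 1)).sub (memLp_const A)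
    have h0 : ∫ ω, (W n ω - A) ∂P = 0 := by
      rw [integral_sub ((WL _).integrable (by norm_num)) (integrable_const _), WA]
      simp
    have i1 := (SL _ hL).integrable_norm_pow (p := 2) (by norm_num)
    have i2 := (DL 0).integrable_norm_pow (p := 2) (by norm_num)
    calc _ ≤ ∫ ω, ((1 + ε) * ‖S (fun ω => W n ω - A) ω‖ ^ 2 + (1 + 1 / ε) * ‖D 0 ω‖ ^ 2) ∂P := by
          refine integral_mono (hL'.integrable_norm_pow (by norm_num))
            ((i1.const_mul _).add (i2.const_mul _)) fun ω => ?_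
          -- Linearity of `S`, with `D 0 = S A - A`.
          have e : W (n + 1) ω - A = S (fun ω => W n ω - A) ω + D 0 ω := by
            simp only [D, Ws, W0, S, weighted]
            ring
          simp only [e]
          exact norm_add_sq_le_weighted hε
      _ = _ := by
          rw [integral_add (i1.const_mul _) (i2.const_mul _), integral_const_mul,
            integral_const_mul, Ssq _ hL h0]
          ring
  have hconv : ∀ᵐ ω ∂P, ∃ w, Tendsto (fun n => W n ω) atTop (𝓝 w) := by
    filter_upwards [ae_summable_norm_of_summable_integral
      (fun n => (DL n).integrable (by norm_num)) Dsum] with ω hω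
    refine cauchySeq_tendsto_of_complete (cauchySeq_of_summable_dist ?_)
    simpa only [dist_eq_norm, norm_sub_rev, D] using hω
  obtain ⟨w, wm, hw⟩ := measurable_limit_of_tendsto_metrizable_ae
    (fun n => (Wm n).aemeasurable) hconv
  have hw' : ∀ᵐ ω ∂P, Tendsto (fun n => W n ω - A) atTop (𝓝 (w ω - A)) := by
    filter_upwards [hw] with ω hω using hω.sub_const A
  have XL : ∀ n, MemLp (fun ω => W n ω - A) 2 P := fun n => (WL n).sub (memLp_const A)
  have wL' := (memLp_two_of_tendsto_ae XL hC hw').1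
  have wL : MemLp w 2 P := by
    have := wL'.add (memLp_const A)
    simpa [Pi.add_def] using this
  have wA : ∫ ω, w ω ∂P = A := by
    have ht := tendsto_integral_of_sq_bounded XL hC hw'
    have e : ∀ n, ∫ ω, (W n ω - A) ∂P = 0 := fun n => by
      rw [integral_sub ((WL _).integrable (by norm_num)) (integrable_const _), WA]
      simp
    simp_rw [e] at ht
    have := tendsto_nhds_unique ht tendsto_const_nhds
    rw [integral_sub (wL.integrable (by norm_num)) (integrable_const _)] at this
    simpa [sub_eq_zero] using this
  -- Since `l` and `r` preserve `P`, the almost sure convergence also holds at `l ω` and `r ω`, and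
  -- one passes to the limit in `W (n + 1) = S (W n)`.
  have hfix : w =ᵐ[P] S w := by
    filter_upwards [hw, hlp.quasiMeasurePreserving.ae hw, hrp.quasiMeasurePreserving.ae hw]
      with ω h0 hl hr
    refine tendsto_nhds_unique (h0.comp (tendsto_add_atTop_nat 1)) ?_
    exact (hl.const_mul _).add (hr.const_mul _)
  refine ⟨P.map w, ⟨Measure.isProbabilityMeasure_map wm.aemeasurable, ?_, ?_⟩, ?_⟩
  · rw [memLp_map_measure_iff (by fun_prop) wm.aemeasurable]
    exact wL
  · rw [integral_map wm.aemeasurable (by fun_prop)]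
    exact wA
  · rw [smooth, Measure.map_prod_map _ _ wm wm]
    conv_rhs => rw [Measure.map_congr hfix]
    have e1 : κ.prod ((P.prod P).map (Prod.map w w))
        = (κ.prod (P.prod P)).map (Prod.map id (Prod.map w w)) := by
      rw [← Measure.map_prod_map _ _ measurable_id (by fun_prop), Measure.map_id]
    rw [e1, Measure.map_map (by fun_prop) (by fun_prop), ← hlaw, Measure.map_map (by fun_prop) hτm]
    rfl

/-! ### Complex moments of the Beta law and the roots of `χ_m` -/

lemma Gamma_add_nat (z : ℂ) (hz : 0 < z.re) (n : ℕ) :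
    Complex.Gamma (z + n) = (∏ k ∈ Finset.range n, (z + k)) * Complex.Gamma z := by
  induction n with
  | zero => simp
  | succ n ih =>
    have h : z + n ≠ 0 := fun h => by
      have := congrArg Complex.re h
      simp at this
      have : (0 : ℝ) ≤ n := n.cast_nonneg
      linarith
    rw [Nat.cast_succ, ← add_assoc, Complex.Gamma_add_one _ h, ih, Finset.prod_range_succ]
    ring

/-- The closed form of the complex moments of the `Beta(m, m)` law. -/
def betaMoment (m : ℕ) (a b : ℂ) : ℂ :=
  Complex.Gamma (m + a) * Complex.Gamma (m + b) * Complex.Gamma (2 * m)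
    / (Complex.Gamma m ^ 2 * Complex.Gamma (2 * m + a + b))

lemma ae_mem_Ioo_beta (m : ℕ) : ∀ᵐ x ∂betaMeasure (m : ℝ) (m : ℝ), 0 < x ∧ x < 1 := by
  rw [betaMeasure, ae_withDensity_iff (by unfold betaPDF; fun_prop)]
  refine Eventually.of_forall fun x hx => ?_
  by_contra h
  rw [betaPDF_eq, if_neg h] at hx
  simp at hx

lemma norm_cpow_le_one {x : ℝ} (h0 : 0 < x) (h1 : x < 1) {l : ℂ} (hl : 0 ≤ l.re) :
    ‖(x : ℂ) ^ l‖ ≤ 1 := by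
  rw [Complex.norm_cpow_eq_rpow_re_of_pos h0]
  exact Real.rpow_le_one h0.le h1.le hl

lemma norm_cpow_sq {x : ℝ} (h0 : 0 < x) (l : ℂ) :
    ((‖(x : ℂ) ^ l‖ ^ 2 : ℝ) : ℂ) = (x : ℂ) ^ ((2 * l.re : ℝ) : ℂ) := by
  rw [Complex.norm_cpow_eq_rpow_re_of_pos h0, ← Complex.ofReal_cpow h0.le, ← Real.rpow_natCast,
    ← Real.rpow_mul h0.le]
  push_cast
  ring_nf

lemma measurable_ofReal_cpow (l : ℂ) : Measurable fun x : ℝ => (x : ℂ) ^ l :=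
  Complex.measurable_ofReal.pow_const l

section Beta

variable {m : ℕ} (hm : 0 < m)
include hm

lemma isProbabilityMeasure_beta : IsProbabilityMeasure (betaMeasure (m : ℝ) (m : ℝ)) :=
  isProbabilityMeasureBeta (by positivity) (by positivity)

lemma integral_beta_eq (a b : ℂ) (ha : -(m : ℝ) < a.re) (hb : -(m : ℝ) < b.re) :
    ∫ x : ℝ, (x : ℂ) ^ a * ((1 - x : ℝ) : ℂ) ^ b ∂betaMeasure (m : ℝ) (m : ℝ)
      = betaMoment m a b := by
  have hpos : ∀ x, 0 ≤ betaPDFReal (m : ℝ) (m : ℝ) x := fun x => by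
    by_cases h : 0 < x ∧ x < 1
    · exact (betaPDFReal_pos h.1 h.2 (by positivity) (by positivity)).le
    · rw [betaPDFReal, if_neg h]
  have hm0 : (0 : ℝ) < m := by positivity
  rw [betaMeasure, integral_withDensity_eq_integral_toReal_smul (by unfold betaPDF; fun_prop)
    (Eventually.of_forall fun x => by simp [betaPDF])]
  have e1 : ∀ x : ℝ, (betaPDF (m : ℝ) (m : ℝ) x).toReal • ((x : ℂ) ^ a * ((1 - x : ℝ) : ℂ) ^ b)
      = (Set.Ioo (0 : ℝ) 1).indicator (fun x : ℝ => ((1 / beta m m : ℝ) : ℂ) *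
        ((x : ℂ) ^ (m + a - 1) * (1 - (x : ℂ)) ^ (m + b - 1))) x := by
    intro x
    rw [betaPDF, ENNReal.toReal_ofReal (hpos x), betaPDFReal]
    by_cases h : 0 < x ∧ x < 1
    · rw [if_pos h, Set.indicator_of_mem (by exact h)]
      have hx : (x : ℂ) ≠ 0 := by exact_mod_cast h.1.ne'
      have h1x : ((1 - x : ℝ) : ℂ) ≠ 0 := by
        exact_mod_cast (sub_pos.2 h.2).ne'
      have e2 : (x : ℂ) ^ (m + a - 1) = (x : ℂ) ^ ((m - 1 : ℝ) : ℂ) * (x : ℂ) ^ a := by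
        rw [← Complex.cpow_add _ _ hx]; congr 1; push_cast; ring
      have e3 : (1 - (x : ℂ)) ^ (m + b - 1)
          = ((1 - x : ℝ) : ℂ) ^ ((m - 1 : ℝ) : ℂ) * ((1 - x : ℝ) : ℂ) ^ b := by
        rw [← Complex.cpow_add _ _ h1x]; congr 1
        · push_cast; ring
        · push_cast; ring
      rw [e2, e3, ← Complex.ofReal_cpow h.1.le, ← Complex.ofReal_cpow (sub_pos.2 h.2).le,
        Complex.real_smul]
      push_cast
      ring
    · rw [if_neg h, Set.indicator_of_notMem (by exact h)]
      simp
  simp_rw [e1]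
  rw [integral_indicator measurableSet_Ioo, integral_const_mul, ← integral_Ioc_eq_integral_Ioo,
    ← intervalIntegral.integral_of_le zero_le_one]
  have e4 := Complex.Gamma_mul_Gamma_eq_betaIntegral (s := m + a) (t := m + b)
    (by simp; linarith) (by simp; linarith)
  rw [Complex.betaIntegral] at e4
  have hG : ∀ z : ℂ, 0 < z.re → Complex.Gamma z ≠ 0 := fun z => Complex.Gamma_ne_zero_of_re_pos
  have g1 := hG m (by simpa using hm)
  have g2 := hG (2 * m + a + b) (by simp; linarith)
  have g3 : Complex.Gamma (m + m) ≠ 0 := hG _ (by simp; linarith)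
  have e5 : ((1 / beta m m : ℝ) : ℂ) = Complex.Gamma (2 * m) / Complex.Gamma m ^ 2 := by
    rw [beta]
    push_cast
    simp only [← Complex.Gamma_ofReal]
    push_cast
    rw [two_mul]
    field_simp
  have e6 : (m + a + (m + b) : ℂ) = 2 * m + a + b := by ring
  rw [e6] at e4
  rw [e5, betaMoment, e4]
  field_simp

lemma integral_beta_cpow (a : ℂ) (ha : -(m : ℝ) < a.re) :
    ∫ x : ℝ, (x : ℂ) ^ a ∂betaMeasure (m : ℝ) (m : ℝ) = betaMoment m a 0 := by
  have hm0 : (0 : ℝ) < m := by positivity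
  simpa using integral_beta_eq hm a 0 ha (by simpa using hm0)

lemma integral_beta_one_sub_cpow (a : ℂ) (ha : -(m : ℝ) < a.re) :
    ∫ x : ℝ, ((1 - x : ℝ) : ℂ) ^ a ∂betaMeasure (m : ℝ) (m : ℝ) = betaMoment m a 0 := by
  have hm0 : (0 : ℝ) < m := by positivity
  have := integral_beta_eq hm 0 a (by simpa using hm0) ha
  simp only [Complex.cpow_zero, one_mul] at this
  rw [this, betaMoment, betaMoment, add_zero, add_zero, add_zero]
  ring

lemma isRoot_chi_iff {l : ℂ} : (chi m).IsRoot l ↔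
    ∏ k ∈ Finset.range m, (m + l + k) = (2 * m)! / m ! := by
  rw [chi, Polynomial.IsRoot, Polynomial.eval_sub, Polynomial.eval_prod, Polynomial.eval_C,
    sub_eq_zero, Finset.prod_Ico_eq_prod_range]
  have : 2 * m - m = m := by omega
  rw [this]
  have e : ∀ k : ℕ, Polynomial.eval l (Polynomial.X + Polynomial.C ((m + k : ℕ) : ℂ)) = m + l + k :=
    fun k => by simp; ring
  simp_rw [e]

/-- The root equation says `Γ(2m + l) = ((2m)! / m!) Γ(m + l)`, which reduces `E B^l` to `m / (2m)`.
This is the only link between `χ_m` and the smoothing equations. -/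
lemma betaMoment_root {l : ℂ} (hl : (chi m).IsRoot l) (h : 0 < l.re) :
    betaMoment m l 0 = 1 / 2 := by
  have hm0 : (0 : ℝ) < m := by positivity
  have e1 := Gamma_add_nat (m + l) (by simp; linarith) m
  rw [(isRoot_chi_iff hm).1 hl] at e1
  have e2 : (m + l + m : ℂ) = 2 * m + l + 0 := by ring
  rw [e2] at e1
  obtain ⟨k, rfl⟩ : ∃ k, m = k + 1 := ⟨m - 1, by omega⟩
  have g1 : Complex.Gamma ((k + 1 : ℕ) : ℂ) = (k ! : ℂ) := by
    push_cast; exact Complex.Gamma_nat_eq_factorial k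
  have g2 : Complex.Gamma (2 * ((k + 1 : ℕ) : ℂ)) = ((2 * k + 1)! : ℂ) := by
    rw [← Complex.Gamma_nat_eq_factorial]; congr 1; push_cast; ring
  have g3 : Complex.Gamma ((k + 1 : ℕ) + l) ≠ 0 :=
    Complex.Gamma_ne_zero_of_re_pos (by simp; positivity)
  rw [betaMoment, e1, g2, add_zero, g1]
  have f1 : ((2 * (k + 1))! : ℂ) = (2 * (k + 1)) * (2 * k + 1)! := by
    have : 2 * (k + 1) = (2 * k + 1) + 1 := by ring
    rw [this, Nat.factorial_succ]; push_cast; ring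
  have f2 : ((k + 1)! : ℂ) = (k + 1) * k ! := by
    rw [Nat.factorial_succ]; push_cast; ring
  have n1 : (k ! : ℂ) ≠ 0 := by exact_mod_cast k.factorial_ne_zero
  have n2 : ((2 * k + 1)! : ℂ) ≠ 0 := by exact_mod_cast (2 * k + 1).factorial_ne_zero
  have n3 : (k + 1 : ℂ) ≠ 0 := by exact_mod_cast k.succ_ne_zero
  rw [f1, f2]
  field_simp

lemma memLp_beta_cpow {l : ℂ} (hl : 0 ≤ l.re) :
    MemLp (fun x : ℝ => (x : ℂ) ^ l) 2 (betaMeasure (m : ℝ) (m : ℝ)) := by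
  have := isProbabilityMeasure_beta hm
  refine MemLp.of_bound (measurable_ofReal_cpow l).aestronglyMeasurable 1 ?_
  filter_upwards [ae_mem_Ioo_beta m] with x hx using norm_cpow_le_one hx.1 hx.2 hl

lemma memLp_beta_one_sub_cpow {l : ℂ} (hl : 0 ≤ l.re) :
    MemLp (fun x : ℝ => ((1 - x : ℝ) : ℂ) ^ l) 2 (betaMeasure (m : ℝ) (m : ℝ)) := by
  have := isProbabilityMeasure_beta hm
  refine MemLp.of_bound
    ((measurable_ofReal_cpow l).comp (measurable_const.sub measurable_id)).aestronglyMeasurable 1 ?_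
  filter_upwards [ae_mem_Ioo_beta m] with x hx
    using norm_cpow_le_one (by linarith) (by linarith) hl

lemma integral_beta_norm_sq_one_sub {l : ℂ} (hl : 0 ≤ l.re) :
    ∫ x : ℝ, ‖((1 - x : ℝ) : ℂ) ^ l‖ ^ 2 ∂betaMeasure (m : ℝ) (m : ℝ)
      = ∫ x : ℝ, ‖(x : ℂ) ^ l‖ ^ 2 ∂betaMeasure (m : ℝ) (m : ℝ) := by
  have hm0 : (0 : ℝ) < m := by positivity
  have h : -(m : ℝ) < ((2 * l.re : ℝ) : ℂ).re := by rw [Complex.ofReal_re]; linarith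
  have e1 := integral_beta_cpow hm _ h
  rw [← integral_beta_one_sub_cpow hm _ h] at e1
  have a1 : ∫ x : ℝ, (x : ℂ) ^ ((2 * l.re : ℝ) : ℂ) ∂betaMeasure (m : ℝ) (m : ℝ)
      = ∫ x : ℝ, ((‖(x : ℂ) ^ l‖ ^ 2 : ℝ) : ℂ) ∂betaMeasure (m : ℝ) (m : ℝ) :=
    integral_congr_ae (by
      filter_upwards [ae_mem_Ioo_beta m] with x hx using (norm_cpow_sq hx.1 l).symm)
  have a2 : ∫ x : ℝ, ((1 - x : ℝ) : ℂ) ^ ((2 * l.re : ℝ) : ℂ) ∂betaMeasure (m : ℝ) (m : ℝ)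
      = ∫ x : ℝ, ((‖((1 - x : ℝ) : ℂ) ^ l‖ ^ 2 : ℝ) : ℂ) ∂betaMeasure (m : ℝ) (m : ℝ) :=
    integral_congr_ae (by
      filter_upwards [ae_mem_Ioo_beta m] with x hx using (norm_cpow_sq (sub_pos.2 hx.2) l).symm)
  rw [a1, a2, integral_complex_ofReal, integral_complex_ofReal] at e1
  exact_mod_cast e1.symm

lemma isRoot_chi_one : (chi m).IsRoot 1 := by
  rw [isRoot_chi_iff hm, eq_div_iff (by exact_mod_cast m.factorial_ne_zero)]
  have : ∀ n : ℕ, (∏ k ∈ Finset.range n, ((m : ℂ) + 1 + k)) * m ! = (m + n)! := fun n => by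
    induction n with
    | zero => simp
    | succ n ih =>
      rw [Finset.prod_range_succ, mul_right_comm, ih, ← add_assoc, Nat.factorial_succ]
      push_cast
      ring
  rw [this, two_mul]

/-- On `(0, 1)` one has `x ^ (2 Re l) < x` as `2 Re l > 1`, and `E B = 1/2` because `1` is a root of
`χ_m`. -/
lemma integral_beta_norm_sq_lt {l : ℂ} (hl : 1 / 2 < l.re) :
    ∫ x : ℝ, ‖(x : ℂ) ^ l‖ ^ 2 ∂betaMeasure (m : ℝ) (m : ℝ) < 1 / 2 := by
  have := isProbabilityMeasure_beta hm
  have hm0 : (0 : ℝ) < m := by positivity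
  have e1 := integral_beta_cpow hm 1 (by simp; linarith)
  rw [betaMoment_root hm (isRoot_chi_one hm) (by simp)] at e1
  simp only [Complex.cpow_one] at e1
  rw [integral_complex_ofReal] at e1
  have e2 : ∫ x : ℝ, x ∂betaMeasure (m : ℝ) (m : ℝ) = 1 / 2 := by
    apply Complex.ofReal_injective
    rw [e1]
    push_cast
    ring
  have i1 : Integrable (fun x : ℝ => x) (betaMeasure (m : ℝ) (m : ℝ)) := by
    refine Integrable.of_bound (by fun_prop) 1 ?_
    filter_upwards [ae_mem_Ioo_beta m] with x hx
    rw [Real.norm_of_nonneg hx.1.le]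
    exact hx.2.le
  have i2 := (memLp_beta_cpow hm (l := l) (by linarith)).integrable_norm_pow (p := 2) (by norm_num)
  rw [← e2, ← sub_pos, ← integral_sub i1 i2]
  have hpos : ∀ᵐ x : ℝ ∂betaMeasure (m : ℝ) (m : ℝ), 0 < x - ‖(x : ℂ) ^ l‖ ^ 2 := by
    filter_upwards [ae_mem_Ioo_beta m] with x hx
    rw [Complex.norm_cpow_eq_rpow_re_of_pos hx.1, ← Real.rpow_natCast, ← Real.rpow_mul hx.1.le,
      sub_pos]
    calc _ < x ^ (1 : ℝ) := Real.rpow_lt_rpow_of_exponent_gt hx.1 hx.2 (by push_cast; linarith)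
      _ = x := Real.rpow_one x
  rw [integral_pos_iff_support_of_nonneg_ae (hpos.mono fun x hx => hx.le) (i1.sub i2)]
  have : (Function.support fun x : ℝ => x - ‖(x : ℂ) ^ l‖ ^ 2) =ᵐ[betaMeasure (m : ℝ) (m : ℝ)]
      Set.univ := eventuallyEq_univ.2 (hpos.mono fun x hx => hx.ne')
  rw [measure_congr this, measure_univ]
  exact one_pos

end Beta

/-! ### The Dirichlet and Beta equations as instances of `smooth` -/

/-- The law of the pair of weights of the Dirichlet smoothing equation. -/
def dirichletKernel (m : ℕ) (l : ℂ) : Measure (ℂ × ℂ) :=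
  (betaMeasure (m : ℝ) (m : ℝ)).map fun x : ℝ => ((x : ℂ) ^ l, ((1 - x : ℝ) : ℂ) ^ l)

/-- The law of the pair of weights of the Beta smoothing equation. -/
def betaKernel (m : ℕ) (l : ℂ) : Measure (ℂ × ℂ) :=
  (betaMeasure (m : ℝ) (m : ℝ)).map fun x : ℝ => ((x : ℂ) ^ l, (x : ℂ) ^ l)

lemma measurable_dirichletWeights (l : ℂ) :
    Measurable fun x : ℝ => ((x : ℂ) ^ l, ((1 - x : ℝ) : ℂ) ^ l) :=
  (measurable_ofReal_cpow l).prodMk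
    ((measurable_ofReal_cpow l).comp (measurable_const.sub measurable_id))

lemma measurable_betaWeights (l : ℂ) :
    Measurable fun x : ℝ => ((x : ℂ) ^ l, (x : ℂ) ^ l) :=
  (measurable_ofReal_cpow l).prodMk (measurable_ofReal_cpow l)

lemma prod_map_left {X Y Z : Type*} [MeasurableSpace X] [MeasurableSpace Y] [MeasurableSpace Z]
    (κ : Measure X) [SFinite κ] (ρ : Measure Z) [SFinite ρ] {f : X → Y} (hf : Measurable f) :
    (κ.map f).prod ρ = (κ.prod ρ).map (Prod.map f id) := by
  rw [← Measure.map_prod_map _ _ hf measurable_id, Measure.map_id]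

lemma smoothDirichlet_eq (m : ℕ) (l : ℂ) (μ : Measure ℂ) [SFinite μ]
    [IsProbabilityMeasure (betaMeasure (m : ℝ) (m : ℝ))] :
    smoothDirichlet m l μ = smooth (dirichletKernel m l) μ := by
  have h1 : Measurable fun b : ℝ => (b, 1 - b) := by fun_prop
  have h2 := measurable_dirichletWeights l
  rw [smoothDirichlet, smooth, dirichletLaw, dirichletKernel, prod_map_left _ _ h1,
    prod_map_left _ _ h2, Measure.map_map (by fun_prop) (by fun_prop),
    Measure.map_map (by fun_prop) (by fun_prop)]
  rfl

lemma smoothBeta_eq (m : ℕ) (l : ℂ) (μ : Measure ℂ) [SFinite μ]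
    [IsProbabilityMeasure (betaMeasure (m : ℝ) (m : ℝ))] :
    smoothBeta m l μ = smooth (betaKernel m l) μ := by
  have h2 := measurable_betaWeights l
  rw [smoothBeta, smooth, betaKernel, prod_map_left _ _ h2,
    Measure.map_map (by fun_prop) (by fun_prop)]
  congr 1
  funext p
  simp [mul_add]

lemma existsUnique_smooth {m : ℕ} (hm : 0 < m) {f g : ℝ → ℂ} (hf : Measurable f)
    (hg : Measurable g)
    (Lf : MemLp f 2 (betaMeasure (m : ℝ) (m : ℝ))) (Lg : MemLp g 2 (betaMeasure (m : ℝ) (m : ℝ)))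
    (mf : ∫ x, f x ∂betaMeasure (m : ℝ) (m : ℝ) = 1 / 2)
    (mg : ∫ x, g x ∂betaMeasure (m : ℝ) (m : ℝ) = 1 / 2)
    (qf : ∫ x, ‖f x‖ ^ 2 ∂betaMeasure (m : ℝ) (m : ℝ) < 1 / 2)
    (qg : ∫ x, ‖g x‖ ^ 2 ∂betaMeasure (m : ℝ) (m : ℝ) < 1 / 2) (A : ℂ) :
    ∃! μ : Measure ℂ, μ ∈ M2 A ∧
      smooth ((betaMeasure (m : ℝ) (m : ℝ)).map fun x => (f x, g x)) μ = μ := by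
  have := isProbabilityMeasure_beta hm
  have hfg : Measurable fun x => (f x, g x) := hf.prodMk hg
  set κ := (betaMeasure (m : ℝ) (m : ℝ)).map fun x => (f x, g x) with hκ
  have : IsProbabilityMeasure κ := Measure.isProbabilityMeasure_map hfg.aemeasurable
  have L1 : MemLp (fun a : ℂ × ℂ => a.1) 2 κ := by
    rw [hκ, memLp_map_measure_iff (by fun_prop) hfg.aemeasurable]; exact Lf
  have L2 : MemLp (fun a : ℂ × ℂ => a.2) 2 κ := by
    rw [hκ, memLp_map_measure_iff (by fun_prop) hfg.aemeasurable]; exact Lg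
  have hq : ∫ a, ‖a.1‖ ^ 2 ∂κ + ∫ a, ‖a.2‖ ^ 2 ∂κ < 1 := by
    rw [hκ, integral_map hfg.aemeasurable (by fun_prop), integral_map hfg.aemeasurable (by fun_prop)]
    simp only
    linarith
  have hmean : ∫ a, (a.1 + a.2) ∂κ = 1 := by
    rw [hκ, integral_map hfg.aemeasurable (by fun_prop)]
    simp only
    rw [integral_add (Lf.integrable (by norm_num)) (Lg.integrable (by norm_num)), mf, mg]
    norm_num
  obtain ⟨μ, hμ, e⟩ := smooth_exists L1 L2 hmean hq A
  exact ⟨μ, ⟨hμ, e⟩, fun ν hν => smooth_unique (L1.integrable_norm_pow (by norm_num))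
    (L2.integrable_norm_pow (by norm_num)) hq hν.1 hμ hν.2 e⟩

theorem existsUnique_smoothDirichlet {m : ℕ} (hm : 0 < m) {l : ℂ} (hl : (chi m).IsRoot l)
    (h : 1 / 2 < l.re) (A : ℂ) :
    ∃! μ : Measure ℂ, μ ∈ M2 A ∧ smoothDirichlet m l μ = μ := by
  have := isProbabilityMeasure_beta hm
  have hm0 : (0 : ℝ) < m := by positivity
  have hr : -(m : ℝ) < l.re := by linarith
  have := existsUnique_smooth hm (f := fun x => (x : ℂ) ^ l)
    (g := fun x => ((1 - x : ℝ) : ℂ) ^ l) (measurable_ofReal_cpow l)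
    ((measurable_ofReal_cpow l).comp (measurable_const.sub measurable_id))
    (memLp_beta_cpow hm (by linarith)) (memLp_beta_one_sub_cpow hm (by linarith))
    (by rw [integral_beta_cpow hm l hr, betaMoment_root hm hl (by linarith)])
    (by rw [integral_beta_one_sub_cpow hm l hr, betaMoment_root hm hl (by linarith)])
    (integral_beta_norm_sq_lt hm h)
    (by rw [integral_beta_norm_sq_one_sub hm (by linarith)]; exact integral_beta_norm_sq_lt hm h) A
  refine (existsUnique_congr fun μ => and_congr_right fun hμ => ?_).2 this
  have := hμ.1
  rw [smoothDirichlet_eq, dirichletKernel]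

theorem existsUnique_smoothBeta {m : ℕ} (hm : 0 < m) {l : ℂ} (hl : (chi m).IsRoot l)
    (h : 1 / 2 < l.re) (A : ℂ) :
    ∃! μ : Measure ℂ, μ ∈ M2 A ∧ smoothBeta m l μ = μ := by
  have := isProbabilityMeasure_beta hm
  have hm0 : (0 : ℝ) < m := by positivity
  have hr : -(m : ℝ) < l.re := by linarith
  have hmean : ∫ x : ℝ, (x : ℂ) ^ l ∂betaMeasure (m : ℝ) (m : ℝ) = 1 / 2 := by
    rw [integral_beta_cpow hm l hr, betaMoment_root hm hl (by linarith)]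
  have := existsUnique_smooth hm (f := fun x => (x : ℂ) ^ l)
    (g := fun x => (x : ℂ) ^ l) (measurable_ofReal_cpow l) (measurable_ofReal_cpow l)
    (memLp_beta_cpow hm (by linarith)) (memLp_beta_cpow hm (by linarith)) hmean hmean
    (integral_beta_norm_sq_lt hm h) (integral_beta_norm_sq_lt hm h) A
  refine (existsUnique_congr fun μ => and_congr_right fun hμ => ?_).2 this
  have := hμ.1
  rw [smoothBeta_eq, betaKernel]

/-! ### Location of the second root -/

lemma factorial_ratio (m : ℕ) : ((2 * m)! : ℂ) / m ! = ∏ k ∈ Finset.range m, ((m : ℂ) + 1 + k) := by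
  rcases Nat.eq_zero_or_pos m with rfl | hm
  · simp
  · exact ((isRoot_chi_iff hm).1 (isRoot_chi_one hm)).symm

lemma isRoot_chi_conj {m : ℕ} (hm : 0 < m) {l : ℂ} (hl : (chi m).IsRoot l) :
    (chi m).IsRoot (conj l) := by
  rw [isRoot_chi_iff hm] at hl ⊢
  have := congrArg conj hl
  simpa [map_prod] using this

lemma chi_ne_zero {m : ℕ} (hm : 0 < m) : chi m ≠ 0 := fun h => by
  have h0 : (chi m).IsRoot (-m) := by simp [h, Polynomial.IsRoot]
  rw [isRoot_chi_iff hm] at h0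
  rw [Finset.prod_eq_zero (Finset.mem_range.2 hm) (by simp)] at h0
  have h1 : ((2 * m)! : ℂ) / m ! ≠ 0 :=
    div_ne_zero (by exact_mod_cast (2 * m).factorial_ne_zero)
      (by exact_mod_cast m.factorial_ne_zero)
  exact h1 h0.symm

/-- Right of `-m` each factor grows in modulus with `Re z` and with `|Im z|`. As all roots of `χ_m`
give the product the same value, two roots cannot be strictly comparable in this sense. -/
lemma normSq_prod_lt {m : ℕ} (hm : 0 < m) {z w : ℂ} (hz : -(m : ℝ) < z.re) (h1 : z.re ≤ w.re)
    (h2 : z.im ^ 2 ≤ w.im ^ 2) (h3 : z.re < w.re ∨ z.im ^ 2 < w.im ^ 2) :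
    Complex.normSq (∏ k ∈ Finset.range m, (m + z + k))
      < Complex.normSq (∏ k ∈ Finset.range m, (m + w + k)) := by
  rw [map_prod, map_prod]
  have hk : ∀ k : ℕ, (0 : ℝ) ≤ k := fun k => k.cast_nonneg
  refine Finset.prod_lt_prod_of_nonempty (fun k _ => ?_) (fun k _ => ?_) ⟨0, Finset.mem_range.2 hm⟩
  · refine Complex.normSq_pos.2 fun h => ?_
    have := congrArg Complex.re h
    simp at this
    linarith [hk k]
  · simp only [Complex.normSq_apply, Complex.add_re, Complex.add_im, Complex.natCast_re,
      Complex.natCast_im, zero_add, add_zero]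
    have := hk k
    rcases h3 with h3 | h3 <;> nlinarith

lemma eq_one_of_real_root {m : ℕ} (hm : 0 < m) {z : ℂ} (hz : (chi m).IsRoot z)
    (hre : -(m : ℝ) < z.re) (him : z.im = 0) : z = 1 := by
  have e := ((isRoot_chi_iff hm).1 hz).trans ((isRoot_chi_iff hm).1 (isRoot_chi_one hm)).symm
  have hm0 : (0 : ℝ) < m := by positivity
  refine Complex.ext ?_ (by simpa using him)
  rcases lt_trichotomy z.re (1 : ℂ).re with h | h | h
  · have := normSq_prod_lt hm hre h.le (by simp [him]) (Or.inl h)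
    rw [e] at this
    exact absurd this (lt_irrefl _)
  · exact h
  · have := normSq_prod_lt hm (z := 1) (by simp; linarith) h.le (by simp [him]) (Or.inl h)
    rw [e] at this
    exact absurd this (lt_irrefl _)

lemma root_eq_of_re_eq {m : ℕ} (hm : 0 < m) {z w : ℂ} (hz : (chi m).IsRoot z)
    (hw : (chi m).IsRoot w) (hre : -(m : ℝ) < z.re) (h : z.re = w.re) (hzi : 0 < z.im)
    (hwi : 0 < w.im) : z = w := by
  have e := ((isRoot_chi_iff hm).1 hz).trans ((isRoot_chi_iff hm).1 hw).symm
  refine Complex.ext h ?_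
  rcases lt_trichotomy z.im w.im with h' | h' | h'
  · have h2 : z.im ^ 2 < w.im ^ 2 := by nlinarith
    have := normSq_prod_lt hm hre h.le h2.le (Or.inr h2)
    rw [e] at this
    exact absurd this (lt_irrefl _)
  · exact h'
  · have h2 : w.im ^ 2 < z.im ^ 2 := by nlinarith
    have := normSq_prod_lt hm (h ▸ hre) h.ge h2.le (Or.inr h2)
    rw [e] at this
    exact absurd this (lt_irrefl _)

/-! #### Elementary inequalities -/

lemma sub_cube_div_le_arctan {x : ℝ} (hx : 0 ≤ x) : x - x ^ 3 / 3 ≤ Real.arctan x := by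
  have hd : ∀ y : ℝ, HasDerivAt (fun y => Real.arctan y - (y - y ^ 3 / 3))
      (1 / (1 + y ^ 2) - (1 - y ^ 2)) y := fun y => by
    have h1 := (hasDerivAt_pow 3 y).div_const 3
    have h2 := (Real.hasDerivAt_arctan y).sub ((hasDerivAt_id y).sub h1)
    refine h2.congr_deriv ?_
    simp
  have hmono : Monotone fun y : ℝ => Real.arctan y - (y - y ^ 3 / 3) := by
    refine monotone_of_hasDerivAt_nonneg hd fun y => ?_
    rw [Pi.zero_apply, sub_nonneg, le_div_iff₀ (by positivity)]
    nlinarith [sq_nonneg (y ^ 2)]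
  have := hmono hx
  simp at this
  linarith

/-- This is `y ≤ sinh y` at `y = log x`. -/
lemma log_le_half_sub_inv {x : ℝ} (hx : 1 ≤ x) : Real.log x ≤ (x - 1 / x) / 2 := by
  have h0 : 0 < x := by linarith
  have := Real.self_le_sinh_iff.2 (Real.log_nonneg hx)
  rw [Real.sinh_log h0] at this
  simpa using this

section Sums

variable (m : ℕ)

/-- The midpoints `m + 1/2, …, 2m - 1/2`. -/
def mid (k : ℕ) : ℝ := m + k + 1 / 2

/-- With `n = m + k`, the inequality `n (n + 1) ≤ (n + 1/2)²` bounds each term by `1 / (2 n²) - 1 /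
(2 (n + 1)²)`, which telescopes. -/
lemma sum_inv_prod_le {m : ℕ} (hm : 0 < m) :
    ∑ k ∈ Finset.range m, 1 / (mid m k * ((m + k : ℝ) * (m + k + 1))) ≤ 3 / (8 * (m : ℝ) ^ 2) := by
  have hm0 : (0 : ℝ) < m := by positivity
  let f : ℕ → ℝ := fun k => -(1 / (2 * (m + k : ℝ) ^ 2))
  have h : ∀ k ∈ Finset.range m, 1 / (mid m k * ((m + k : ℝ) * (m + k + 1))) ≤ f (k + 1) - f k := by
    intro k _
    have hn : (0 : ℝ) < m + k := by positivity
    have e : f (k + 1) - f k = mid m k / ((m + k : ℝ) * (m + k + 1)) ^ 2 := by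
      simp only [f, mid]
      push_cast
      have : (m + (k + 1) : ℝ) ≠ 0 := by positivity
      have : (m + k + 1 : ℝ) ≠ 0 := by positivity
      field_simp
      ring
    have ha : 0 < mid m k := by unfold mid; positivity
    rw [e, div_le_div_iff₀ (by positivity) (by positivity)]
    have : (m + k : ℝ) * (m + k + 1) ≤ mid m k ^ 2 := by unfold mid; nlinarith
    have hp : 0 < (m + k : ℝ) * (m + k + 1) := by positivity
    nlinarith
  refine (Finset.sum_le_sum h).trans ?_
  rw [Finset.sum_range_sub]
  simp only [f]
  apply le_of_eq
  push_cast
  field_simp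
  ring

lemma sum_inv_sq_le {m : ℕ} (hm : 0 < m) :
    ∑ k ∈ Finset.range m, 1 / mid m k ^ 2 ≤ 1 / (2 * (m : ℝ)) := by
  have hm0 : (0 : ℝ) < m := by positivity
  let f : ℕ → ℝ := fun k => -(1 / (m + k : ℝ))
  have h : ∀ k ∈ Finset.range m, 1 / mid m k ^ 2 ≤ f (k + 1) - f k := by
    intro k _
    have hn : (0 : ℝ) < m + k := by positivity
    have e : f (k + 1) - f k = 1 / ((m + k : ℝ) * (m + k + 1)) := by
      simp only [f]
      push_cast
      have : (m + (k + 1) : ℝ) ≠ 0 := by positivity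
      have : (m + k + 1 : ℝ) ≠ 0 := by positivity
      field_simp
      ring
    have ha : 0 < mid m k := by unfold mid; positivity
    rw [e]
    apply one_div_le_one_div_of_le (by positivity)
    unfold mid; nlinarith
  refine (Finset.sum_le_sum h).trans ?_
  rw [Finset.sum_range_sub]
  simp only [f]
  apply le_of_eq
  push_cast
  field_simp
  ring

/-- `log 2` is the telescoping sum of `log ((n + 1) / n)` for `m ≤ n < 2m`, and each term is
compared with the midpoint value `1 / (n + 1/2)`. The midpoint rule has error `O(m⁻²)`, which the
tight numerics at `m = 60` need. -/
lemma log_two_sub_le_sum_inv {m : ℕ} (hm : 0 < m) :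
    Real.log 2 - 1 / 4 * (3 / (8 * (m : ℝ) ^ 2)) ≤ ∑ k ∈ Finset.range m, 1 / mid m k := by
  have hm0 : (0 : ℝ) < m := by positivity
  have hlog : ∑ k ∈ Finset.range m, (Real.log (m + (k + 1 : ℕ)) - Real.log (m + k)) = Real.log 2 := by
    rw [Finset.sum_range_sub (fun k : ℕ => Real.log (m + k)), ← Real.log_div (by positivity)
      (by positivity)]
    congr 1
    push_cast
    field_simp
    ring
  have h : ∀ k ∈ Finset.range m, Real.log (m + (k + 1 : ℕ)) - Real.log (m + k)
      ≤ 1 / mid m k + 1 / 4 * (1 / (mid m k * ((m + k : ℝ) * (m + k + 1)))) := by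
    intro k _
    have hn : (0 : ℝ) < m + k := by positivity
    have hn1 : (0 : ℝ) < m + k + 1 := by positivity
    have ha : 0 < mid m k := by unfold mid; positivity
    push_cast
    rw [← add_assoc, ← Real.log_div (by positivity) (by positivity)]
    refine (log_le_half_sub_inv ?_).trans (le_of_eq ?_)
    · rw [le_div_iff₀ hn]; linarith
    · have h4 : (m + k : ℝ) * (m + k + 1) = mid m k ^ 2 - 1 / 4 := by unfold mid; ring
      have e1 : (((m : ℝ) + k + 1) / (m + k) - 1 / ((m + k + 1) / (m + k))) / 2
          = mid m k / ((m + k : ℝ) * (m + k + 1)) := by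
        unfold mid; field_simp; ring
      rw [e1, div_eq_iff (by positivity)]
      field_simp
      rw [mul_assoc, h4]
      ring
  have := Finset.sum_le_sum h
  rw [hlog, Finset.sum_add_distrib, ← Finset.mul_sum] at this
  have h2 := sum_inv_prod_le hm
  linarith

/-- The sum is close to `9.104 log 2`. The constant is slightly above `2π / log 2 ≈ 9.065`, enough
to absorb the cubic term of `arctan` at `m = 60`, yet small enough for `sum_log_lt`. It bounds the
height at which the curve of phase `2π` meets `Re z = 1/2`. -/
lemma two_pi_le_sum_arctan {m : ℕ} (hm : 60 ≤ m) :
    2 * Real.pi ≤ ∑ k ∈ Finset.range m, Real.arctan (9.104 / mid m k) := by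
  have hm0 : 0 < m := by omega
  have hm' : (60 : ℝ) ≤ m := by exact_mod_cast hm
  have h : ∀ k ∈ Finset.range m, 9.104 * (1 / mid m k)
      - 9.104 ^ 3 / 3 * (1 / (mid m k * ((m + k : ℝ) * (m + k + 1)))) ≤ Real.arctan (9.104 / mid m k) := by
    intro k _
    have ha : 0 < mid m k := by unfold mid; positivity
    refine le_trans ?_ (sub_cube_div_le_arctan (by positivity))
    have hn : (0 : ℝ) < (m + k) * (m + k + 1) := by positivity
    have : 1 / mid m k ^ 3 ≤ 1 / (mid m k * ((m + k : ℝ) * (m + k + 1))) := by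
      apply one_div_le_one_div_of_le (by positivity)
      have : (m + k : ℝ) * (m + k + 1) ≤ mid m k ^ 2 := by unfold mid; nlinarith
      nlinarith
    have e : 9.104 / mid m k - (9.104 / mid m k) ^ 3 / 3
        = 9.104 * (1 / mid m k) - 9.104 ^ 3 / 3 * (1 / mid m k ^ 3) := by
      field_simp
    rw [e]
    nlinarith
  have h1 := Finset.sum_le_sum h
  rw [Finset.sum_sub_distrib, ← Finset.mul_sum, ← Finset.mul_sum] at h1
  have h2 := sum_inv_prod_le hm0
  have h3 := log_two_sub_le_sum_inv hm0
  have h4 : 3 / (8 * (m : ℝ) ^ 2) ≤ 3 / (8 * 60 ^ 2) := by gcongr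
  have h5 := Real.log_two_gt_d9
  have h6 := Real.pi_lt_d6
  norm_num at h4
  nlinarith

/-- Shifting the midpoints by `1/2` gains about `(log 2) / 2 ≈ 0.3466`. The imaginary part costs at
most about `(9.104² / 2) / (2m)`, and with the second-order term of the logarithm the loss is about
`0.3464` at `m = 60`. -/
lemma sum_log_lt {m : ℕ} (hm : 60 ≤ m) :
    ∑ k ∈ Finset.range m, Real.log (mid m k ^ 2 + 9.104 ^ 2) / 2
      < ∑ k ∈ Finset.range m, Real.log (m + 1 + k) := by
  have hm0 : 0 < m := by omega
  have hm' : (60 : ℝ) ≤ m := by exact_mod_cast hm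
  have h : ∀ k ∈ Finset.range m, 1 / 2 * (1 / mid m k) - (1 / 8 + 9.104 ^ 2 / 2) * (1 / mid m k ^ 2)
      ≤ Real.log (m + 1 + k) - Real.log (mid m k ^ 2 + 9.104 ^ 2) / 2 := by
    intro k _
    have ha : 0 < mid m k := by unfold mid; positivity
    have e1 : (m + 1 + k : ℝ) = mid m k * (1 + 1 / (2 * mid m k)) := by
      have : mid m k * (1 + 1 / (2 * mid m k)) = mid m k + 1 / 2 := by field_simp
      rw [this]; unfold mid; ring
    have e2 : mid m k ^ 2 + 9.104 ^ 2 = mid m k ^ 2 * (1 + 9.104 ^ 2 / mid m k ^ 2) := by field_simp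
    rw [e1, e2, Real.log_mul (by positivity) (by positivity),
      Real.log_mul (by positivity) (by positivity), Real.log_pow]
    have l1 := Real.le_log_one_add_of_nonneg (x := 1 / (2 * mid m k)) (by positivity)
    have l2 : Real.log (1 + 9.104 ^ 2 / mid m k ^ 2) ≤ 9.104 ^ 2 / mid m k ^ 2 := by
      have := Real.log_le_sub_one_of_pos (x := 1 + 9.104 ^ 2 / mid m k ^ 2) (by positivity)
      linarith
    have l3 : 1 / 2 * (1 / mid m k) - 1 / 8 * (1 / mid m k ^ 2)
        ≤ 2 * (1 / (2 * mid m k)) / (1 / (2 * mid m k) + 2) := by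
      rw [le_div_iff₀ (by positivity)]
      field_simp
      ring_nf
      nlinarith
    have e3 : (1 / 8 + 9.104 ^ 2 / 2) * (1 / mid m k ^ 2)
        = 1 / 8 * (1 / mid m k ^ 2) + 9.104 ^ 2 / mid m k ^ 2 / 2 := by ring
    rw [e3]
    push_cast
    linarith
  have h1 := Finset.sum_le_sum h
  rw [Finset.sum_sub_distrib, ← Finset.mul_sum, ← Finset.mul_sum, Finset.sum_sub_distrib] at h1
  have h2 := sum_inv_sq_le hm0
  have h3 := log_two_sub_le_sum_inv hm0
  have h4 : 3 / (8 * (m : ℝ) ^ 2) ≤ 3 / (8 * 60 ^ 2) := by gcongr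
  have h5 : 1 / (2 * (m : ℝ)) ≤ 1 / (2 * 60) := by gcongr
  have h6 := Real.log_two_gt_d9
  have h7 := h2.trans h5
  norm_num at h4
  rw [← sub_pos]
  refine lt_of_lt_of_le ?_ h1
  linarith

end Sums

/-! #### The curve of constant phase -/

/-- The argument of `∏ (m + s + k + i t)`. -/
def phase (m : ℕ) (s t : ℝ) : ℝ := ∑ k ∈ Finset.range m, Real.arctan (t / (m + s + k))

/-- The logarithm of the modulus of `∏ (m + s + k + i t)`. -/
def logMod (m : ℕ) (s t : ℝ) : ℝ := ∑ k ∈ Finset.range m, Real.log ((m + s + k) ^ 2 + t ^ 2) / 2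

lemma exp_log_add_arctan {a : ℝ} (ha : 0 < a) (t : ℝ) :
    Complex.exp ((Real.log (a ^ 2 + t ^ 2) / 2 : ℝ) + (Real.arctan (t / a) : ℝ) * Complex.I)
      = a + t * Complex.I := by
  have h0 : 0 < a ^ 2 + t ^ 2 := by positivity
  have e : Real.log (a ^ 2 + t ^ 2) / 2 = Real.log (√(a ^ 2 + t ^ 2)) := by
    rw [Real.log_sqrt h0.le]
  have hs : √(1 + (t / a) ^ 2) = √(a ^ 2 + t ^ 2) / a := by
    have : 1 + (t / a) ^ 2 = (a ^ 2 + t ^ 2) / a ^ 2 := by field_simp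
    rw [this, Real.sqrt_div h0.le, Real.sqrt_sq ha.le]
  have hr : √(a ^ 2 + t ^ 2) ≠ 0 := (Real.sqrt_pos.2 h0).ne'
  rw [Complex.exp_add, ← Complex.ofReal_exp, e, Real.exp_log (Real.sqrt_pos.2 h0),
    Complex.exp_mul_I, ← Complex.ofReal_cos, ← Complex.ofReal_sin, Real.cos_arctan,
    Real.sin_arctan, hs]
  have hc : (√(a ^ 2 + t ^ 2) : ℂ) ≠ 0 := by exact_mod_cast hr
  have hac : (a : ℂ) ≠ 0 := by exact_mod_cast ha.ne'
  push_cast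
  field_simp

lemma prod_eq_exp {m : ℕ} {s : ℝ} (hs : -(m : ℝ) < s) (t : ℝ) :
    ∏ k ∈ Finset.range m, ((m : ℂ) + (s + t * Complex.I) + k)
      = Complex.exp (logMod m s t + phase m s t * Complex.I) := by
  rw [logMod, phase]
  push_cast
  rw [Finset.sum_mul, ← Finset.sum_add_distrib, Complex.exp_sum]
  refine Finset.prod_congr rfl fun k _ => ?_
  have hk : (0 : ℝ) ≤ k := k.cast_nonneg
  have := exp_log_add_arctan (a := m + s + k) (by linarith) t
  push_cast at this
  rw [this]
  ring

lemma strictMono_phase {m : ℕ} (hm : 0 < m) {s : ℝ} (hs : -(m : ℝ) < s) : StrictMono (phase m s) := by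
  intro t t' h
  refine Finset.sum_lt_sum_of_nonempty ⟨0, Finset.mem_range.2 hm⟩ fun k _ => ?_
  have hk : (0 : ℝ) ≤ k := k.cast_nonneg
  apply Real.arctan_strictMono
  have : 0 < (m : ℝ) + s + k := by linarith
  gcongr

lemma continuous_phase {m : ℕ} (s : ℝ) : Continuous (phase m s) := by
  unfold phase
  fun_prop

lemma continuousOn_phase {m : ℕ} (t : ℝ) : ContinuousOn (fun s => phase m s t) (Set.Ioi (-m)) := by
  unfold phase
  refine continuousOn_finsetSum _ fun k _ => Real.continuous_arctan.comp_continuousOn ?_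
  refine continuousOn_const.div (by fun_prop) fun s hs => ?_
  have hk : (0 : ℝ) ≤ k := k.cast_nonneg
  have hs' : -(m : ℝ) < s := hs
  linarith

/-- At `t = 2m` every quotient is at least `1`, so the phase is at least `m π / 4`, beyond `2π`; the
intermediate value theorem concludes. -/
lemma exists_phase_eq {m : ℕ} (hm : 60 ≤ m) {s : ℝ} (h0 : 0 ≤ s) (h1 : s ≤ 1) :
    ∃ t, phase m s t = 2 * Real.pi := by
  have hm' : (60 : ℝ) ≤ m := by exact_mod_cast hm
  have e0 : phase m s 0 = 0 := by simp [phase]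
  have e1 : 2 * Real.pi ≤ phase m s (2 * m) := by
    have h : ∀ k ∈ Finset.range m, Real.pi / 4 ≤ Real.arctan (2 * m / (m + s + k)) := by
      intro k hk
      rw [← Real.arctan_one]
      apply Real.arctan_mono
      have hk0 : (0 : ℝ) ≤ k := k.cast_nonneg
      have hk1 : (k : ℝ) + 1 ≤ m := by exact_mod_cast Finset.mem_range.1 hk
      rw [le_div_iff₀ (by linarith)]
      linarith
    have := Finset.card_nsmul_le_sum _ _ _ h
    rw [Finset.card_range, nsmul_eq_mul] at this
    refine le_trans ?_ this
    nlinarith [Real.pi_pos]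
  have := intermediate_value_Icc (by positivity : (0 : ℝ) ≤ 2 * m)
    (continuous_phase (m := m) s).continuousOn
  obtain ⟨t, -, ht⟩ := this ⟨by rw [e0]; positivity, e1⟩
  exact ⟨t, ht⟩

/-- On the curve of phase `2π` the product is real and positive, so being a root reduces to the
equality of moduli `logMod = c`. This is solved by the intermediate value theorem for `s` in `[1/2,
1]`, with strict inequality at `1/2`. -/
theorem exists_root_re_gt_half {m : ℕ} (hm : 60 ≤ m) :
    ∃ z : ℂ, (chi m).IsRoot z ∧ 1 / 2 < z.re ∧ z ≠ 1 := by
  have hm0 : 0 < m := by omega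
  have hm' : (60 : ℝ) ≤ m := by exact_mod_cast hm
  have hex : ∀ s : ℝ, ∃ t, s ∈ Set.Icc (1 / 2 : ℝ) 1 → phase m s t = 2 * Real.pi := fun s => by
    by_cases h : s ∈ Set.Icc (1 / 2 : ℝ) 1
    · obtain ⟨t, ht⟩ := exists_phase_eq hm (s := s) (by linarith [h.1]) h.2
      exact ⟨t, fun _ => ht⟩
    · exact ⟨0, fun h' => absurd h' h⟩
  choose τ hτ using hex
  have hmono : ∀ s ∈ Set.Icc (1 / 2 : ℝ) 1, StrictMono (phase m s) := fun s hs =>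
    strictMono_phase hm0 (by linarith [hs.1])
  have hτpos : ∀ s ∈ Set.Icc (1 / 2 : ℝ) 1, 0 < τ s := fun s hs => by
    rw [← (hmono s hs).lt_iff_lt, hτ s hs]
    simpa [phase] using Real.pi_pos
  -- Continuity of the implicit function from strict monotonicity in `t` and continuity in `s`: the
  -- strict inequalities at `τ s ± ε` persist nearby and trap `τ x`.
  have hτc : ContinuousOn τ (Set.Icc (1 / 2 : ℝ) 1) := by
    intro s hs
    have hc : ∀ t, ContinuousWithinAt (fun s => phase m s t) (Set.Icc (1 / 2 : ℝ) 1) s := fun t =>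
      ((continuousOn_phase t).mono fun x hx => by
        have := hx.1
        simp only [Set.mem_Ioi]
        linarith) s hs
    refine Metric.continuousWithinAt_iff'.2 fun ε hε => ?_
    have h1 : phase m s (τ s - ε) < 2 * Real.pi := by
      rw [← hτ s hs]; exact hmono s hs (by linarith)
    have h2 : 2 * Real.pi < phase m s (τ s + ε) := by
      rw [← hτ s hs]; exact hmono s hs (by linarith)
    filter_upwards [(hc _).eventually_lt_const h1, (hc _).eventually_const_lt h2,
      self_mem_nhdsWithin] with x hx1 hx2 hx
    rw [← hτ x hx, (hmono x hx).lt_iff_lt] at hx1 hx2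
    rw [Real.dist_eq, abs_lt]
    constructor <;> linarith
  let c : ℝ := ∑ k ∈ Finset.range m, Real.log (m + 1 + k)
  have hLc : ContinuousOn (fun s => logMod m s (τ s)) (Set.Icc (1 / 2 : ℝ) 1) := by
    unfold logMod
    refine continuousOn_finsetSum _ fun k _ => ContinuousOn.div_const ?_ 2
    refine ContinuousOn.log (by fun_prop) fun s hs => ?_
    have := hτpos s hs
    positivity
  have hL0 : logMod m (1 / 2) (τ (1 / 2)) < c := by
    have hhalf : (1 / 2 : ℝ) ∈ Set.Icc (1 / 2 : ℝ) 1 := by norm_num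
    have hle : τ (1 / 2) ≤ 9.104 := by
      rw [← (hmono _ hhalf).le_iff_le, hτ _ hhalf]
      refine (two_pi_le_sum_arctan hm).trans (le_of_eq ?_)
      refine Finset.sum_congr rfl fun k _ => ?_
      unfold mid
      congr 2
      ring
    refine lt_of_le_of_lt ?_ (sum_log_lt hm)
    refine Finset.sum_le_sum fun k _ => ?_
    have := hτpos _ hhalf
    have e : mid m k = m + 1 / 2 + k := by unfold mid; ring
    rw [e]
    gcongr
  -- At `s = 1` each factor has real part `m + 1 + k`, so an imaginary part can only increase its
  -- modulus.
  have hL1 : c ≤ logMod m 1 (τ 1) := by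
    refine Finset.sum_le_sum fun k _ => ?_
    have hp : (0 : ℝ) < m + 1 + k := by positivity
    rw [le_div_iff₀ two_pos, mul_comm, ← Nat.cast_ofNat (R := ℝ) (n := 2), ← Real.log_pow]
    apply Real.log_le_log (by positivity)
    nlinarith [sq_nonneg (τ 1)]
  obtain ⟨s, hs, hsc⟩ := intermediate_value_Icc (by norm_num) hLc ⟨hL0.le, hL1⟩
  have hne : s ≠ 1 / 2 := fun h => hL0.ne (h ▸ hsc)
  refine ⟨s + τ s * Complex.I, ?_, ?_, ?_⟩
  · rw [isRoot_chi_iff hm0, prod_eq_exp (by linarith [hs.1]), hτ s hs, Complex.exp_add]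
    simp only at hsc
    rw [hsc, factorial_ratio]
    have e1 : Complex.exp ((2 * Real.pi : ℝ) * Complex.I) = 1 := by
      push_cast; exact Complex.exp_two_pi_mul_I
    rw [e1, mul_one, ← Complex.ofReal_exp, Real.exp_sum]
    push_cast
    refine Finset.prod_congr rfl fun k _ => ?_
    have hp : (0 : ℝ) < m + 1 + k := by positivity
    rw [← Complex.ofReal_exp, Real.exp_log hp]
    push_cast
    rfl
  · simpa using lt_of_le_of_ne hs.1 hne.symm
  · intro h
    have := congrArg Complex.im h
    simp at this
    exact (hτpos s hs).ne' this

/-- A root other than `1` of maximal real part is not real, since `1` is the only real root right of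
`-m`; conjugation makes its imaginary part positive. Uniqueness holds because roots with equal real
part and positive imaginary parts coincide. -/
theorem existsUnique_isLambda2 {m : ℕ} (hm : 60 ≤ m) : ∃! l : ℂ, IsLambda2 m l := by
  have hm0 : 0 < m := by omega
  have hm' : (0 : ℝ) < m := by positivity
  obtain ⟨z, hz, hzre, hz1⟩ := exists_root_re_gt_half hm
  let S : Finset ℂ := (chi m).roots.toFinset.erase 1
  have hS : ∀ w, w ∈ S ↔ w ≠ 1 ∧ (chi m).IsRoot w := fun w => by
    simp [S, Polynomial.mem_roots (chi_ne_zero hm0)]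
  obtain ⟨l, hl, hmax⟩ := S.exists_max_image Complex.re ⟨z, (hS z).2 ⟨hz1, hz⟩⟩
  obtain ⟨hl1, hlr⟩ := (hS l).1 hl
  have hlre : 1 / 2 < l.re := hzre.trans_le (hmax z ((hS z).2 ⟨hz1, hz⟩))
  have hmax' : ∀ w, (chi m).IsRoot w → w ≠ 1 → w.re ≤ l.re := fun w hw hw1 =>
    hmax w ((hS w).2 ⟨hw1, hw⟩)
  have him : l.im ≠ 0 := fun h => hl1 (eq_one_of_real_root hm0 hlr (by linarith) h)
  obtain ⟨k, hk⟩ : ∃ k, IsLambda2 m k ∧ k.re = l.re := by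
    rcases lt_or_gt_of_ne him with h | h
    · exact ⟨conj l, ⟨isRoot_chi_conj hm0 hlr, by simpa using h, by simpa using hmax'⟩, by simp⟩
    · exact ⟨l, ⟨hlr, h, hmax'⟩, rfl⟩
  refine ⟨k, hk.1, fun k' hk' => ?_⟩
  have n1 : ∀ w, IsLambda2 m w → w ≠ 1 := fun w hw h => by
    have := hw.2.1
    simp [h] at this
  have e : k.re = k'.re := le_antisymm (hk'.2.2 k hk.1.1 (n1 k hk.1)) (hk.1.2.2 k' hk'.1 (n1 k' hk'))
  exact (root_eq_of_re_eq hm0 hk.1.1 hk'.1 (by rw [hk.2]; linarith) e hk.1.2.1 hk'.2.1).symm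

lemma half_lt_re_of_isLambda2 {m : ℕ} (hm : 60 ≤ m) {l : ℂ} (hl : IsLambda2 m l) : 1 / 2 < l.re := by
  obtain ⟨z, hz, hzre, hz1⟩ := exists_root_re_gt_half hm
  exact hzre.trans_le (hl.2.2 z hz hz1)

/-! ### One step of the urn -/

section Algebra

variable {m : ℕ}

lemma sum_mul_incr (a : ℕ → ℂ) (i : Fin m) :
    ∑ j : Fin m, a j * (incr m i j : ℂ)
      = -a i + if (i : ℕ) + 1 = m then 2 * a 0 else a (i + 1) := by
  have h1 : ∑ j : Fin m, a j * (if j = i then (-1 : ℂ) else 0) = -a i := by simp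
  have e : ∀ j : Fin m, a j * (incr m i j : ℂ) = a j * (if j = i then (-1 : ℂ) else 0)
      + a j * (if (j : ℕ) = i + 1 then (1 : ℂ) else 0)
      + a j * (if (i : ℕ) + 1 = m ∧ (j : ℕ) = 0 then (2 : ℂ) else 0) := fun j => by
    simp only [incr]
    push_cast
    ring
  simp_rw [e]
  rw [Finset.sum_add_distrib, Finset.sum_add_distrib, h1, add_assoc]
  congr 1
  split_ifs with h
  · have h2 : ∀ j : Fin m, a j * (if (j : ℕ) = i + 1 then (1 : ℂ) else 0) = 0 := fun j => by
      rw [if_neg (by have := j.2; omega), mul_zero]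
    have hm : 0 < m := by omega
    rw [Finset.sum_eq_zero fun j _ => h2 j, zero_add, Finset.sum_eq_single ⟨0, hm⟩]
    · simp [h, mul_comm]
    · intro j _ hj
      have : (j : ℕ) ≠ 0 := fun h' => hj (Fin.ext h')
      simp [this]
    · simp
  · have h2 : ∀ j : Fin m, a j * (if (i : ℕ) + 1 = m ∧ (j : ℕ) = 0 then (2 : ℂ) else 0) = 0 :=
      fun j => by simp [h]
    have hi : (i : ℕ) + 1 < m := lt_of_le_of_ne i.2 h
    rw [Finset.sum_eq_zero fun j _ => h2 j, add_zero, Finset.sum_eq_single ⟨i + 1, hi⟩]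
    · simp
    · intro j _ hj
      have : (j : ℕ) ≠ i + 1 := fun h' => hj (Fin.ext h')
      simp [this]
    · simp

lemma gaps_add (x y : Fin m → ℤ) (i : Fin m) : gaps (x + y) i = gaps x i + gaps y i := by
  simp [gaps, mul_add]

lemma totalGaps_add (x y : Fin m → ℤ) : totalGaps (x + y) = totalGaps x + totalGaps y := by
  simp only [totalGaps, gaps_add, Finset.sum_add_distrib]

lemma totalGaps_incr (i : Fin m) : totalGaps (incr m i) = 1 := by
  have h := sum_mul_incr (fun j => (m : ℂ) + j) i
  have e : ((totalGaps (incr m i) : ℝ) : ℂ) = ∑ j : Fin m, ((m : ℂ) + (j : ℕ)) * (incr m i j : ℂ) := by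
    simp [totalGaps, gaps]
  apply Complex.ofReal_injective
  rw [e, h]
  split_ifs with hi
  · have : (m : ℂ) = i + 1 := by exact_mod_cast hi.symm
    rw [this]; push_cast; ring
  · push_cast; ring

/-- The coefficients of the form `u(l)`. -/
def uCoeff (m : ℕ) (l : ℂ) (i : ℕ) : ℂ := ∏ j ∈ Finset.range i, (l + m + j) / (1 + m + j)

lemma uGap_eq (l : ℂ) (x : Fin m → ℤ) : uGap m l x = ∑ i : Fin m, uCoeff m l i * (gaps x i : ℂ) :=
  rfl

lemma uGap_add (l : ℂ) (x y : Fin m → ℤ) : uGap m l (x + y) = uGap m l x + uGap m l y := by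
  simp only [uGap_eq, gaps_add, Complex.ofReal_add, mul_add, Finset.sum_add_distrib]

lemma one_add_add_ne_zero (m j : ℕ) : (1 + m + j : ℂ) ≠ 0 := by
  have : ((1 + m + j : ℕ) : ℂ) ≠ 0 := by exact_mod_cast (by omega : 1 + m + j ≠ 0)
  simpa using this

lemma uCoeff_succ (l : ℂ) (i : ℕ) :
    (m + (i + 1 : ℕ)) * uCoeff m l (i + 1) = (l + m + i) * uCoeff m l i := by
  rw [uCoeff, Finset.prod_range_succ, ← uCoeff]
  have := one_add_add_ne_zero m i
  push_cast
  field_simp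
  ring

/-- The index `m` is one past the last type. The root equation closes the recursion cyclically, as a
split of type `m` returns two nodes of type `1`, whose coefficient is also `1`. -/
lemma uCoeff_last (hm : 0 < m) {l : ℂ} (hl : (chi m).IsRoot l) : uCoeff m l m = 1 := by
  have h : ∀ j ∈ Finset.range m, (1 + m + j : ℂ) ≠ 0 := fun j _ => one_add_add_ne_zero m j
  rw [uCoeff, Finset.prod_div_distrib, div_eq_one_iff_eq (Finset.prod_ne_zero_iff.2 h)]
  have := (isRoot_chi_iff hm).1 hl
  rw [factorial_ratio] at this
  simpa only [add_comm l, add_comm (1 : ℂ)] using this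

/-- This is the left eigenvector relation of the urn, with eigenvalue `l`. -/
lemma uGap_incr (hm : 0 < m) {l : ℂ} (hl : (chi m).IsRoot l) (i : Fin m) :
    uGap m l (incr m i) = l * uCoeff m l i := by
  have h := sum_mul_incr (fun j => uCoeff m l j * ((m : ℂ) + j)) i
  have e : uGap m l (incr m i) = ∑ j : Fin m, uCoeff m l j * ((m : ℂ) + (j : ℕ)) * (incr m i j : ℂ) := by
    simp [uGap_eq, gaps, mul_assoc]
  rw [e, h]
  have hs := uCoeff_succ (m := m) l i
  split_ifs with hi
  · have h1 : uCoeff m l 0 = 1 := by simp [uCoeff]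
    rw [hi, uCoeff_last hm hl] at hs
    rw [h1]
    push_cast
    linear_combination hs
  · linear_combination hs

lemma e1_eq (hm : 0 < m) : e1 m = Pi.single ⟨0, hm⟩ 1 := by
  funext i
  simp [e1, Pi.single_apply, Fin.ext_iff]

lemma gaps_single (i j : Fin m) (c : ℤ) :
    gaps (Pi.single i c) j = if j = i then ((m : ℝ) + (i : ℕ)) * c else 0 := by
  rw [gaps, Pi.single_apply]
  split_ifs with h <;> simp [h]

lemma totalGaps_single (i : Fin m) (c : ℤ) : totalGaps (Pi.single i c) = ((m : ℝ) + (i : ℕ)) * c := by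
  simp [totalGaps, gaps_single]

lemma totalGaps_e1 (hm : 0 < m) : totalGaps (e1 m) = m := by
  rw [e1_eq hm, totalGaps_single]
  simp

lemma uGap_e1 (hm : 0 < m) (l : ℂ) : uGap m l (e1 m) = m := by
  rw [e1_eq hm, uGap_eq, Finset.sum_eq_single ⟨0, hm⟩]
  · simp [gaps_single, uCoeff]
  · intro j _ hj
    simp [gaps_single, hj]
  · simp

lemma incr_injective : Function.Injective (incr m) := by
  intro i j h
  by_contra hij
  have h1 := congrFun h i
  have h2 := congrFun h j
  have hv : (i : ℕ) ≠ j := fun h => hij (Fin.ext h)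
  simp only [incr, if_true, hij, Ne.symm hij, if_false] at h1 h2
  have hi := i.2
  have hj := j.2
  split_ifs at h1 h2 <;> omega

/-- The transition operator of the fringe chain. -/
def kern (m : ℕ) (f : (Fin m → ℤ) → ℂ) (x : Fin m → ℤ) : ℂ :=
  ∑ i, ((gaps x i / totalGaps x : ℝ) : ℂ) * f (x + incr m i)

/-- The states that can be reached in `n` steps from `e₁`: nonnegative, with `m + n` gaps. -/
def reach (m n : ℕ) : Set (Fin m → ℤ) := {x | (∀ i, 0 ≤ x i) ∧ totalGaps x = m + n}

lemma gaps_nonneg {n : ℕ} {x : Fin m → ℤ} (hx : x ∈ reach m n) (i : Fin m) : 0 ≤ gaps x i := by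
  have : (0 : ℝ) ≤ x i := by exact_mod_cast hx.1 i
  unfold gaps
  positivity

lemma totalGaps_pos (hm : 0 < m) {n : ℕ} {x : Fin m → ℤ} (hx : x ∈ reach m n) :
    0 < totalGaps x := by
  rw [hx.2]; positivity

/-- Because of this finiteness, every function of the state at a fixed step is almost surely
bounded, which settles all integrability questions there. -/
lemma finite_reach (hm : 0 < m) (n : ℕ) : (reach m n).Finite := by
  refine (Set.Finite.pi' fun _ : Fin m => Set.finite_Icc (0 : ℤ) (m + n)).subset fun x hx i => ?_
  refine ⟨hx.1 i, ?_⟩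
  have h1 : gaps x i ≤ totalGaps x :=
    Finset.single_le_sum (fun j _ => gaps_nonneg hx j) (Finset.mem_univ i)
  rw [hx.2, gaps] at h1
  have h2 : (0 : ℝ) ≤ x i := by exact_mod_cast hx.1 i
  have hm1 : (1 : ℝ) ≤ m := by exact_mod_cast hm
  have hi : (0 : ℝ) ≤ (i : ℕ) := Nat.cast_nonneg _
  have : (x i : ℝ) ≤ m + n := by nlinarith
  exact_mod_cast this

lemma e1_mem_reach (hm : 0 < m) : e1 m ∈ reach m 0 := by
  refine ⟨fun i => ?_, by simp [totalGaps_e1 hm]⟩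
  unfold e1
  split_ifs <;> simp

lemma add_incr_mem_reach {n : ℕ} {x : Fin m → ℤ} (hx : x ∈ reach m n) {i : Fin m} (hi : 0 < x i) :
    x + incr m i ∈ reach m (n + 1) := by
  refine ⟨fun j => ?_, by rw [totalGaps_add, hx.2, totalGaps_incr]; push_cast; ring⟩
  have := hx.1 j
  simp only [Pi.add_apply, incr]
  by_cases h : j = i
  · subst h
    simp only [if_true]
    split_ifs <;> omega
  · simp only [h, if_false]
    split_ifs <;> omega

lemma sum_gaps_div (hm : 0 < m) {n : ℕ} {x : Fin m → ℤ} (hx : x ∈ reach m n) :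
    ∑ i, gaps x i / totalGaps x = 1 := by
  rw [← Finset.sum_div, ← totalGaps, div_self (totalGaps_pos hm hx).ne']

end Algebra

lemma exists_bound_of_ae_mem {Ω S : Type*} [MeasurableSpace Ω] {P : Measure Ω} {y : Ω → S}
    {F : Set S} (hF : F.Finite) (hy : ∀ᵐ ω ∂P, y ω ∈ F) (f : S → ℂ) :
    ∃ C, ∀ᵐ ω ∂P, ‖f (y ω)‖ ≤ C := by
  obtain ⟨C, hC⟩ := (hF.image fun x => ‖f x‖).bddAbove
  exact ⟨C, hy.mono fun ω hω => hC ⟨_, hω, rfl⟩⟩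

lemma integrable_mul_of_ae_mem {Ω S : Type*} [MeasurableSpace Ω] [MeasurableSpace S] [Countable S]
    [MeasurableSingletonClass S] {P : Measure Ω} {g : Ω → ℂ} (hg : Integrable g P) {y : Ω → S}
    (hym : Measurable y) {F : Set S} (hF : F.Finite) (hy : ∀ᵐ ω ∂P, y ω ∈ F) (f : S → ℂ) :
    Integrable (fun ω => g ω * f (y ω)) P := by
  obtain ⟨C, hC⟩ := exists_bound_of_ae_mem hF hy f
  exact hg.mul_bdd ((measurable_of_countable f).comp hym).aestronglyMeasurable hC

lemma memLp_of_ae_mem {Ω S : Type*} [MeasurableSpace Ω] [MeasurableSpace S] [Countable S]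
    [MeasurableSingletonClass S] {P : Measure Ω} [IsFiniteMeasure P] {y : Ω → S}
    (hym : Measurable y) {F : Set S} (hF : F.Finite) (hy : ∀ᵐ ω ∂P, y ω ∈ F) (f : S → ℂ) :
    MemLp (fun ω => f (y ω)) 2 P := by
  obtain ⟨C, hC⟩ := exists_bound_of_ae_mem hF hy f
  exact MemLp.of_bound ((measurable_of_countable f).comp hym).aestronglyMeasurable C hC

section Step

variable {Ω E : Type*} [MeasurableSpace Ω] [MeasurableSpace E] {P : Measure Ω}
  [IsProbabilityMeasure P] {m n : ℕ} {R : Ω → E} {p : E → Fin m → ℤ} {y' : Ω → Fin m → ℤ}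

/-- Given `R`, the state moves from `p R` to `p R + w_i` with probability proportional to the number
of gaps of type `i`. -/
def IsStep (P : Measure Ω) (R : Ω → E) (p : E → Fin m → ℤ) (y' : Ω → Fin m → ℤ) : Prop :=
  ∀ (i : Fin m) (A : Set E), MeasurableSet A →
    P {ω | R ω ∈ A ∧ y' ω = p (R ω) + incr m i}
      = ∫⁻ ω in {ω | R ω ∈ A}, ENNReal.ofReal (gaps (p (R ω)) i / totalGaps (p (R ω))) ∂P

variable (hm : 0 < m) (hR : Measurable R) (hp : Measurable p) (hy : Measurable y')
  (hs : IsStep P R p y') (hr : ∀ᵐ ω ∂P, p (R ω) ∈ reach m n)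
include hm hR hp hy hs hr

/-- The events for different `i` are disjoint, as the `w_i` are distinct, and their probabilities
add up to `1`. An absent type has transition probability `0`. -/
lemma IsStep.ae_exists : ∀ᵐ ω ∂P, ∃ i, y' ω = p (R ω) + incr m i ∧ 0 < p (R ω) i := by
  have hmeas : ∀ i, MeasurableSet {ω | y' ω = p (R ω) + incr m i} := fun i =>
    measurableSet_eq_fun hy ((hp.comp hR).add_const _)
  have h1 : P (⋃ i, {ω | y' ω = p (R ω) + incr m i}) = 1 := by
    have hdisj : Pairwise (Function.onFun Disjoint fun i => {ω | y' ω = p (R ω) + incr m i}) := by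
      intro i j hij
      refine Set.disjoint_left.2 fun ω hi hj => hij (incr_injective (m := m) ?_)
      have hi' : y' ω = p (R ω) + incr m i := hi
      have hj' : y' ω = p (R ω) + incr m j := hj
      exact add_left_cancel (hi'.symm.trans hj')
    rw [measure_iUnion hdisj hmeas, tsum_fintype]
    have e : ∀ i, P {ω | y' ω = p (R ω) + incr m i}
        = ∫⁻ ω, ENNReal.ofReal (gaps (p (R ω)) i / totalGaps (p (R ω))) ∂P := fun i => by
      simpa using hs i Set.univ MeasurableSet.univ
    simp_rw [e]
    rw [← lintegral_finsetSum]
    · have : ∀ᵐ ω ∂P, ∑ i, ENNReal.ofReal (gaps (p (R ω)) i / totalGaps (p (R ω))) = 1 := by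
        filter_upwards [hr] with ω hω
        rw [← ENNReal.ofReal_sum_of_nonneg fun i _ =>
          div_nonneg (gaps_nonneg hω i) (totalGaps_pos hm hω).le, sum_gaps_div hm hω,
          ENNReal.ofReal_one]
      rw [lintegral_congr_ae this]
      simp
    · intro i _
      exact ENNReal.measurable_ofReal.comp
        ((measurable_of_countable fun x : Fin m → ℤ => gaps x i / totalGaps x).comp (hp.comp hR))
  have h2 : ∀ᵐ ω ∂P, ω ∈ ⋃ i, {ω | y' ω = p (R ω) + incr m i} := by
    rw [← prob_compl_eq_zero_iff (MeasurableSet.iUnion hmeas)] at h1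
    exact h1
  have h3 : ∀ i, ∀ᵐ ω ∂P, ¬ (p (R ω) i ≤ 0 ∧ y' ω = p (R ω) + incr m i) := fun i => by
    have hA : MeasurableSet {e | p e i ≤ 0} :=
      measurableSet_le ((measurable_pi_apply i).comp hp) measurable_const
    have hA' : MeasurableSet {ω | R ω ∈ {e | p e i ≤ 0}} := hR hA
    have := hs i _ hA
    rw [ae_iff]
    simp only [not_not]
    refine this.trans ?_
    rw [setLIntegral_congr_fun_ae (g := fun _ => 0) hA']
    · simp
    · filter_upwards [hr] with ω hω hωA
      have h0 : p (R ω) i = 0 := le_antisymm hωA (hω.1 i)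
      simp [gaps, h0]
  filter_upwards [h2, ae_all_iff.2 h3] with ω hω h3ω
  obtain ⟨i, hi⟩ := Set.mem_iUnion.1 hω
  refine ⟨i, hi, ?_⟩
  by_contra h
  exact h3ω i ⟨not_lt.1 h, hi⟩

lemma IsStep.ae_mem_reach : ∀ᵐ ω ∂P, y' ω ∈ reach m (n + 1) := by
  filter_upwards [hs.ae_exists hm hR hp hy hr, hr] with ω ⟨i, hi, hpos⟩ hω
  rw [hi]
  exact add_incr_mem_reach hω hpos

-- `IsStep` says that the law of `R` on the event of a move of type `i` has the transition
-- probability as density with respect to the law of `R`; this passes from sets to functions.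
omit [IsProbabilityMeasure P] in
lemma IsStep.setIntegral_eq (i : Fin m) {H : E → ℂ} (hH : Measurable H) :
    ∫ ω in {ω | y' ω = p (R ω) + incr m i}, H (R ω) ∂P
      = ∫ ω, ((gaps (p (R ω)) i / totalGaps (p (R ω)) : ℝ) : ℂ) * H (R ω) ∂P := by
  have hS : MeasurableSet {ω | y' ω = p (R ω) + incr m i} :=
    measurableSet_eq_fun hy ((hp.comp hR).add_const _)
  let ρ : E → ℝ≥0∞ := fun e => ENNReal.ofReal (gaps (p e) i / totalGaps (p e))
  have hρ : Measurable ρ := ENNReal.measurable_ofReal.comp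
    ((measurable_of_countable fun x : Fin m → ℤ => gaps x i / totalGaps x).comp hp)
  have hmap : (P.restrict {ω | y' ω = p (R ω) + incr m i}).map R = (P.map R).withDensity ρ := by
    ext A hA
    rw [Measure.map_apply hR hA, Measure.restrict_apply (hR hA), withDensity_apply _ hA,
      setLIntegral_map hA hρ hR]
    exact hs i A hA
  have e := integral_map (μ := P.restrict {ω | y' ω = p (R ω) + incr m i}) hR.aemeasurable
    (f := H) hH.aestronglyMeasurable
  have e2 : AEStronglyMeasurable (fun x => (ρ x).toReal • H x) (P.map R) :=
    hρ.ennreal_toReal.aestronglyMeasurable.smul hH.aestronglyMeasurable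
  rw [← e, hmap,
    integral_withDensity_eq_integral_toReal_smul hρ
      (Eventually.of_forall fun e => ENNReal.ofReal_lt_top),
    integral_map hR.aemeasurable e2]
  refine integral_congr_ae ?_
  filter_upwards [hr] with ω hω
  simp only [ρ]
  rw [ENNReal.toReal_ofReal (div_nonneg (gaps_nonneg hω i) (totalGaps_pos hm hω).le),
    Complex.real_smul]

/-- The Markov property in integrated form. The past `R` is left abstract so that it applies to
paths of the chain and to paths of the pair (jump time, state). -/
lemma IsStep.integral_eq {h : E → ℂ} (hh : Measurable h) (hi : Integrable (fun ω => h (R ω)) P)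
    (f : (Fin m → ℤ) → ℂ) :
    ∫ ω, h (R ω) * f (y' ω) ∂P = ∫ ω, h (R ω) * kern m f (p (R ω)) ∂P := by
  have hmeas : ∀ i, MeasurableSet {ω | y' ω = p (R ω) + incr m i} := fun i =>
    measurableSet_eq_fun hy ((hp.comp hR).add_const _)
  have hg : ∀ i, Measurable fun e => f (p e + incr m i) := fun i =>
    (measurable_of_countable f).comp (hp.add_const _)
  have hint : ∀ i, Integrable (fun ω => h (R ω) * f (p (R ω) + incr m i)) P := fun i =>
    integrable_mul_of_ae_mem hi (hp.comp hR) (finite_reach hm n) hr fun x => f (x + incr m i)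
  have e1 : ∀ᵐ ω ∂P, h (R ω) * f (y' ω)
      = ∑ i, ({ω | y' ω = p (R ω) + incr m i} : Set Ω).indicator
          (fun ω => h (R ω) * f (p (R ω) + incr m i)) ω := by
    filter_upwards [hs.ae_exists hm hR hp hy hr] with ω ⟨i, hi, _⟩
    rw [Finset.sum_eq_single i]
    · rw [Set.indicator_of_mem (by exact hi), hi]
    · intro j _ hj
      rw [Set.indicator_of_notMem]
      intro hj'
      have hj'' : y' ω = p (R ω) + incr m j := hj'
      exact hj (incr_injective (add_left_cancel (hj''.symm.trans hi)))
    · simp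
  rw [integral_congr_ae e1, integral_finsetSum _ fun i _ => (hint i).indicator (hmeas i)]
  have e2 : ∀ i, ∫ ω, ({ω | y' ω = p (R ω) + incr m i} : Set Ω).indicator
      (fun ω => h (R ω) * f (p (R ω) + incr m i)) ω ∂P
      = ∫ ω, ((gaps (p (R ω)) i / totalGaps (p (R ω)) : ℝ) : ℂ)
        * (h (R ω) * f (p (R ω) + incr m i)) ∂P := fun i => by
    rw [integral_indicator (hmeas i)]
    exact hs.setIntegral_eq hm hR hp hy hr i (hh.mul (hg i))
  simp_rw [e2]
  rw [← integral_finsetSum]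
  · refine integral_congr_ae (Eventually.of_forall fun ω => ?_)
    simp only [kern, Finset.mul_sum]
    refine Finset.sum_congr rfl fun i _ => ?_
    ring
  · intro i _
    have := integrable_mul_of_ae_mem hi (hp.comp hR) (finite_reach hm n) hr
      fun x => ((gaps x i / totalGaps x : ℝ) : ℂ) * f (x + incr m i)
    refine this.congr (Eventually.of_forall fun ω => ?_)
    simp only [Function.comp]
    ring

end Step

/-! ### Martingales along a path -/

section Path

variable {Ω E : Type*} [MeasurableSpace Ω] [MeasurableSpace E]

/-- The trajectory of a process up to time `n`. -/
def path (Z : ℕ → Ω → E) (n : ℕ) (ω : Ω) : Fin (n + 1) → E := fun a => Z a ω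

lemma measurable_path {Z : ℕ → Ω → E} (hZ : ∀ n, Measurable (Z n)) (n : ℕ) : Measurable (path Z n) :=
  measurable_pi_lambda _ fun a => hZ a

/-- The filtration generated by the trajectories. -/
def pathFiltration {Z : ℕ → Ω → E} (hZ : ∀ n, Measurable (Z n)) :
    Filtration ℕ (inferInstance : MeasurableSpace Ω) where
  seq n := MeasurableSpace.comap (path Z n) inferInstance
  mono' := monotone_nat_of_le_succ fun n => by
    rintro _ ⟨A, hA, rfl⟩
    have hm : Measurable fun q : Fin (n + 1 + 1) → E => fun a : Fin (n + 1) => q a.castSucc := by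
      fun_prop
    exact ⟨_, hm hA, rfl⟩
  le' n := (measurable_path hZ n).comap_le

variable {P : Measure Ω} [IsProbabilityMeasure P]

/-- Doob's convergence theorem for L¹-bounded martingales, with the martingale property tested on
the sets of the path filtration. -/
lemma ae_tendsto_of_path_real {Z : ℕ → Ω → E} (hZ : ∀ n, Measurable (Z n))
    {d : ∀ n, (Fin (n + 1) → E) → ℝ} (hd : ∀ n, Measurable (d n))
    (hi : ∀ n, Integrable (fun ω => d n (path Z n ω)) P)
    (hmart : ∀ n (A : Set (Fin (n + 1) → E)), MeasurableSet A →
      ∫ ω in path Z n ⁻¹' A, d (n + 1) (path Z (n + 1) ω) ∂P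
        = ∫ ω in path Z n ⁻¹' A, d n (path Z n ω) ∂P)
    {C : ℝ} (hC : ∀ n, ∫ ω, ‖d n (path Z n ω)‖ ∂P ≤ C) :
    ∀ᵐ ω ∂P, ∃ c, Tendsto (fun n => d n (path Z n ω)) atTop (𝓝 c) := by
  have hM : Martingale (fun n ω => d n (path Z n ω)) (pathFiltration hZ) P := by
    refine martingale_of_setIntegral_eq_succ (fun n => ?_) hi fun n s hs => ?_
    · exact ((hd n).comp (comap_measurable (path Z n))).stronglyMeasurable
    · obtain ⟨A, hA, rfl⟩ := hs
      exact (hmart n A hA).symm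
  refine hM.submartingale.exists_ae_tendsto_of_bdd (R := C.toNNReal) fun n => ?_
  rw [eLpNorm_one_eq_lintegral_enorm, ← ofReal_integral_norm_eq_lintegral_enorm (hi n)]
  exact ENNReal.ofReal_le_ofReal (hC n)

lemma ae_tendsto_of_path {Z : ℕ → Ω → E} (hZ : ∀ n, Measurable (Z n))
    {d : ∀ n, (Fin (n + 1) → E) → ℂ} (hd : ∀ n, Measurable (d n))
    (hi : ∀ n, Integrable (fun ω => d n (path Z n ω)) P)
    (hmart : ∀ n (A : Set (Fin (n + 1) → E)), MeasurableSet A →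
      ∫ ω in path Z n ⁻¹' A, d (n + 1) (path Z (n + 1) ω) ∂P
        = ∫ ω in path Z n ⁻¹' A, d n (path Z n ω) ∂P)
    {C : ℝ} (hC : ∀ n, ∫ ω, ‖d n (path Z n ω)‖ ∂P ≤ C) :
    ∀ᵐ ω ∂P, ∃ c, Tendsto (fun n => d n (path Z n ω)) atTop (𝓝 c) := by
  have h1 := ae_tendsto_of_path_real hZ (d := fun n q => (d n q).re)
    (fun n => Complex.measurable_re.comp (hd n)) (fun n => (hi n).re) (fun n A hA => by
      have := congrArg Complex.re (hmart n A hA)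
      have e1 := integral_re ((hi (n + 1)).restrict (s := path Z n ⁻¹' A))
      have e2 := integral_re ((hi n).restrict (s := path Z n ⁻¹' A))
      simp only [RCLike.re_to_complex] at e1 e2
      rw [e1, e2, this]) (C := C) (fun n => le_trans (integral_mono (hi n).re.norm (hi n).norm
        fun ω => Complex.abs_re_le_norm _) (hC n))
  have h2 := ae_tendsto_of_path_real hZ (d := fun n q => (d n q).im)
    (fun n => Complex.measurable_im.comp (hd n)) (fun n => (hi n).im) (fun n A hA => by
      have := congrArg Complex.im (hmart n A hA)
      have e1 := integral_im ((hi (n + 1)).restrict (s := path Z n ⁻¹' A))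
      have e2 := integral_im ((hi n).restrict (s := path Z n ⁻¹' A))
      simp only [RCLike.im_to_complex] at e1 e2
      rw [e1, e2, this]) (C := C) (fun n => le_trans (integral_mono (hi n).im.norm (hi n).norm
        fun ω => Complex.abs_im_le_norm _) (hC n))
  filter_upwards [h1, h2] with ω ⟨a, ha⟩ ⟨b, hb⟩
  refine ⟨a + b * Complex.I, ?_⟩
  have := (Complex.continuous_ofReal.tendsto _ |>.comp ha).add
    ((Complex.continuous_ofReal.tendsto _ |>.comp hb).mul_const Complex.I)
  refine this.congr fun n => ?_
  simp [Complex.re_add_im]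

end Path

/-! ### Products of Gamma type -/

/-- `∏_{j < n} (s + l + j) / (s + j)`. -/
def gammaProd (s l : ℂ) (n : ℕ) : ℂ := ∏ j ∈ Finset.range n, (s + l + j) / (s + j)

lemma add_natCast_ne_zero {s : ℂ} (hs : 0 < s.re) (j : ℕ) : s + j ≠ 0 := fun h => by
  have := congrArg Complex.re h
  simp at this
  have : (0 : ℝ) ≤ j := j.cast_nonneg
  linarith

lemma gammaProd_ne_zero {s l : ℂ} (hs : 0 < s.re) (hl : 0 < (s + l).re) (n : ℕ) :
    gammaProd s l n ≠ 0 :=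
  Finset.prod_ne_zero_iff.2 fun j _ =>
    div_ne_zero (add_natCast_ne_zero hl j) (add_natCast_ne_zero hs j)

/-- A quotient of two of Euler's sequences for `Γ`. Those have `n + 1` factors against `n` in
`gammaProd`; the extra factor tends to `1`. -/
lemma tendsto_gammaProd {s l : ℂ} (hs : 0 < s.re) (hl : 0 < (s + l).re) :
    Tendsto (fun n : ℕ => (n : ℂ) ^ (-l) * gammaProd s l n) atTop
      (𝓝 (Complex.Gamma s / Complex.Gamma (s + l))) := by
  have h1 : Tendsto (fun n => Complex.GammaSeq s n / Complex.GammaSeq (s + l) n) atTop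
      (𝓝 (Complex.Gamma s / Complex.Gamma (s + l))) := (Complex.GammaSeq_tendsto_Gamma s).div (Complex.GammaSeq_tendsto_Gamma (s + l))
    (Complex.Gamma_ne_zero_of_re_pos hl)
  have h2 : Tendsto (fun n : ℕ => (s + n) / (s + l + n)) atTop (𝓝 1) := by
    have := tendsto_add_mul_div_add_mul_atTop_nhds (𝕜 := ℂ) s (s + l) 1 (one_ne_zero)
    simpa using this
  have h3 := h1.mul h2
  rw [mul_one] at h3
  refine h3.congr' ?_
  filter_upwards [eventually_gt_atTop 0] with n hn
  have hn0 : (n : ℂ) ≠ 0 := by exact_mod_cast hn.ne'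
  have hf : (n ! : ℂ) ≠ 0 := by exact_mod_cast n.factorial_ne_zero
  have p1 : ∏ j ∈ Finset.range n, (s + j) ≠ 0 :=
    Finset.prod_ne_zero_iff.2 fun j _ => add_natCast_ne_zero hs j
  have p2 : ∏ j ∈ Finset.range n, (s + l + j) ≠ 0 :=
    Finset.prod_ne_zero_iff.2 fun j _ => add_natCast_ne_zero hl j
  have q1 := add_natCast_ne_zero hs n
  have q2 := add_natCast_ne_zero hl n
  have c1 : (n : ℂ) ^ s ≠ 0 := by simp [Complex.cpow_eq_zero_iff, hn0]
  have c2 : (n : ℂ) ^ l ≠ 0 := by simp [Complex.cpow_eq_zero_iff, hn0]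
  rw [Complex.GammaSeq, Complex.GammaSeq, Finset.prod_range_succ, Finset.prod_range_succ,
    gammaProd, Finset.prod_div_distrib, Complex.cpow_add _ _ hn0, Complex.cpow_neg]
  field_simp

/-! ### The discrete fringe process -/

section Chain

variable {m : ℕ}

/-- The mean increment of `u(l)` is `l u(l) / (m + n)`, by the eigenvector relation and because the
number of gaps after `n` steps is not random. Hence `u(l) / gammaProd m l n` is a martingale. -/
lemma kern_uGap (hm : 0 < m) {l : ℂ} (hl : (chi m).IsRoot l) {n : ℕ} {x : Fin m → ℤ}
    (hx : x ∈ reach m n) :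
    kern m (uGap m l) x = (m + l + n) / (m + n) * uGap m l x := by
  have ht := (totalGaps_pos hm hx).ne'
  have h1 := sum_gaps_div hm hx
  have h2 : ∑ i, ((gaps x i / totalGaps x : ℝ) : ℂ) * uCoeff m l i = uGap m l x / totalGaps x := by
    rw [uGap_eq, Finset.sum_div]
    refine Finset.sum_congr rfl fun i _ => ?_
    push_cast
    ring
  have h3 : ∑ i, ((gaps x i / totalGaps x : ℝ) : ℂ) = 1 := by exact_mod_cast h1
  have ht' : (totalGaps x : ℂ) = m + n := by rw [hx.2]; push_cast; rfl
  have hmn : (m + n : ℂ) ≠ 0 := by rw [← ht']; exact_mod_cast ht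
  simp only [kern, uGap_add, uGap_incr hm hl, mul_add, Finset.sum_add_distrib]
  rw [← Finset.sum_mul, h3]
  have e : ∀ i : Fin m, ((gaps x i / totalGaps x : ℝ) : ℂ) * (l * uCoeff m l i)
      = l * (((gaps x i / totalGaps x : ℝ) : ℂ) * uCoeff m l i) := fun i => by ring
  simp_rw [e]
  rw [← Finset.mul_sum, h2, ht']
  field_simp
  ring

/-- A bound for the squared increments of `u(l)` along the process. -/
def incrBound (m : ℕ) (l : ℂ) : ℝ := ∑ i : Fin m, ‖l * uCoeff m l i‖ ^ 2

/-- Expanding the square, the cross terms sum exactly by the eigenvector relation to `2 Re l ‖u‖² /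
(m + n)`; the squared increments are bounded by a constant. -/
lemma sum_gaps_norm_sq_le (hm : 0 < m) {l : ℂ} (hl : (chi m).IsRoot l) {n : ℕ} {x : Fin m → ℤ}
    (hx : x ∈ reach m n) :
    ∑ i, gaps x i / totalGaps x * ‖uGap m l (x + incr m i)‖ ^ 2
      ≤ (1 + 2 * l.re / (m + n)) * ‖uGap m l x‖ ^ 2 + incrBound m l := by
  have ht := totalGaps_pos hm hx
  have hp : ∀ i, 0 ≤ gaps x i / totalGaps x := fun i => div_nonneg (gaps_nonneg hx i) ht.le
  have h1 := sum_gaps_div hm hx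
  have e : ∀ i, gaps x i / totalGaps x * ‖uGap m l (x + incr m i)‖ ^ 2
      = gaps x i / totalGaps x * ‖uGap m l x‖ ^ 2
        + 2 * (conj (uGap m l x) * l * (uCoeff m l i * gaps x i)).re / totalGaps x
        + gaps x i / totalGaps x * ‖l * uCoeff m l i‖ ^ 2 := fun i => by
    have hre : (conj (uGap m l x) * l * (uCoeff m l i * gaps x i)).re
        = (uGap m l x * conj (l * uCoeff m l i)).re * gaps x i := by
      have : conj (uGap m l x) * l * (uCoeff m l i * gaps x i)
          = (conj (uGap m l x * conj (l * uCoeff m l i))) * (gaps x i : ℂ) := by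
        simp; ring
      rw [this, Complex.re_mul_ofReal, Complex.conj_re]
    rw [hre, uGap_add, uGap_incr hm hl, ← Complex.normSq_eq_norm_sq, Complex.normSq_add,
      Complex.normSq_eq_norm_sq, Complex.normSq_eq_norm_sq]
    ring
  simp_rw [e]
  rw [Finset.sum_add_distrib, Finset.sum_add_distrib, ← Finset.sum_mul, h1, ← Finset.sum_div,
    ← Finset.mul_sum, ← Complex.re_sum, ← Finset.mul_sum, ← uGap_eq]
  have e2 : (conj (uGap m l x) * l * uGap m l x).re = l.re * ‖uGap m l x‖ ^ 2 := by
    have : conj (uGap m l x) * l * uGap m l x = l * (Complex.normSq (uGap m l x) : ℂ) := by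
      rw [← Complex.mul_conj]; ring
    rw [this, Complex.re_mul_ofReal, Complex.normSq_eq_norm_sq]
  rw [e2, hx.2]
  have e3 : ∑ i, gaps x i / (m + n : ℝ) * ‖l * uCoeff m l i‖ ^ 2 ≤ incrBound m l := by
    refine Finset.sum_le_sum fun i _ => mul_le_of_le_one_left (by positivity) ?_
    rw [← hx.2, ← h1]
    exact Finset.single_le_sum (f := fun i => gaps x i / totalGaps x) (fun j _ => hp j)
      (Finset.mem_univ i)
  have e4 : (1 + 2 * l.re / (m + n : ℝ)) * ‖uGap m l x‖ ^ 2
      = 1 * ‖uGap m l x‖ ^ 2 + 2 * (l.re * ‖uGap m l x‖ ^ 2) / (m + n) := by ring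
  rw [e4]
  linarith

variable {Ω : Type*} [MeasurableSpace Ω] {P : Measure Ω} [IsProbabilityMeasure P]
  {L : ℕ → Ω → Fin m → ℤ}

omit [IsProbabilityMeasure P] in
lemma IsFringeChain.isStep (h : IsFringeChain P m (e1 m) L) (n : ℕ) :
    IsStep P (path L n) (fun q => q (Fin.last n)) (L (n + 1)) := fun i A hA => h.step n i A hA

lemma IsFringeChain.ae_mem_reach (hm : 0 < m) (h : IsFringeChain P m (e1 m) L) (n : ℕ) :
    ∀ᵐ ω ∂P, L n ω ∈ reach m n := by
  induction n with
  | zero =>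
    filter_upwards [h.init] with ω hω
    rw [hω]
    exact e1_mem_reach hm
  | succ n ih =>
    exact (h.isStep n).ae_mem_reach hm (measurable_path h.measurable n) (by fun_prop)
      (h.measurable _) ih

lemma IsFringeChain.integral_path (hm : 0 < m) (h : IsFringeChain P m (e1 m) L) (n : ℕ)
    {g : (Fin (n + 1) → Fin m → ℤ) → ℂ} (hg : Measurable g)
    (hi : Integrable (fun ω => g (path L n ω)) P) (f : (Fin m → ℤ) → ℂ) :
    ∫ ω, g (path L n ω) * f (L (n + 1) ω) ∂P = ∫ ω, g (path L n ω) * kern m f (L n ω) ∂P :=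
  (h.isStep n).integral_eq hm (measurable_path h.measurable n) (by fun_prop)
      (h.measurable _) (h.ae_mem_reach hm n) hg hi f

lemma IsFringeChain.memLp (hm : 0 < m) (h : IsFringeChain P m (e1 m) L) (n : ℕ)
    (f : (Fin m → ℤ) → ℂ) : MemLp (fun ω => f (L n ω)) 2 P :=
  memLp_of_ae_mem (h.measurable n) (finite_reach hm n) (h.ae_mem_reach hm n) f

lemma IsFringeChain.integral_succ (hm : 0 < m) (h : IsFringeChain P m (e1 m) L) (n : ℕ)
    (f : (Fin m → ℤ) → ℂ) :
    ∫ ω, f (L (n + 1) ω) ∂P = ∫ ω, kern m f (L n ω) ∂P := by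
  simpa using h.integral_path hm n (g := fun _ => 1) measurable_const (integrable_const _) f

lemma IsFringeChain.setIntegral_succ (hm : 0 < m) (h : IsFringeChain P m (e1 m) L) (n : ℕ)
    {A : Set (Fin (n + 1) → Fin m → ℤ)} (hA : MeasurableSet A) (f : (Fin m → ℤ) → ℂ) :
    ∫ ω in path L n ⁻¹' A, f (L (n + 1) ω) ∂P = ∫ ω in path L n ⁻¹' A, kern m f (L n ω) ∂P := by
  have hA' := measurable_path h.measurable n hA
  have := h.integral_path hm n (g := A.indicator fun _ => 1) (measurable_const.indicator hA)
    ((integrable_const (1 : ℂ)).indicator hA') f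
  rw [← integral_indicator hA', ← integral_indicator hA']
  have e : ∀ F : Ω → ℂ, ∀ ω, (path L n ⁻¹' A).indicator F ω
      = A.indicator (fun _ => (1 : ℂ)) (path L n ω) * F ω := fun F ω => by
    by_cases hω : path L n ω ∈ A
    · rw [Set.indicator_of_mem (by exact hω), Set.indicator_of_mem hω, one_mul]
    · rw [Set.indicator_of_notMem (by exact hω), Set.indicator_of_notMem hω, zero_mul]
  simp_rw [e]
  exact this

/-- The chain's one-time expectations thus become iterates of a deterministic operator, on which the
branching identity is proved. -/
lemma IsFringeChain.integral_eq_iterate (hm : 0 < m) (h : IsFringeChain P m (e1 m) L) (n : ℕ)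
    (f : (Fin m → ℤ) → ℂ) : ∫ ω, f (L n ω) ∂P = ((kern m)^[n] f) (e1 m) := by
  induction n generalizing f with
  | zero =>
    have : ∀ᵐ ω ∂P, f (L 0 ω) = f (e1 m) := h.init.mono fun ω hω => by rw [hω]
    rw [integral_congr_ae this]
    simp
  | succ n ih => rw [h.integral_succ hm, ih, Function.iterate_succ_apply]

lemma IsFringeChain.integral_norm_sq_le (hm : 0 < m) (h : IsFringeChain P m (e1 m) L) {l : ℂ}
    (hl : (chi m).IsRoot l) (n : ℕ) :
    ∫ ω, ‖uGap m l (L (n + 1) ω)‖ ^ 2 ∂P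
      ≤ (1 + 2 * l.re / (m + n)) * ∫ ω, ‖uGap m l (L n ω)‖ ^ 2 ∂P + incrBound m l := by
  have h1 := h.integral_succ hm n fun x => ((‖uGap m l x‖ ^ 2 : ℝ) : ℂ)
  have h2 : ∀ x, kern m (fun x => ((‖uGap m l x‖ ^ 2 : ℝ) : ℂ)) x
      = ((∑ i, gaps x i / totalGaps x * ‖uGap m l (x + incr m i)‖ ^ 2 : ℝ) : ℂ) := fun x => by
    simp [kern]
  simp_rw [h2] at h1
  rw [integral_complex_ofReal, integral_complex_ofReal] at h1
  have h3 := Complex.ofReal_injective h1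
  rw [h3]
  have i1 := (h.memLp hm n (uGap m l)).integrable_norm_pow (p := 2) (by norm_num)
  have i2 := (h.memLp hm n fun x =>
    ((∑ i, gaps x i / totalGaps x * ‖uGap m l (x + incr m i)‖ ^ 2 : ℝ) : ℂ)).integrable
      (by norm_num)
  calc _ ≤ ∫ ω, ((1 + 2 * l.re / (m + n)) * ‖uGap m l (L n ω)‖ ^ 2 + incrBound m l) ∂P := by
        refine integral_mono_ae ?_ ((i1.const_mul _).add (integrable_const _)) ?_
        · exact i2.re
        · filter_upwards [h.ae_mem_reach hm n] with ω hω using sum_gaps_norm_sq_le hm hl hω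
    _ = _ := by
        rw [integral_add (i1.const_mul _) (integrable_const _), integral_const_mul]
        simp

end Chain

/-! ### The limit of the discrete fringe process -/

lemma summable_inv_gammaProd_sq {s l : ℂ} (hs : 0 < s.re) (hl : 0 < (s + l).re)
    (h : 1 / 2 < l.re) : Summable fun n : ℕ => (‖gammaProd s l n‖ ^ 2)⁻¹ := by
  have h0 : Complex.Gamma s / Complex.Gamma (s + l) ≠ 0 :=
    div_ne_zero (Complex.Gamma_ne_zero_of_re_pos hs) (Complex.Gamma_ne_zero_of_re_pos hl)
  have h1 := ((tendsto_gammaProd hs hl).norm.pow 2).inv₀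
    (pow_ne_zero 2 (norm_ne_zero_iff.2 h0))
  have h2 : (fun n : ℕ => (‖gammaProd s l n‖ ^ 2)⁻¹)
      =O[atTop] fun n : ℕ => ((n : ℝ) ^ (2 * l.re))⁻¹ := by
    have h3 := (h1.isBigO_one ℝ).mul
      (isBigO_refl (fun n : ℕ => ((n : ℝ) ^ (2 * l.re))⁻¹) atTop)
    refine h3.congr' ?_ (Eventually.of_forall fun n => one_mul _)
    filter_upwards [eventually_gt_atTop 0] with n hn
    have hn' : (0 : ℝ) < n := by exact_mod_cast hn
    have : ‖(n : ℂ) ^ (-l)‖ ^ 2 = ((n : ℝ) ^ (2 * l.re))⁻¹ := by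
      rw [Complex.norm_natCast_cpow_of_pos hn, ← Real.rpow_natCast, ← Real.rpow_mul hn'.le,
        ← Real.rpow_neg hn'.le]
      congr 1
      simp
      ring
    rw [norm_mul, mul_pow, this, mul_inv, inv_inv]
    have : (n : ℝ) ^ (2 * l.re) ≠ 0 := (Real.rpow_pos_of_pos hn' _).ne'
    field_simp
  exact summable_of_isBigO_nat (Real.summable_nat_rpow_inv.2 (by linarith)) h2

section Chain

variable {m : ℕ} {Ω : Type*} [MeasurableSpace Ω] {P : Measure Ω} [IsProbabilityMeasure P]
  {L : ℕ → Ω → Fin m → ℤ}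

/-- After normalisation the second moment grows at step `n` by at most a constant over `‖gammaProd m
l (n + 1)‖²`. This is of order `n ^ (-2 Re l)`, summable exactly when `Re l > 1/2`. -/
lemma IsFringeChain.exists_bound (hm : 0 < m) (h : IsFringeChain P m (e1 m) L) {l : ℂ}
    (hl : (chi m).IsRoot l) (hr : 1 / 2 < l.re) :
    ∃ C, ∀ n, ∫ ω, ‖uGap m l (L n ω) / gammaProd m l n‖ ^ 2 ∂P ≤ C := by
  have hm' : (0 : ℝ) < m := by exact_mod_cast hm
  have hs : 0 < (m : ℂ).re := by simpa using hm'
  have hsl : 0 < ((m : ℂ) + l).re := by simp; linarith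
  have hg := gammaProd_ne_zero hs hsl
  have hS := summable_inv_gammaProd_sq hs hsl hr
  set a : ℕ → ℝ := fun n => ∫ ω, ‖uGap m l (L n ω) / gammaProd m l n‖ ^ 2 ∂P with ha
  have ha' : ∀ n, a n = (∫ ω, ‖uGap m l (L n ω)‖ ^ 2 ∂P) / ‖gammaProd m l n‖ ^ 2 := fun n => by
    simp only [ha, norm_div, div_pow]
    rw [integral_div]
  have hC0 : 0 ≤ incrBound m l := Finset.sum_nonneg fun i _ => by positivity
  have hstep : ∀ n, a (n + 1) ≤ a n + incrBound m l * (‖gammaProd m l (n + 1)‖ ^ 2)⁻¹ := fun n => by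
    have h1 := h.integral_norm_sq_le hm hl n
    have hpos : 0 < ‖gammaProd m l n‖ ^ 2 := by have := norm_pos_iff.2 (hg n); positivity
    have hpos' : 0 < ‖gammaProd m l (n + 1)‖ ^ 2 := by
      have := norm_pos_iff.2 (hg (n + 1)); positivity
    have hE : 0 ≤ ∫ ω, ‖uGap m l (L n ω)‖ ^ 2 ∂P := integral_nonneg fun ω => by positivity
    -- This is `|1 + l / (m + n)|² ≥ 1 + 2 Re l / (m + n)`.
    have h2 : (1 + 2 * l.re / (m + n)) * ‖gammaProd m l n‖ ^ 2 ≤ ‖gammaProd m l (n + 1)‖ ^ 2 := by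
      have e : gammaProd m l (n + 1) = gammaProd m l n * (((1 : ℝ) + l.re / (m + n) : ℝ)
          + ((l.im / (m + n) : ℝ) : ℂ) * Complex.I) := by
        rw [gammaProd, Finset.prod_range_succ, ← gammaProd]
        congr 1
        have : (m + n : ℂ) ≠ 0 := add_natCast_ne_zero hs n
        nth_rewrite 1 [← Complex.re_add_im l]
        push_cast
        field_simp
        ring
      rw [e, norm_mul, mul_pow, ← Complex.normSq_eq_norm_sq (_ + _ * Complex.I),
        Complex.normSq_add_mul_I, mul_comm]
      refine mul_le_mul_of_nonneg_left ?_ hpos.le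
      have : (1 + l.re / (m + n : ℝ)) ^ 2 = 1 + 2 * l.re / (m + n) + (l.re / (m + n)) ^ 2 := by ring
      rw [this]
      nlinarith [sq_nonneg (l.re / (m + n : ℝ)), sq_nonneg (l.im / (m + n : ℝ))]
    rw [ha', ha']
    calc _ ≤ ((1 + 2 * l.re / (m + n)) * (∫ ω, ‖uGap m l (L n ω)‖ ^ 2 ∂P) + incrBound m l)
          / ‖gammaProd m l (n + 1)‖ ^ 2 := by gcongr
      _ = (1 + 2 * l.re / (m + n)) * (∫ ω, ‖uGap m l (L n ω)‖ ^ 2 ∂P) / ‖gammaProd m l (n + 1)‖ ^ 2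
          + incrBound m l * (‖gammaProd m l (n + 1)‖ ^ 2)⁻¹ := by rw [add_div]; rfl
      _ ≤ _ := by
        gcongr ?_ + _
        rw [div_le_div_iff₀ hpos' hpos]
        calc _ = (∫ ω, ‖uGap m l (L n ω)‖ ^ 2 ∂P)
              * ((1 + 2 * l.re / (m + n)) * ‖gammaProd m l n‖ ^ 2) := by ring
          _ ≤ _ := by gcongr
  have hsum : ∀ n, a n ≤ a 0 + incrBound m l * ∑ k ∈ Finset.range n, (‖gammaProd m l (k + 1)‖ ^ 2)⁻¹ := by
    intro n
    induction n with
    | zero => simp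
    | succ n ih =>
      rw [Finset.sum_range_succ, mul_add]
      linarith [hstep n]
  refine ⟨a 0 + incrBound m l * ∑' k, (‖gammaProd m l (k + 1)‖ ^ 2)⁻¹, fun n => (hsum n).trans ?_⟩
  gcongr
  exact ((summable_nat_add_iff 1).2 hS).sum_le_tsum _ fun k _ => by positivity

lemma IsFringeChain.integral_uGap (hm : 0 < m) (h : IsFringeChain P m (e1 m) L) {l : ℂ}
    (hl : (chi m).IsRoot l) (n : ℕ) : ∫ ω, uGap m l (L n ω) ∂P = m * gammaProd m l n := by
  induction n with
  | zero =>
    rw [h.integral_eq_iterate hm]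
    simp [uGap_e1 hm, gammaProd]
  | succ n ih =>
    have e : ∀ᵐ ω ∂P, kern m (uGap m l) (L n ω) = (m + l + n) / (m + n) * uGap m l (L n ω) := by
      filter_upwards [h.ae_mem_reach hm n] with ω hω using kern_uGap hm hl hω
    rw [h.integral_succ hm, integral_congr_ae e, integral_const_mul, ih]
    simp only [gammaProd, Finset.prod_range_succ]
    ring

theorem IsFringeChain.exists_limit (hm : 0 < m) (h : IsFringeChain P m (e1 m) L) {l : ℂ}
    (hl : (chi m).IsRoot l) (hr : 1 / 2 < l.re) :
    ∃ W : Ω → ℂ, Measurable W ∧ IsDiscreteLimit P m l L W ∧ MemLp W 2 P ∧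
      ∫ ω, W ω ∂P = (m ! : ℂ) / Complex.Gamma (m + l) ∧
      Tendsto (fun n : ℕ => ∫ ω, ‖(n : ℂ) ^ (-l) * uGap m l (L n ω) - W ω‖ ∂P) atTop (𝓝 0) := by
  have hm' : (0 : ℝ) < m := by exact_mod_cast hm
  have hs : 0 < (m : ℂ).re := by simpa using hm'
  have hsl : 0 < ((m : ℂ) + l).re := by simp; linarith
  have hg := gammaProd_ne_zero hs hsl
  obtain ⟨C, hC⟩ := h.exists_bound hm hl hr
  have hM : ∀ n, MemLp (fun ω => uGap m l (L n ω) / gammaProd m l n) 2 P := fun n =>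
    h.memLp hm n fun x => uGap m l x / gammaProd m l n
  have hconv : ∀ᵐ ω ∂P, ∃ c, Tendsto (fun n => uGap m l (L n ω) / gammaProd m l n) atTop (𝓝 c) := by
    refine ae_tendsto_of_path h.measurable
      (d := fun n q => uGap m l (q (Fin.last n)) / gammaProd m l n) (fun n => ?_)
      (fun n => (hM n).integrable (by norm_num)) (fun n A hA => ?_) (C := √C) fun n =>
        (integral_norm_le_sqrt (hM n)).trans (Real.sqrt_le_sqrt (hC n))
    · exact (measurable_of_countable fun x : Fin m → ℤ => uGap m l x / gammaProd m l n).comp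
        (measurable_pi_apply (Fin.last n))
    · change ∫ ω in path L n ⁻¹' A, uGap m l (L (n + 1) ω) / gammaProd m l (n + 1) ∂P
        = ∫ ω in path L n ⁻¹' A, uGap m l (L n ω) / gammaProd m l n ∂P
      rw [h.setIntegral_succ hm n hA fun x => uGap m l x / gammaProd m l (n + 1)]
      refine integral_congr_ae (ae_restrict_of_ae ?_)
      filter_upwards [h.ae_mem_reach hm n] with ω hω
      have e : kern m (fun x => uGap m l x / gammaProd m l (n + 1)) (L n ω)
          = kern m (uGap m l) (L n ω) / gammaProd m l (n + 1) := by
        simp only [kern, Finset.sum_div, mul_div_assoc]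
      have h2 : gammaProd m l (n + 1) = gammaProd m l n * ((m + l + n) / (m + n)) := by
        rw [gammaProd, Finset.prod_range_succ, ← gammaProd]
      rw [e, kern_uGap hm hl hω, h2]
      have h3 := hg n
      have h4 := add_natCast_ne_zero hsl n
      have h5 := add_natCast_ne_zero hs n
      field_simp
  have ht := tendsto_gammaProd hs hsl
  have hconv' : ∀ᵐ ω ∂P, ∃ c, Tendsto (fun n : ℕ => (n : ℂ) ^ (-l) * uGap m l (L n ω)) atTop (𝓝 c) := by
    filter_upwards [hconv] with ω ⟨c, hc⟩
    refine ⟨_, (ht.mul hc).congr fun n => ?_⟩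
    have := hg n
    field_simp
  have hX : ∀ n : ℕ, MemLp (fun ω => (n : ℂ) ^ (-l) * uGap m l (L n ω)) 2 P := fun n =>
    h.memLp hm n fun x => (n : ℂ) ^ (-l) * uGap m l x
  obtain ⟨W, hW, hlim⟩ := measurable_limit_of_tendsto_metrizable_ae
    (fun n => (hX n).1.aemeasurable) hconv'
  obtain ⟨D, hD⟩ : ∃ D, ∀ n : ℕ, ‖(n : ℂ) ^ (-l) * gammaProd m l n‖ ≤ D := by
    obtain ⟨D, hD⟩ := ht.norm.bddAbove_range
    exact ⟨D, fun n => hD ⟨n, rfl⟩⟩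
  have hD0 : 0 ≤ D := (norm_nonneg _).trans (hD 0)
  have hXC : ∀ n : ℕ, ∫ ω, ‖(n : ℂ) ^ (-l) * uGap m l (L n ω)‖ ^ 2 ∂P ≤ D ^ 2 * C := fun n => by
    have e : ∀ ω, ‖(n : ℂ) ^ (-l) * uGap m l (L n ω)‖ ^ 2
        = ‖(n : ℂ) ^ (-l) * gammaProd m l n‖ ^ 2 * ‖uGap m l (L n ω) / gammaProd m l n‖ ^ 2 :=
      fun ω => by
        rw [← mul_pow, ← norm_mul]
        have := hg n
        congr 2
        field_simp
    simp_rw [e]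
    rw [integral_const_mul]
    have : 0 ≤ ∫ ω, ‖uGap m l (L n ω) / gammaProd m l n‖ ^ 2 ∂P :=
      integral_nonneg fun ω => by positivity
    gcongr
    · exact hD n
    · exact hC n
  refine ⟨W, hW, hlim, (memLp_two_of_tendsto_ae hX hXC hlim).1, ?_,
    tendsto_integral_norm_sub hX hXC hlim⟩
  have h1 := tendsto_integral_of_sq_bounded hX hXC hlim
  have h2 := h.integral_uGap hm hl
  have h3 : Tendsto (fun n : ℕ => ∫ ω, (n : ℂ) ^ (-l) * uGap m l (L n ω) ∂P) atTop
      (𝓝 (m * (Complex.Gamma m / Complex.Gamma (m + l)))) := by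
    refine (ht.const_mul (m : ℂ)).congr fun n => ?_
    rw [integral_const_mul, h2]
    ring
  rw [tendsto_nhds_unique h1 h3, ← mul_div_assoc]
  congr 1
  rw [← Complex.Gamma_add_one _ (by exact_mod_cast hm.ne'), Complex.Gamma_nat_eq_factorial]

end Chain

/-! ### Biorthogonality and asymptotic expansions -/

section Biorthogonal

variable {m : ℕ}

lemma uCoeff_mul_vVec {l μ : ℂ} (hμ : 0 < (m + μ).re) (i : ℕ) :
    uCoeff m l i * (1 / ((m + μ) * harm m (m + μ - 1))
        * ∏ j ∈ Finset.Icc 1 i, ((m : ℂ) + j) / (m + j + μ))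
      = 1 / harm m (m + μ - 1)
        * ((∏ j ∈ Finset.range i, (m + l + j) / (m + μ + j)) / (m + μ + i)) := by
  have h0 : (m + μ : ℂ) ≠ 0 := by simpa using add_natCast_ne_zero hμ 0
  suffices h : uCoeff m l i * ∏ j ∈ Finset.Icc 1 i, ((m : ℂ) + j) / (m + j + μ)
      = (∏ j ∈ Finset.range i, (m + l + j) / (m + μ + j)) * ((m + μ) / (m + μ + i)) by
    calc _ = 1 / ((m + μ) * harm m (m + μ - 1))
          * (uCoeff m l i * ∏ j ∈ Finset.Icc 1 i, ((m : ℂ) + j) / (m + j + μ)) := by ring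
      _ = 1 / harm m (m + μ - 1) * ((∏ j ∈ Finset.range i, (m + l + j) / (m + μ + j)) / (m + μ + i))
          * ((m + μ) / (m + μ)) := by
            rw [h]
            simp only [mul_inv, div_eq_mul_inv]
            ring
      _ = _ := by rw [div_self h0, mul_one]
  induction i with
  | zero => simp [uCoeff, h0]
  | succ i ih =>
    have h1 := add_natCast_ne_zero hμ i
    have h2 := add_natCast_ne_zero hμ (i + 1)
    have h3 := one_add_add_ne_zero m i
    have e : uCoeff m l (i + 1) = uCoeff m l i * ((l + m + i) / (1 + m + i)) := by
      rw [uCoeff, Finset.prod_range_succ, ← uCoeff]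
    rw [e, Finset.prod_Icc_succ_top (by omega), Finset.prod_range_succ]
    calc _ = (uCoeff m l i * ∏ j ∈ Finset.Icc 1 i, ((m : ℂ) + j) / (m + j + μ))
          * ((l + m + i) / (1 + m + i) * ((m + (i + 1 : ℕ)) / (m + (i + 1 : ℕ) + μ))) := by ring
      _ = _ := by
        rw [ih, show (m : ℂ) + (i + 1 : ℕ) + μ = m + μ + (i + 1 : ℕ) by ring,
          show (m : ℂ) + (i + 1 : ℕ) = 1 + m + i by push_cast; ring]
        field_simp
        ring

lemma sum_uCoeff_mul_vVec {l μ : ℂ} (hμ : 0 < (m + μ).re) :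
    ∑ i : Fin m, uCoeff m l i * vVec m μ i
      = 1 / harm m (m + μ - 1) * ∑ i ∈ Finset.range m,
        (∏ j ∈ Finset.range i, (m + l + j) / (m + μ + j)) / (m + μ + i) := by
  simp only [vVec]
  rw [Fin.sum_univ_eq_sum_range fun i => uCoeff m l i * (1 / ((m + μ) * harm m (m + μ - 1))
        * ∏ j ∈ Finset.Icc 1 i, ((m : ℂ) + j) / (m + j + μ)), Finset.mul_sum]
  exact Finset.sum_congr rfl fun i _ => uCoeff_mul_vVec hμ i

/-- Up to the factor `l - μ` and a constant the pairing is a telescoping sum `a m - a 0`. Both ends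
equal `1`, since the two full products take the same value at roots. -/
lemma sum_uCoeff_mul_vVec_of_ne (hm : 0 < m) {l μ : ℂ} (hμ : 0 < (m + μ).re)
    (hl : (chi m).IsRoot l) (hr : (chi m).IsRoot μ) (h : l ≠ μ) :
    ∑ i : Fin m, uCoeff m l i * vVec m μ i = 0 := by
  set a : ℕ → ℂ := fun i => ∏ j ∈ Finset.range i, (m + l + j) / (m + μ + j) with ha
  have h1 : ∀ i, a (i + 1) - a i = (l - μ) * (a i / (m + μ + i)) := fun i => by
    have := add_natCast_ne_zero hμ i
    simp only [ha, Finset.prod_range_succ]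
    field_simp
    ring
  have h2 : (l - μ) * ∑ i ∈ Finset.range m, a i / (m + μ + i) = a m - a 0 := by
    rw [Finset.mul_sum, ← Finset.sum_range_sub]
    exact Finset.sum_congr rfl fun i _ => (h1 i).symm
  have h3 : a m = a 0 := by
    simp only [ha, Finset.prod_div_distrib, Finset.range_zero, Finset.prod_empty]
    rw [(isRoot_chi_iff hm).1 hl, (isRoot_chi_iff hm).1 hr]
    have h4 : ((2 * m)! : ℂ) / (m ! : ℂ) ≠ 0 := div_ne_zero
      (Nat.cast_ne_zero.2 (2 * m).factorial_ne_zero) (Nat.cast_ne_zero.2 m.factorial_ne_zero)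
    rw [div_self h4, div_one]
  rw [h3, sub_self] at h2
  rw [sum_uCoeff_mul_vVec hμ, (mul_eq_zero.1 h2).resolve_left (sub_ne_zero.2 h), mul_zero]

lemma sum_uCoeff_mul_vVec_self (hm : 0 < m) {l : ℂ} (hl : 0 < (m + l).re) :
    ∑ i : Fin m, uCoeff m l i * vVec m l i = 1 := by
  have h1 : ∀ i : ℕ, ∏ j ∈ Finset.range i, (m + l + j) / (m + l + j) = 1 := fun i =>
    Finset.prod_eq_one fun j _ => div_self (add_natCast_ne_zero hl j)
  have h2 : harm m (m + l - 1) = ∑ i ∈ Finset.range m, 1 / (m + l + i) := by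
    rw [harm, Finset.range_eq_Ico, ← Finset.Ico_add_one_right_eq_Icc]
    have := Finset.sum_Ico_add' (fun k : ℕ => 1 / (m + l - 1 + k : ℂ)) 0 m 1
    rw [zero_add] at this
    rw [← this]
    refine Finset.sum_congr rfl fun i _ => ?_
    push_cast
    ring
  rw [sum_uCoeff_mul_vVec hl]
  simp_rw [h1]
  rw [← h2, one_div, inv_mul_cancel₀]
  intro h
  rw [h2] at h
  have h3 := congrArg Complex.re h
  rw [Complex.re_sum, Complex.zero_re] at h3
  refine (Finset.sum_pos (fun i _ => ?_) ⟨0, Finset.mem_range.2 hm⟩).ne' h3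
  have h4 := add_natCast_ne_zero hl i
  rw [one_div, Complex.inv_re]
  refine div_pos ?_ (Complex.normSq_pos.2 h4)
  simp at hl ⊢
  positivity

lemma conj_pInvV (l : ℂ) (i : Fin m) : conj (pInvV m l i) = pInvV m (conj l) i := by
  simp [pInvV, vVec, harm, map_prod, map_sum]

/-- Writing `2 Re (z v(l)) = z v(l) + conj z v(conj l)`, the form `u(l)` kills `v(1)` and `v(conj
l)` and takes the value `1` on `v(l)`. The coefficient `r` of `v(1)` is arbitrary, which covers both
time scales. -/
lemma uGap_sub_isLittleO (hm : 0 < m) {l : ℂ} (hl : (chi m).IsRoot l) (hr : 0 < l.re) (hi : 0 < l.im)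
    {α : Type*} {F : Filter α} {x : α → Fin m → ℤ} {r z : α → ℂ} {s g : α → ℝ}
    (h : ∀ i, (fun t => (x t i : ℂ) - (r t * pInvV m 1 i + 2 * ((z t * pInvV m l i).re : ℂ) * s t))
      =o[F] g) :
    (fun t => uGap m l (x t) - z t * s t) =o[F] g := by
  have hm' : (0 : ℝ) < m := by exact_mod_cast hm
  have b0 := sum_uCoeff_mul_vVec_of_ne hm (l := l) (μ := 1) (by simp; linarith) hl (isRoot_chi_one hm)
    fun h => by simp [h] at hi
  have b1 := sum_uCoeff_mul_vVec_self hm (l := l) (by simp; linarith)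
  have b2 := sum_uCoeff_mul_vVec_of_ne hm (l := l) (μ := conj l) (by simp; linarith) hl
    (isRoot_chi_conj hm hl) fun h => by
      have := congrArg Complex.im h
      simp at this
      linarith
  have hp : ∀ (μ : ℂ) (i : Fin m), (m + (i : ℕ)) * pInvV m μ i = vVec m μ i := fun μ i => by
    have : (m + (i : ℕ) : ℂ) ≠ 0 := add_natCast_ne_zero (by simpa using hm') i
    rw [pInvV]
    field_simp
  have e : ∀ t, uGap m l (x t) - z t * s t = ∑ i : Fin m, uCoeff m l i * (m + (i : ℕ))
      * ((x t i : ℂ) - (r t * pInvV m 1 i + 2 * ((z t * pInvV m l i).re : ℂ) * s t)) := fun t => by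
    have e1 : ∀ i : Fin m, uCoeff m l i * (m + (i : ℕ))
        * ((x t i : ℂ) - (r t * pInvV m 1 i + 2 * ((z t * pInvV m l i).re : ℂ) * s t))
        = uCoeff m l i * gaps (x t) i - (r t * (uCoeff m l i * vVec m 1 i)
          + z t * s t * (uCoeff m l i * vVec m l i)
          + conj (z t) * s t * (uCoeff m l i * vVec m (conj l) i)) := fun i => by
      have := Complex.add_conj (z t * pInvV m l i)
      push_cast at this
      rw [← this, map_mul, conj_pInvV, ← hp, ← hp, ← hp, gaps]
      push_cast
      ring
    simp_rw [e1]
    rw [Finset.sum_sub_distrib, Finset.sum_add_distrib, Finset.sum_add_distrib, ← Finset.mul_sum,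
      ← Finset.mul_sum, ← Finset.mul_sum, b0, b1, b2, uGap_eq]
    ring
  simp_rw [e]
  exact IsLittleO.fun_sum fun i _ => (h i).const_mul_left _

variable {Ω : Type*} [MeasurableSpace Ω] {P : Measure Ω}

lemma HasDiscreteExpansion.isDiscreteLimit (hm : 0 < m) {l : ℂ} (hl : (chi m).IsRoot l)
    (hr : 0 < l.re) (hi : 0 < l.im) {L : ℕ → Ω → Fin m → ℤ} {W : Ω → ℂ}
    (h : HasDiscreteExpansion P m l L W) : IsDiscreteLimit P m l L W := by
  filter_upwards [h] with ω hω
  have h1 := uGap_sub_isLittleO hm hl hr hi (x := fun n => L n ω) (r := fun n : ℕ => (n : ℂ))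
    (z := fun n : ℕ => (n : ℂ) ^ l * W ω) (s := fun _ => 1) (F := atTop)
    (g := fun n : ℕ => (n : ℝ) ^ l.re) (by simpa using hω)
  have h2 := (isBigO_refl (fun n : ℕ => (n : ℂ) ^ (-l)) atTop).norm_right.mul_isLittleO h1
  have h3 : (fun n : ℕ => (n : ℂ) ^ (-l) * uGap m l (L n ω) - W ω) =o[atTop] fun _ => (1 : ℝ) := by
    refine h2.congr' ?_ ?_
    · filter_upwards [eventually_gt_atTop 0] with n hn
      have hn0 : (n : ℂ) ≠ 0 := by exact_mod_cast hn.ne'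
      have : (n : ℂ) ^ (-l) * (n : ℂ) ^ l = 1 := by rw [← Complex.cpow_add _ _ hn0]; simp
      rw [mul_sub, Complex.ofReal_one, mul_one, ← mul_assoc, this, one_mul]
    · filter_upwards [eventually_gt_atTop 0] with n hn
      have hn' : (0 : ℝ) < n := by exact_mod_cast hn
      rw [Complex.norm_natCast_cpow_of_pos hn, ← Real.rpow_add hn']
      simp
  exact tendsto_sub_nhds_zero_iff.1 ((isLittleO_one_iff ℝ).1 h3)

lemma HasContinuousExpansion.isContinuousLimit (hm : 0 < m) {l : ℂ} (hl : (chi m).IsRoot l)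
    (hr : 0 < l.re) (hi : 0 < l.im) {X : ℝ≥0 → Ω → Fin m → ℤ} {W : Ω → ℂ}
    (h : HasContinuousExpansion P m l X W) : IsContinuousLimit P m l X W := by
  filter_upwards [h] with ω ⟨ξ, a, b, ha, hb, hω⟩
  have h1 := uGap_sub_isLittleO hm hl hr hi (x := fun t => X t ω)
    (r := fun t : ℝ≥0 => ((Real.exp t * ξ * (1 + a t) : ℝ) : ℂ))
    (z := fun t : ℝ≥0 => Complex.exp (l * (t : ℝ)) * W ω) (s := fun t => 1 + b t) (F := atTop)
    (g := fun t : ℝ≥0 => Real.exp (l.re * t)) hω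
  have h2 := (isBigO_refl (fun t : ℝ≥0 => Complex.exp (-(l * (t : ℝ)))) atTop).norm_right.mul_isLittleO h1
  have h3 : (fun t : ℝ≥0 => Complex.exp (-(l * (t : ℝ))) * uGap m l (X t ω) - W ω * (1 + b t : ℝ))
      =o[atTop] fun _ => (1 : ℝ) := by
    refine h2.congr (fun t => ?_) fun t => ?_
    · have : Complex.exp (-(l * (t : ℝ))) * Complex.exp (l * (t : ℝ)) = 1 := by
        rw [← Complex.exp_add]; simp
      rw [mul_sub, ← mul_assoc, ← mul_assoc, this, one_mul]
    · rw [Complex.norm_exp, ← Real.exp_add]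
      simp
  have h4 := (isLittleO_one_iff ℝ).1 h3
  have h5 : Tendsto (fun t : ℝ≥0 => W ω * (1 + b t : ℝ)) atTop (𝓝 (W ω)) := by
    have : Tendsto (fun t : ℝ≥0 => W ω * (1 + b t : ℝ)) atTop (𝓝 (W ω * ((1 + 0 : ℝ) : ℂ))) :=
      ((Complex.continuous_ofReal.tendsto _).comp (hb.const_add 1)).const_mul _
    simpa using this
  simpa using h4.add h5

lemma IsDiscreteLimit.ae_eq {l : ℂ} {L : ℕ → Ω → Fin m → ℤ} {W W' : Ω → ℂ}
    (h : IsDiscreteLimit P m l L W) (h' : IsDiscreteLimit P m l L W') : W =ᵐ[P] W' := by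
  filter_upwards [h, h'] with ω h1 h2 using tendsto_nhds_unique h1 h2

lemma IsContinuousLimit.ae_eq {l : ℂ} {X : ℝ≥0 → Ω → Fin m → ℤ} {W W' : Ω → ℂ}
    (h : IsContinuousLimit P m l X W) (h' : IsContinuousLimit P m l X W') : W =ᵐ[P] W' := by
  filter_upwards [h, h'] with ω h1 h2 using tendsto_nhds_unique h1 h2

end Biorthogonal

/-! ### The branching property of the fringe chain -/

section Branching

variable {m : ℕ}

/-- The unnormalised transition operator of the fringe chain. -/
def rateOp (m : ℕ) (f : (Fin m → ℤ) → ℂ) (x : Fin m → ℤ) : ℂ :=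
  ∑ i, (gaps x i : ℂ) * f (x + incr m i)

/-- A Leibniz rule expressing branching: rates are additive in the state, so a jump occurs either in
`x` or in `y`, and multiplicative functions factor over the two parts. -/
lemma iterate_rateOp_add {f : (Fin m → ℤ) → ℂ} (hf : ∀ x y, f (x + y) = f x * f y) (n : ℕ)
    (x y : Fin m → ℤ) :
    (rateOp m)^[n] f (x + y) = ∑ k ∈ Finset.HasAntidiagonal.antidiagonal n,
      (n.choose k.1 : ℂ) * ((rateOp m)^[k.1] f x * (rateOp m)^[k.2] f y) := by
  induction n generalizing x y with
  | zero => simp [hf]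
  | succ n ih =>
    rw [Finset.sum_antidiagonal_choose_succ_mul
      (fun a b => (rateOp m)^[a] f x * (rateOp m)^[b] f y), Function.iterate_succ_apply', rateOp]
    have e : ∀ i, ((gaps (x + y) i : ℝ) : ℂ) * (rateOp m)^[n] f (x + y + incr m i)
        = ∑ k ∈ Finset.HasAntidiagonal.antidiagonal n, (n.choose k.1 : ℂ) * ((rateOp m)^[k.1] f x *
            ((gaps y i : ℂ) * (rateOp m)^[k.2] f (y + incr m i)))
          + ∑ k ∈ Finset.HasAntidiagonal.antidiagonal n, (n.choose k.2 : ℂ) *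
            (((gaps x i : ℂ) * (rateOp m)^[k.1] f (x + incr m i)) * (rateOp m)^[k.2] f y) :=
      fun i => by
        have e1 := ih x (y + incr m i)
        have e2 := ih (x + incr m i) y
        rw [← add_assoc] at e1
        rw [add_right_comm] at e2
        rw [gaps_add, Complex.ofReal_add, add_mul, add_comm]
        congr 1
        · rw [e1, Finset.mul_sum]
          exact Finset.sum_congr rfl fun k _ => by ring
        · rw [e2, Finset.mul_sum]
          refine Finset.sum_congr rfl fun k hk => ?_
          rw [Nat.choose_symm_of_eq_add (Finset.HasAntidiagonal.mem_antidiagonal.1 hk).symm]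
          ring
    simp_rw [e]
    rw [Finset.sum_add_distrib, Finset.sum_comm, Finset.sum_comm (s := Finset.univ)]
    simp_rw [← Finset.mul_sum, ← Finset.sum_mul]
    simp only [Function.iterate_succ_apply']
    rfl

/-- Each move adds exactly one gap, so the normalising constants are deterministic and multiply to a
rising factorial. -/
lemma iterate_rateOp (f : (Fin m → ℤ) → ℂ) (n : ℕ) {x : Fin m → ℤ} (hx : 0 < totalGaps x) :
    (rateOp m)^[n] f x = (∏ j ∈ Finset.range n, ((totalGaps x : ℂ) + j)) * (kern m)^[n] f x := by
  induction n generalizing x with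
  | zero => simp
  | succ n ih =>
    have hx' : (totalGaps x : ℂ) ≠ 0 := by exact_mod_cast hx.ne'
    have h1 : ∀ i, totalGaps (x + incr m i) = totalGaps x + 1 := fun i => by
      rw [totalGaps_add, totalGaps_incr]
    rw [Function.iterate_succ_apply', Function.iterate_succ_apply', rateOp, kern, Finset.mul_sum,
      Finset.prod_range_succ']
    refine Finset.sum_congr rfl fun i _ => ?_
    rw [ih (by rw [h1]; linarith), h1]
    push_cast
    have e : ∀ j : ℕ, (totalGaps x : ℂ) + 1 + j = totalGaps x + (j + 1) := fun j => by ring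
    simp_rw [e]
    field_simp
    ring

lemma kern_single (f : (Fin m → ℤ) → ℂ) (i : Fin m) :
    kern m f (Pi.single i 1) = f (Pi.single i 1 + incr m i) := by
  have h : (0 : ℝ) < (m : ℝ) + (i : ℕ) := by
    have : (0 : ℝ) < m := by exact_mod_cast i.pos
    positivity
  rw [kern, Finset.sum_eq_single i]
  · simp [gaps_single, totalGaps_single]
    rw [div_self (by exact_mod_cast h.ne'), one_mul]
  · intro j _ hj
    simp [gaps_single, hj]
  · simp

/-- A single node has no choice: it runs through the types `1, …, m` and then splits into two nodes
of type `1`. -/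
lemma iterate_kern_self (hm : 0 < m) (f : (Fin m → ℤ) → ℂ) :
    (kern m)^[m] f (e1 m) = f (e1 m + e1 m) := by
  have h : ∀ (i : ℕ) (hi : i < m) (f : (Fin m → ℤ) → ℂ),
      (kern m)^[i] f (e1 m) = f (Pi.single ⟨i, hi⟩ 1) := by
    intro i
    induction i with
    | zero => intro hi f; rw [e1_eq hm]; rfl
    | succ i ih =>
      intro hi f
      rw [Function.iterate_succ_apply, ih (by omega), kern_single]
      congr 1
      funext j
      simp only [Pi.add_apply, Pi.single_apply, incr, Fin.ext_iff]
      split_ifs <;> omega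
  obtain ⟨k, rfl⟩ : ∃ k, m = k + 1 := ⟨m - 1, by omega⟩
  rw [Function.iterate_succ_apply, h k (by omega), kern_single]
  congr 1
  funext j
  simp only [Pi.add_apply, Pi.single_apply, incr, Fin.ext_iff, e1, true_and]
  have := j.2
  split_ifs <;> omega

lemma betaMoment_natCast (hm : 0 < m) (a b : ℕ) :
    betaMoment m a b * ∏ j ∈ Finset.range (a + b), ((2 * m : ℂ) + j)
      = (∏ j ∈ Finset.range a, ((m : ℂ) + j)) * ∏ j ∈ Finset.range b, ((m : ℂ) + j) := by
  have h1 : 0 < (m : ℂ).re := by simpa using hm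
  have h2 : 0 < (2 * m : ℂ).re := by simpa using hm
  have e := Gamma_add_nat (2 * m) h2 (a + b)
  rw [betaMoment, Gamma_add_nat _ h1, Gamma_add_nat _ h1, add_assoc, ← Nat.cast_add, e]
  have g1 := Complex.Gamma_ne_zero_of_re_pos h1
  have g2 := Complex.Gamma_ne_zero_of_re_pos h2
  have g3 : ∏ j ∈ Finset.range (a + b), ((2 * m : ℂ) + j) ≠ 0 :=
    Finset.prod_ne_zero_iff.2 fun j _ => add_natCast_ne_zero h2 j
  generalize (2 * m : ℂ) = c at *
  field_simp

/-- After the split, the steps are shared between the two subtrees as in a Pólya urn with initial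
composition `(m, m)`: the rising factorials of the Leibniz rule combine into Beta moments. -/
lemma iterate_kern_add (hm : 0 < m) {f : (Fin m → ℤ) → ℂ} (hf : ∀ x y, f (x + y) = f x * f y)
    (n : ℕ) :
    (kern m)^[n + m] f (e1 m) = ∑ k ∈ Finset.HasAntidiagonal.antidiagonal n, betaMoment m k.1 k.2 *
      ((n.choose k.1 : ℂ) * ((kern m)^[k.1] f (e1 m) * (kern m)^[k.2] f (e1 m))) := by
  have hm' : (0 : ℝ) < m := by exact_mod_cast hm
  have t1 := totalGaps_e1 hm
  have t2 : totalGaps (e1 m + e1 m) = 2 * m := by rw [totalGaps_add, t1]; ring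
  have h2 : 0 < (2 * m : ℂ).re := by simpa using hm
  have g3 : ∏ j ∈ Finset.range n, ((2 * m : ℂ) + j) ≠ 0 :=
    Finset.prod_ne_zero_iff.2 fun j _ => add_natCast_ne_zero h2 j
  rw [add_comm, Function.iterate_add_apply, iterate_kern_self hm]
  refine mul_left_cancel₀ g3 ?_
  have e := iterate_rateOp f n (x := e1 m + e1 m) (by rw [t2]; positivity)
  rw [t2] at e
  push_cast at e
  rw [← e, iterate_rateOp_add hf, Finset.mul_sum]
  refine Finset.sum_congr rfl fun k hk => ?_
  have hk' := Finset.HasAntidiagonal.mem_antidiagonal.1 hk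
  have b := betaMoment_natCast hm k.1 k.2
  rw [hk'] at b
  rw [iterate_rateOp f _ (by rw [t1]; exact hm'), iterate_rateOp f _ (by rw [t1]; exact hm'), t1]
  push_cast
  linear_combination -(n.choose k.1 : ℂ) * ((kern m)^[k.1] f (e1 m) * (kern m)^[k.2] f (e1 m)) * b

lemma iterate_kern_add_eq_integral (hm : 0 < m) {f : (Fin m → ℤ) → ℂ}
    (hf : ∀ x y, f (x + y) = f x * f y) (n : ℕ) :
    (kern m)^[n + m] f (e1 m) = ∫ b : ℝ, ∑ k ∈ Finset.range (n + 1),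
      ((n.choose k * b ^ k * (1 - b) ^ (n - k) : ℝ) : ℂ)
        * ((kern m)^[k] f (e1 m) * (kern m)^[n - k] f (e1 m)) ∂betaMeasure (m : ℝ) (m : ℝ) := by
  have := isProbabilityMeasure_beta hm
  have hm' : (0 : ℝ) < m := by exact_mod_cast hm
  rw [iterate_kern_add hm hf, Finset.Nat.sum_antidiagonal_eq_sum_range_succ
    (fun i j => betaMoment m i j * ((n.choose i : ℂ) *
      ((kern m)^[i] f (e1 m) * (kern m)^[j] f (e1 m)))), integral_finsetSum]
  · refine Finset.sum_congr rfl fun k _ => ?_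
    rw [← integral_beta_eq hm _ _ (by simp; linarith) (by simp; linarith), ← integral_mul_const]
    refine integral_congr_ae (Eventually.of_forall fun b => ?_)
    simp only [Complex.cpow_natCast]
    push_cast
    ring
  · intro k _
    refine Integrable.mul_const (Integrable.of_bound (by fun_prop) (n.choose k : ℝ) ?_) _
    filter_upwards [ae_mem_Ioo_beta m] with b hb
    rw [Complex.norm_real, Real.norm_of_nonneg, mul_assoc]
    · refine mul_le_of_le_one_right (by positivity) (mul_le_one₀ (pow_le_one₀ hb.1.le hb.2.le)
        (pow_nonneg (by linarith) _) (pow_le_one₀ (by linarith) (by linarith)))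
    · have := hb.1.le
      have : 0 ≤ 1 - b := by linarith [hb.2]
      positivity

end Branching

/-! ### The smoothing equation of the discrete limit -/

/-- Uniformity in `k ≤ n`: past a threshold monotonicity of `g` suffices, and the finitely many
earlier values are absorbed by `g n → ∞`. -/
lemma eventually_forall_le_of_isLittleO {ρ g : ℕ → ℝ} (hg : Monotone g) (hg' : Tendsto g atTop atTop)
    (h : ρ =o[atTop] g) (hg0 : ∀ n, 0 ≤ g n) {ε : ℝ} (hε : 0 < ε) :
    ∀ᶠ n in atTop, ∀ k ≤ n, ρ k ≤ ε * g n := by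
  obtain ⟨K, hK⟩ := eventually_atTop.1 (h.def hε)
  filter_upwards [hg'.eventually_ge_atTop ((∑ k ∈ Finset.range K, |ρ k|) / ε)] with n hn k hk
  rcases lt_or_ge k K with hkK | hkK
  · calc ρ k ≤ |ρ k| := le_abs_self _
      _ ≤ ∑ k ∈ Finset.range K, |ρ k| :=
        Finset.single_le_sum (f := fun k => |ρ k|) (fun _ _ => abs_nonneg _) (Finset.mem_range.2 hkK)
      _ ≤ ε * g n := (div_le_iff₀' hε).1 hn
  · have h1 := hK k hkK
    rw [Real.norm_of_nonneg (hg0 k)] at h1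
    exact (le_abs_self _).trans (h1.trans (by gcongr; exact hg hk))

/-- Bernstein polynomials of `F` converge, and replacing `F (k / n)` by `t n k` costs at most the
uniform error because the weights sum to `1`. -/
lemma tendsto_bernstein_sum {t : ℕ → ℕ → ℂ} {F : ℝ → ℂ} (hF : Continuous F)
    (h : ∀ ε > 0, ∀ᶠ n in atTop, ∀ k ≤ n, ‖t n k - F (k / n)‖ ≤ ε) {b : ℝ} (hb0 : 0 ≤ b)
    (hb1 : b ≤ 1) :
    Tendsto (fun n : ℕ => ∑ k ∈ Finset.range (n + 1),
      ((n.choose k * b ^ k * (1 - b) ^ (n - k) : ℝ) : ℂ) * t n k) atTop (𝓝 (F b)) := by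
  set x : unitInterval := ⟨b, hb0, hb1⟩ with hx
  set G : C(unitInterval, ℂ) := ⟨fun y => F y, hF.comp continuous_subtype_val⟩ with hG
  have h1 : Tendsto (fun n => bernsteinApproximation n G x) atTop (𝓝 (F b)) :=
    ((continuous_eval_const x).tendsto G).comp (bernsteinApproximation_uniform G)
  have h2 : ∀ n, ∑ k ∈ Finset.range (n + 1),
      ((n.choose k * b ^ k * (1 - b) ^ (n - k) : ℝ) : ℂ) * t n k
      = ∑ k : Fin (n + 1), bernstein n k x • t n k := fun n => by
    rw [Finset.sum_range]
    exact Finset.sum_congr rfl fun k _ => by rw [bernstein_apply, Complex.real_smul]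
  simp_rw [h2]
  refine h1.congr_dist ?_
  rw [Metric.tendsto_nhds]
  intro ε hε
  filter_upwards [h (ε / 2) (half_pos hε)] with n hn
  rw [Real.dist_0_eq_abs, abs_of_nonneg dist_nonneg, dist_comm, dist_eq_norm,
    bernsteinApproximation.apply, ← Finset.sum_sub_distrib]
  calc _ ≤ ∑ k : Fin (n + 1), bernstein n k x * (ε / 2) := by
        refine norm_sum_le_of_le _ fun k _ => ?_
        rw [← smul_sub, norm_smul, Real.norm_of_nonneg bernstein_nonneg]
        refine mul_le_mul_of_nonneg_left ?_ bernstein_nonneg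
        exact hn k (by omega)
    _ < ε := by
        rw [← Finset.sum_mul, bernstein.probability]
        linarith

lemma norm_exp_sub_exp_le (a b : ℝ) :
    ‖Complex.exp (a * Complex.I) - Complex.exp (b * Complex.I)‖ ≤ |a - b| := by
  have h : Complex.exp (a * Complex.I) - Complex.exp (b * Complex.I)
      = Complex.exp (b * Complex.I) * (Complex.exp (Complex.I * (a - b : ℝ)) - 1) := by
    rw [mul_sub, ← Complex.exp_add, mul_one]
    push_cast
    ring_nf
  rw [h, norm_mul, Complex.norm_exp_ofReal_mul_I, one_mul]
  exact Real.norm_exp_I_mul_ofReal_sub_one_le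

lemma natCast_div_cpow (k : ℕ) {n : ℕ} (hn : 0 < n) (l : ℂ) :
    (((k / n : ℝ) : ℂ)) ^ l = (n : ℂ) ^ (-l) * (k : ℂ) ^ l := by
  have h0 : ((n : ℝ) : ℂ) ≠ 0 := by exact_mod_cast hn.ne'
  have e := Complex.mul_cpow_ofReal_nonneg (a := (k / n : ℝ)) (b := (n : ℝ)) (by positivity)
    (by positivity) l
  rw [← Complex.ofReal_mul, div_mul_cancel₀ _ (by exact_mod_cast hn.ne')] at e
  rw [Complex.ofReal_natCast, Complex.ofReal_natCast] at e
  rw [e, Complex.cpow_neg]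
  have : (n : ℂ) ^ l ≠ 0 := by
    rw [Ne, Complex.cpow_eq_zero_iff]
    exact fun h => h0 (by simpa using h.1)
  field_simp

lemma charFun_map_mul {Ω : Type*} [MeasurableSpace Ω] {P : Measure Ω} {W : Ω → ℂ} (hW : Measurable W)
    (a z : ℂ) : charFun (P.map W) (conj a * z)
      = ∫ ω, Complex.exp ((inner ℝ (a * W ω) z : ℝ) * Complex.I) ∂P := by
  rw [charFun_apply, integral_map hW.aemeasurable (by fun_prop)]
  simp_rw [inner_mul_left_eq]

section Chain

variable {m : ℕ} {Ω : Type*} [MeasurableSpace Ω] {P : Measure Ω} [IsProbabilityMeasure P]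
  {L : ℕ → Ω → Fin m → ℤ} {l : ℂ} {W : Ω → ℂ}

omit [IsProbabilityMeasure P] in
lemma tendsto_cpow_mul_uGap_shift (hlim : IsDiscreteLimit P m l L W) (c : ℕ) :
    ∀ᵐ ω ∂P, Tendsto (fun n : ℕ => (n : ℂ) ^ (-l) * uGap m l (L (n + c) ω)) atTop (𝓝 (W ω)) := by
  have h0 : Tendsto (fun n : ℕ => (((n + c : ℕ) / n : ℝ) : ℂ) ^ l) atTop (𝓝 1) := by
    have h1 : Tendsto (fun n : ℕ => ((n + c : ℕ) / n : ℝ)) atTop (𝓝 1) := by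
      have := tendsto_add_mul_div_add_mul_atTop_nhds (𝕜 := ℝ) c 0 1 (one_ne_zero)
      simp only [one_mul, zero_add, div_one] at this
      refine this.congr fun n => ?_
      push_cast
      ring
    have h2 : ContinuousAt (fun x : ℂ => x ^ l) ((1 : ℝ) : ℂ) := by
      refine continuousAt_cpow_const ?_
      simp
    have h3 := h2.tendsto.comp ((Complex.continuous_ofReal.tendsto _).comp h1)
    simpa [Function.comp_def] using h3
  filter_upwards [hlim] with ω hω
  have h1 := h0.mul ((tendsto_add_atTop_iff_nat c).2 hω)
  rw [one_mul] at h1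
  refine h1.congr' ?_
  filter_upwards [eventually_gt_atTop 0] with n hn
  have h2 : ((n + c : ℕ) : ℂ) ≠ 0 := by exact_mod_cast (by omega)
  have h3 : ((n + c : ℕ) : ℂ) ^ l * ((n + c : ℕ) : ℂ) ^ (-l) = 1 := by
    rw [← Complex.cpow_add _ _ h2]; simp
  rw [natCast_div_cpow _ hn]
  linear_combination (n : ℂ) ^ (-l) * uGap m l (L (n + c) ω) * h3

/-- The characters `c n` of the rescaled `u(l)` are multiplicative, so the branching identity
applies to them. Its left side tends to the characteristic function of `W` at `z`; on the right, the
`k`-th iterate is uniformly close to `F (k / n)`, and the binomial sum converges to `F b * F (1 -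
b)`. -/
theorem IsFringeChain.charFun_limit (hm : 0 < m) (h : IsFringeChain P m (e1 m) L)
    (hr : 0 < l.re) (hW : Measurable W) (hlim : IsDiscreteLimit P m l L W)
    (hL2 : MemLp W 2 P)
    (hL1 : Tendsto (fun n : ℕ => ∫ ω, ‖(n : ℂ) ^ (-l) * uGap m l (L n ω) - W ω‖ ∂P) atTop (𝓝 0))
    (z : ℂ) :
    charFun (P.map W) z = ∫ b : ℝ, charFun (P.map W) (conj ((b : ℂ) ^ l) * z)
      * charFun (P.map W) (conj (((1 - b : ℝ) : ℂ) ^ l) * z) ∂betaMeasure (m : ℝ) (m : ℝ) := by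
  have := isProbabilityMeasure_beta hm
  have hPW : IsProbabilityMeasure (P.map W) := Measure.isProbabilityMeasure_map hW.aemeasurable
  set F : ℝ → ℂ := fun b => charFun (P.map W) (conj ((b : ℂ) ^ l) * z) with hF
  have hFc : Continuous F := by
    have := Complex.continuous_ofReal_cpow_const hr
    exact continuous_charFun.comp ((Complex.continuous_conj.comp this).mul continuous_const)
  have hF1 : ∀ b, ‖F b‖ ≤ 1 := fun b => norm_charFun_le_one _
  set c : ℕ → (Fin m → ℤ) → ℂ := fun n x =>
    Complex.exp ((inner ℝ ((n : ℂ) ^ (-l) * uGap m l x) z : ℝ) * Complex.I) with hc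
  have hcadd : ∀ n x y, c n (x + y) = c n x * c n y := fun n x y => by
    simp only [hc]
    rw [← Complex.exp_add, uGap_add, mul_add, inner_add_left]
    push_cast
    ring_nf
  have hc1 : ∀ n x, ‖c n x‖ = 1 := fun n x => Complex.norm_exp_ofReal_mul_I _
  have hT : ∀ n k, (kern m)^[k] (c n) (e1 m) = ∫ ω, c n (L k ω) ∂P := fun n k =>
    (h.integral_eq_iterate hm k (c n)).symm
  have hT1 : ∀ n k, ‖(kern m)^[k] (c n) (e1 m)‖ ≤ 1 := fun n k => by
    rw [hT]
    refine (norm_integral_le_integral_norm _).trans ?_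
    simp [hc1]
  -- L¹ convergence makes this `o(k ^ Re l)`; divided by `n ^ Re l` it controls all `k ≤ n` at once,
  -- including small `k` where the limit theorem says nothing.
  set ρ : ℕ → ℝ := fun k => ∫ ω, ‖uGap m l (L k ω) - (k : ℂ) ^ l * W ω‖ ∂P with hρ
  have hρo : ρ =o[atTop] fun k : ℕ => (k : ℝ) ^ l.re := by
    have h1 := (isBigO_refl (fun k : ℕ => (k : ℝ) ^ l.re) atTop).mul_isLittleO
      ((isLittleO_one_iff ℝ).2 hL1)
    refine h1.congr' ?_ (Eventually.of_forall fun k => mul_one _)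
    filter_upwards [eventually_gt_atTop 0] with k hk
    have hk0 : (k : ℂ) ≠ 0 := by exact_mod_cast hk.ne'
    have e : (k : ℂ) ^ l * (k : ℂ) ^ (-l) = 1 := by rw [← Complex.cpow_add _ _ hk0]; simp
    rw [← Complex.norm_natCast_cpow_of_pos hk, ← integral_const_mul]
    refine integral_congr_ae (Eventually.of_forall fun ω => ?_)
    simp only
    rw [← norm_mul, mul_sub, ← mul_assoc, e, one_mul]
  have hbound : ∀ n : ℕ, 0 < n → ∀ k : ℕ,
      ‖(kern m)^[k] (c n) (e1 m) - F (k / n)‖ ≤ ‖z‖ * (ρ k / (n : ℝ) ^ l.re) := fun n hn k => by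
    have hmeas : Measurable fun ω => c n (L k ω) :=
      (measurable_of_countable (c n)).comp (h.measurable k)
    have i1 : Integrable (fun ω => c n (L k ω)) P :=
      Integrable.of_bound hmeas.aestronglyMeasurable 1 (Eventually.of_forall fun ω => (hc1 n _).le)
    have i2 : Integrable (fun ω => Complex.exp
        ((inner ℝ ((((k / n : ℝ) : ℂ)) ^ l * W ω) z : ℝ) * Complex.I)) P :=
      Integrable.of_bound (by fun_prop) 1
        (Eventually.of_forall fun ω => (Complex.norm_exp_ofReal_mul_I _).le)
    have i3 : Integrable (fun ω => ‖uGap m l (L k ω) - (k : ℂ) ^ l * W ω‖) P :=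
      (((h.memLp hm k (uGap m l)).sub (hL2.const_mul ((k : ℂ) ^ l))).integrable (by norm_num)).norm
    rw [hT]
    simp only [hF]
    rw [charFun_map_mul hW, ← integral_sub i1 i2]
    calc _ ≤ ∫ ω, ‖z‖ * (‖uGap m l (L k ω) - (k : ℂ) ^ l * W ω‖ / (n : ℝ) ^ l.re) ∂P := by
          refine norm_integral_le_of_norm_le ((i3.div_const _).const_mul _)
            (Eventually.of_forall fun ω => ?_)
          refine (norm_exp_sub_exp_le _ _).trans ?_
          rw [← inner_sub_left]
          refine (abs_real_inner_le_norm _ _).trans ?_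
          rw [natCast_div_cpow k hn, mul_assoc, ← mul_sub, norm_mul,
            Complex.norm_natCast_cpow_of_pos hn, Complex.neg_re, Real.rpow_neg (by positivity)]
          apply le_of_eq
          ring
      _ = _ := by rw [integral_const_mul, integral_div]
  have happrox : ∀ ε > 0, ∀ᶠ n : ℕ in atTop, ∀ k ≤ n,
      ‖(kern m)^[k] (c n) (e1 m) - F (k / n)‖ ≤ ε := fun ε hε => by
    have h1 := eventually_forall_le_of_isLittleO (ρ := ρ) (g := fun k : ℕ => (k : ℝ) ^ l.re)
      (fun a b hab => Real.rpow_le_rpow (by positivity) (by exact_mod_cast hab) hr.le)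
      ((tendsto_rpow_atTop hr).comp tendsto_natCast_atTop_atTop) hρo (fun n => by positivity)
      (ε := ε / (‖z‖ + 1)) (by positivity)
    filter_upwards [h1, eventually_gt_atTop 0] with n hn hn0 k hk
    have hpos : (0 : ℝ) < (n : ℝ) ^ l.re := Real.rpow_pos_of_pos (by exact_mod_cast hn0) _
    refine (hbound n hn0 k).trans ?_
    have h2 : ρ k / (n : ℝ) ^ l.re ≤ ε / (‖z‖ + 1) := (div_le_iff₀ hpos).2 (hn k hk)
    calc _ ≤ ‖z‖ * (ε / (‖z‖ + 1)) := by gcongr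
      _ ≤ ε := by
        rw [mul_div_assoc', div_le_iff₀ (by positivity)]
        nlinarith [norm_nonneg z]
  have hleft : Tendsto (fun n : ℕ => (kern m)^[n + m] (c n) (e1 m)) atTop (𝓝 (charFun (P.map W) z)) := by
    have e := charFun_map_mul (P := P) hW 1 z
    simp only [map_one, one_mul] at e
    rw [e]
    simp_rw [hT]
    refine tendsto_integral_of_dominated_convergence (fun _ => 1) (fun n => ?_) (integrable_const _)
      (fun n => Eventually.of_forall fun ω => (hc1 n _).le) ?_
    · exact ((measurable_of_countable (c n)).comp (h.measurable (n + m))).aestronglyMeasurable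
    · filter_upwards [tendsto_cpow_mul_uGap_shift hlim m] with ω hω
      have hcont : Continuous fun w : ℂ => Complex.exp ((inner ℝ w z : ℝ) * Complex.I) := by fun_prop
      exact (hcont.tendsto _).comp hω
  have hright : Tendsto (fun n : ℕ => (kern m)^[n + m] (c n) (e1 m)) atTop
      (𝓝 (∫ b : ℝ, F b * F (1 - b) ∂betaMeasure (m : ℝ) (m : ℝ))) := by
    simp_rw [fun n => iterate_kern_add_eq_integral hm (hcadd n) n]
    refine tendsto_integral_of_dominated_convergence (fun _ => 1) (fun n => ?_) (integrable_const _)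
      (fun n => ?_) ?_
    · fun_prop
    · filter_upwards [ae_mem_Ioo_beta m] with b hb
      have hb0 := hb.1.le
      have hb1 : 0 ≤ 1 - b := by linarith [hb.2]
      have e := (add_pow b (1 - b) n).symm
      rw [add_sub_cancel, one_pow] at e
      refine le_trans (norm_sum_le_of_le _ fun k _ => ?_) e.le
      rw [norm_mul, Complex.norm_real, norm_mul ((kern m)^[k] (c n) (e1 m)), Real.norm_of_nonneg (by positivity)]
      calc _ ≤ (n.choose k * b ^ k * (1 - b) ^ (n - k)) * (1 * 1) := by
            gcongr
            · exact hT1 n k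
            · exact hT1 n _
        _ = _ := by ring
    · filter_upwards [ae_mem_Ioo_beta m] with b hb
      refine tendsto_bernstein_sum (t := fun n k => (kern m)^[k] (c n) (e1 m)
        * (kern m)^[n - k] (c n) (e1 m)) (F := fun b => F b * F (1 - b))
        (hFc.mul (hFc.comp (continuous_const.sub continuous_id))) (fun ε hε => ?_) hb.1.le hb.2.le
      filter_upwards [happrox (ε / 2) (half_pos hε), eventually_gt_atTop 0] with n hn hn0 k hk
      have hn0' : (n : ℝ) ≠ 0 := by exact_mod_cast hn0.ne'
      have e : (1 : ℝ) - k / n = (n - k : ℕ) / n := by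
        rw [Nat.cast_sub hk]
        field_simp
      rw [e]
      refine (norm_mul_sub_mul_le (hT1 n k) (hF1 _)).trans ?_
      linarith [hn k hk, hn (n - k) (Nat.sub_le _ _)]
  exact tendsto_nhds_unique hleft hright

theorem IsFringeChain.smoothDirichlet_limit (hm : 0 < m) (h : IsFringeChain P m (e1 m) L)
    (hr : 0 < l.re) (hW : Measurable W) (hlim : IsDiscreteLimit P m l L W)
    (hL2 : MemLp W 2 P)
    (hL1 : Tendsto (fun n : ℕ => ∫ ω, ‖(n : ℂ) ^ (-l) * uGap m l (L n ω) - W ω‖ ∂P) atTop (𝓝 0)) :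
    smoothDirichlet m l (P.map W) = P.map W := by
  have := isProbabilityMeasure_beta hm
  have hPW : IsProbabilityMeasure (P.map W) := Measure.isProbabilityMeasure_map hW.aemeasurable
  have hmw := measurable_dirichletWeights l
  have : IsProbabilityMeasure (dirichletKernel m l) :=
    Measure.isProbabilityMeasure_map hmw.aemeasurable
  rw [smoothDirichlet_eq]
  refine Measure.ext_of_charFun (funext fun z => ?_)
  rw [charFun_smooth, h.charFun_limit hm hr hW hlim hL2 hL1 z, dirichletKernel,
    integral_map hmw.aemeasurable]
  have : Continuous (charFun (P.map W)) := continuous_charFun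
  fun_prop

lemma map_mem_M2 (hW : Measurable W) (hL2 : MemLp W 2 P) : P.map W ∈ M2 (∫ ω, W ω ∂P) := by
  refine ⟨Measure.isProbabilityMeasure_map hW.aemeasurable, ?_, ?_⟩
  · exact (memLp_map_measure_iff (g := fun z : ℂ => z) (by fun_prop) hW.aemeasurable).2 hL2
  · exact integral_map hW.aemeasurable (by fun_prop)

end Chain

/-! ### Exponential waiting times -/

lemma expMeasure_Iic {r : ℝ} (hr : 0 < r) {a : ℝ} (ha : 0 ≤ a) :
    expMeasure r (Set.Iic a) = ENNReal.ofReal (1 - Real.exp (-(r * a))) := by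
  have := lintegral_exponentialPDF_eq_antiDeriv hr a
  rw [if_pos ha] at this
  rw [← this, expMeasure, gammaMeasure, withDensity_apply _ measurableSet_Iic]
  rfl

lemma expMeasure_Ioi {r : ℝ} (hr : 0 < r) {a : ℝ} (ha : 0 ≤ a) :
    expMeasure r (Set.Ioi a) = ENNReal.ofReal (Real.exp (-(r * a))) := by
  have := isProbabilityMeasure_expMeasure hr
  have h1 : Real.exp (-(r * a)) ≤ 1 := Real.exp_le_one_iff.2 (by nlinarith)
  rw [← Set.compl_Iic, prob_compl_eq_one_sub measurableSet_Iic, expMeasure_Iic hr ha,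
    ← ENNReal.ofReal_one, ← ENNReal.ofReal_sub _ (by linarith)]
  congr 1
  ring

lemma measure_ext_of_Ioi {μ ν : Measure ℝ} [IsFiniteMeasure μ] [IsFiniteMeasure ν]
    (h : ∀ a, 0 ≤ a → μ (Set.Ioi a) = ν (Set.Ioi a)) (hμ : μ (Set.Iic 0) = 0)
    (hν : ν (Set.Iic 0) = 0) : μ = ν := by
  have huniv : ∀ ρ : Measure ℝ, ρ (Set.Iic 0) = 0 → ρ Set.univ = ρ (Set.Ioi 0) := fun ρ hρ => by
    rw [← Set.Iic_union_Ioi (a := (0 : ℝ))]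
    refine le_antisymm ((measure_union_le _ _).trans ?_) (measure_mono Set.subset_union_right)
    rw [hρ, zero_add]
  refine Measure.ext_of_Iic _ _ fun a => ?_
  rcases le_or_gt 0 a with ha | ha
  · rw [← Set.compl_Ioi, measure_compl measurableSet_Ioi (measure_ne_top _ _),
      measure_compl measurableSet_Ioi (measure_ne_top _ _), huniv μ hμ, huniv ν hν, h a ha, h 0 le_rfl]
  · rw [measure_mono_null (Set.Iic_subset_Iic.2 ha.le) hμ,
      measure_mono_null (Set.Iic_subset_Iic.2 ha.le) hν]

lemma expMeasure_Iic_zero {r : ℝ} (hr : 0 < r) : expMeasure r (Set.Iic 0) = 0 := by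
  rw [expMeasure_Iic hr le_rfl]
  simp

lemma integral_expMeasure {r : ℝ} (hr : 0 < r) (z : ℂ) (hz : -r < z.re) :
    Integrable (fun t : ℝ => Complex.exp (-(z * t))) (expMeasure r) ∧
    ∫ t : ℝ, Complex.exp (-(z * t)) ∂expMeasure r = r / (r + z) := by
  have h0 : (-(r + z)).re < 0 := by simp; linarith
  have hne : (r + z : ℂ) ≠ 0 := fun h => by rw [h] at h0; simp at h0
  have hm : Measurable (exponentialPDF r) := (measurable_exponentialPDFReal r).ennreal_ofReal
  have hdef : expMeasure r = volume.withDensity (exponentialPDF r) := rfl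
  have e : ∀ t : ℝ, (exponentialPDF r t).toReal • Complex.exp (-(z * t))
      = (Set.Ici (0 : ℝ)).indicator (fun t : ℝ => r * Complex.exp (-(r + z) * t)) t := fun t => by
    rw [exponentialPDF_eq]
    by_cases ht : 0 ≤ t
    · rw [if_pos ht, ENNReal.toReal_ofReal (by positivity), Set.indicator_of_mem (by exact ht),
        Complex.real_smul]
      push_cast
      rw [mul_assoc, ← Complex.exp_add]
      ring_nf
    · rw [if_neg ht, Set.indicator_of_notMem (by exact ht)]
      simp
  constructor
  · rw [hdef, integrable_withDensity_iff_integrable_smul' hm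
      (Eventually.of_forall fun _ => ENNReal.ofReal_lt_top)]
    simp_rw [e]
    rw [integrable_indicator_iff measurableSet_Ici, integrableOn_Ici_iff_integrableOn_Ioi]
    exact (integrableOn_exp_mul_complex_Ioi h0 0).const_mul _
  · rw [hdef, integral_withDensity_eq_integral_toReal_smul hm
      (Eventually.of_forall fun _ => ENNReal.ofReal_lt_top)]
    simp_rw [e]
    rw [integral_indicator measurableSet_Ici, integral_Ici_eq_integral_Ioi, integral_const_mul,
      integral_exp_mul_complex_Ioi h0]
    simp only [Complex.ofReal_zero, mul_zero, Complex.exp_zero]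
    rw [neg_div_neg_eq]
    field_simp

/-! ### The jump chain of the continuous-time process -/

section Jump

variable {Ω : Type*} [MeasurableSpace Ω]

/-- Jump times `T` and successive states `Y` of the continuous-time fringe process. -/
structure IsJumpChain (P : Measure Ω) (m : ℕ) (T : ℕ → Ω → ℝ) (Y : ℕ → Ω → Fin m → ℤ) : Prop where
  measurable_time : ∀ n, Measurable (T n)
  measurable_state : ∀ n, Measurable (Y n)
  init : ∀ᵐ ω ∂P, T 0 ω = 0 ∧ Y 0 ω = e1 m
  jump : ∀ (n : ℕ) (i : Fin m) (s : ℝ), 0 ≤ s →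
      ∀ A : Set (Fin (n + 1) → ℝ × (Fin m → ℤ)), MeasurableSet A →
        P {ω | path (fun n ω => (T n ω, Y n ω)) n ω ∈ A ∧
            s < T (n + 1) ω - T n ω ∧ Y (n + 1) ω = Y n ω + incr m i}
          = ∫⁻ ω in {ω | path (fun n ω => (T n ω, Y n ω)) n ω ∈ A},
              ENNReal.ofReal (Real.exp (-(totalGaps (Y n ω) * s))
                * (gaps (Y n ω) i / totalGaps (Y n ω))) ∂P

variable {P : Measure Ω} [IsProbabilityMeasure P] {m : ℕ} {T : ℕ → Ω → ℝ} {Y : ℕ → Ω → Fin m → ℤ}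

omit [IsProbabilityMeasure P] in
lemma IsJumpChain.measurable_pair (h : IsJumpChain P m T Y) (n : ℕ) :
    Measurable fun ω => (T n ω, Y n ω) :=
  (h.measurable_time n).prodMk (h.measurable_state n)

omit [IsProbabilityMeasure P] in
lemma IsJumpChain.measurable_path (h : IsJumpChain P m T Y) (n : ℕ) :
    Measurable (path (fun n ω => (T n ω, Y n ω)) n) :=
  BTreeUrn.measurable_path h.measurable_pair n

/-- The defining relation at `s = 0` concerns only moves with a positive waiting time. Those already
have total probability `1`, which forces the waiting times to be positive. -/
lemma IsJumpChain.ae_lt_and_isStep (hm : 0 < m) (h : IsJumpChain P m T Y) {n : ℕ}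
    (hr : ∀ᵐ ω ∂P, Y n ω ∈ reach m n) :
    (∀ᵐ ω ∂P, T n ω < T (n + 1) ω) ∧
      IsStep P (path (fun n ω => (T n ω, Y n ω)) n) (fun q => (q (Fin.last n)).2) (Y (n + 1)) := by
  have hpos : MeasurableSet {ω | T n ω < T (n + 1) ω} :=
    measurableSet_lt (h.measurable_time n) (h.measurable_time (n + 1))
  classical
  -- Without a positive waiting time `y'` stays put, which is never a move since `w_i ≠ 0`. So `y'`
  -- obeys `IsStep` exactly, and `IsStep.ae_exists` shows that it moves almost surely.
  let y' : Ω → Fin m → ℤ := fun ω => if T n ω < T (n + 1) ω then Y (n + 1) ω else Y n ω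
  have hy' : Measurable y' := Measurable.ite hpos (h.measurable_state _) (h.measurable_state _)
  have hne : ∀ i, incr m i ≠ 0 := fun i hi => by
    have := totalGaps_incr i
    rw [hi] at this
    simp [totalGaps, gaps] at this
  have hs : IsStep P (path (fun n ω => (T n ω, Y n ω)) n) (fun q => (q (Fin.last n)).2) y' := by
    intro i A hA
    have e := h.jump n i 0 le_rfl A hA
    simp only [mul_zero, neg_zero, Real.exp_zero, one_mul, sub_pos] at e
    refine Eq.trans ?_ e
    congr 1
    ext ω
    refine and_congr_right fun _ => ?_
    change y' ω = Y n ω + incr m i ↔ _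
    by_cases hω : T n ω < T (n + 1) ω
    · simp only [y', if_pos hω, hω, true_and]
    · simp only [y', if_neg hω, hω, false_and, iff_false]
      intro h0
      exact hne i (by simpa using h0.symm)
  have hae : ∀ᵐ ω ∂P, T n ω < T (n + 1) ω := by
    filter_upwards [hs.ae_exists hm (h.measurable_path n) (by fun_prop) hy' hr] with ω ⟨i, hi, _⟩
    by_contra hω
    have hi' : y' ω = Y n ω + incr m i := hi
    simp only [y', if_neg hω] at hi'
    exact hne i (by simpa using hi'.symm)
  refine ⟨hae, fun i A hA => (measure_congr ?_).trans (hs i A hA)⟩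
  filter_upwards [hae] with ω hω
  refine propext (and_congr_right fun _ => ?_)
  simp only [y', if_pos hω]

lemma IsJumpChain.ae_mem_reach (hm : 0 < m) (h : IsJumpChain P m T Y) (n : ℕ) :
    ∀ᵐ ω ∂P, Y n ω ∈ reach m n := by
  induction n with
  | zero =>
    filter_upwards [h.init] with ω hω
    rw [hω.2]
    exact e1_mem_reach hm
  | succ n ih =>
    exact (h.ae_lt_and_isStep hm ih).2.ae_mem_reach hm (h.measurable_path n) (by fun_prop)
      (h.measurable_state _) ih

lemma IsJumpChain.ae_lt (hm : 0 < m) (h : IsJumpChain P m T Y) :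
    ∀ᵐ ω ∂P, ∀ n, T n ω < T (n + 1) ω :=
  ae_all_iff.2 fun n => (h.ae_lt_and_isStep hm (h.ae_mem_reach hm n)).1

lemma IsJumpChain.isStep (hm : 0 < m) (h : IsJumpChain P m T Y) (n : ℕ) :
    IsStep P (path (fun n ω => (T n ω, Y n ω)) n) (fun q => (q (Fin.last n)).2) (Y (n + 1)) :=
  (h.ae_lt_and_isStep hm (h.ae_mem_reach hm n)).2

lemma IsJumpChain.isFringeChain (hm : 0 < m) (h : IsJumpChain P m T Y) :
    IsFringeChain P m (e1 m) Y where
  measurable := h.measurable_state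
  init := h.init.mono fun _ hω => hω.2
  step n i A hA := by
    have hA' : MeasurableSet {q : Fin (n + 1) → ℝ × (Fin m → ℤ) | (fun a => (q a).2) ∈ A} :=
      (measurable_pi_lambda _ fun a => (measurable_pi_apply a).snd) hA
    exact h.isStep hm n i _ hA'

lemma IsJumpChain.measure_eq_sum (hm : 0 < m) (h : IsJumpChain P m T Y) (n : ℕ) {B : Set Ω}
    (hB : MeasurableSet B) : P B = ∑ i, P (B ∩ {ω | Y (n + 1) ω = Y n ω + incr m i}) := by
  have hmeas : ∀ i, MeasurableSet {ω | Y (n + 1) ω = Y n ω + incr m i} := fun i =>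
    measurableSet_eq_fun (h.measurable_state _) ((h.measurable_state n).add_const _)
  refine Eq.trans (b := P (⋃ i, B ∩ {ω | Y (n + 1) ω = Y n ω + incr m i})) ?_ ?_
  · refine measure_congr ?_
    filter_upwards [(h.isStep hm n).ae_exists hm (h.measurable_path n) (by fun_prop)
      (h.measurable_state _) (h.ae_mem_reach hm n)] with ω ⟨i, hi, _⟩
    refine propext ⟨fun hω => Set.mem_iUnion.2 ⟨i, hω, hi⟩, fun hω => ?_⟩
    obtain ⟨j, hj⟩ := Set.mem_iUnion.1 hω
    exact hj.1
  · rw [measure_iUnion ?_ fun i => hB.inter (hmeas i), tsum_fintype]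
    intro i j hij
    refine Set.disjoint_left.2 fun ω hi hj => hij (incr_injective (m := m) ?_)
    have hi' : Y (n + 1) ω = Y n ω + incr m i := hi.2
    have hj' : Y (n + 1) ω = Y n ω + incr m j := hj.2
    exact add_left_cancel (hi'.symm.trans hj')

/-- The rate is `m + n` whatever the past, so the exponential tail factors out even jointly with the
next state. This is the source of the independence of jump times and states. -/
lemma IsJumpChain.measure_inter_lt (hm : 0 < m) (h : IsJumpChain P m T Y) (n : ℕ) {a : ℝ} (ha : 0 ≤ a)
    {S : Set ((Fin (n + 1) → ℝ × (Fin m → ℤ)) × (Fin m → ℤ))} (hS : MeasurableSet S) :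
    P ((fun ω => (path (fun n ω => (T n ω, Y n ω)) n ω, Y (n + 1) ω)) ⁻¹' S
        ∩ {ω | a < T (n + 1) ω - T n ω})
      = ENNReal.ofReal (Real.exp (-((m + n) * a)))
        * P ((fun ω => (path (fun n ω => (T n ω, Y n ω)) n ω, Y (n + 1) ω)) ⁻¹' S) := by
  have hR : Measurable fun ω => (path (fun n ω => (T n ω, Y n ω)) n ω, Y (n + 1) ω) :=
    (h.measurable_path n).prodMk (h.measurable_state _)
  have hlt : MeasurableSet {ω | a < T (n + 1) ω - T n ω} :=
    measurableSet_lt measurable_const ((h.measurable_time _).sub (h.measurable_time _))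
  rw [h.measure_eq_sum hm n ((hR hS).inter hlt), h.measure_eq_sum hm n (hR hS), Finset.mul_sum]
  refine Finset.sum_congr rfl fun i _ => ?_
  -- On the event of a move of type `i`, the next state is a function of the path, so `S` becomes an
  -- event of the past.
  have hSi : MeasurableSet {q : Fin (n + 1) → ℝ × (Fin m → ℤ) |
      (q, (q (Fin.last n)).2 + incr m i) ∈ S} := by
    have : Measurable fun q : Fin (n + 1) → ℝ × (Fin m → ℤ) =>
      (q, (q (Fin.last n)).2 + incr m i) := by fun_prop
    exact this hS
  have e1 := h.jump n i a ha _ hSi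
  have e2 := h.isStep hm n i _ hSi
  have s1 : (fun ω => (path (fun n ω => (T n ω, Y n ω)) n ω, Y (n + 1) ω)) ⁻¹' S
        ∩ {ω | a < T (n + 1) ω - T n ω} ∩ {ω | Y (n + 1) ω = Y n ω + incr m i}
      = {ω | path (fun n ω => (T n ω, Y n ω)) n ω ∈ {q : Fin (n + 1) → ℝ × (Fin m → ℤ) |
          (q, (q (Fin.last n)).2 + incr m i) ∈ S} ∧
          a < T (n + 1) ω - T n ω ∧ Y (n + 1) ω = Y n ω + incr m i} := by
    ext ω
    constructor
    · rintro ⟨⟨h1, h2⟩, h3⟩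
      have h3' : Y (n + 1) ω = Y n ω + incr m i := h3
      have h1' : (path (fun n ω => (T n ω, Y n ω)) n ω, Y (n + 1) ω) ∈ S := h1
      rw [h3'] at h1'
      exact ⟨h1', h2, h3⟩
    · rintro ⟨h1, h2, h3⟩
      have h1' : (path (fun n ω => (T n ω, Y n ω)) n ω, Y n ω + incr m i) ∈ S := h1
      rw [← h3] at h1'
      exact ⟨⟨h1', h2⟩, h3⟩
  have s2 : (fun ω => (path (fun n ω => (T n ω, Y n ω)) n ω, Y (n + 1) ω)) ⁻¹' S
        ∩ {ω | Y (n + 1) ω = Y n ω + incr m i}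
      = {ω | path (fun n ω => (T n ω, Y n ω)) n ω ∈ {q : Fin (n + 1) → ℝ × (Fin m → ℤ) |
          (q, (q (Fin.last n)).2 + incr m i) ∈ S} ∧ Y (n + 1) ω = Y n ω + incr m i} := by
    ext ω
    constructor
    · rintro ⟨h1, h3⟩
      have h3' : Y (n + 1) ω = Y n ω + incr m i := h3
      have h1' : (path (fun n ω => (T n ω, Y n ω)) n ω, Y (n + 1) ω) ∈ S := h1
      rw [h3'] at h1'
      exact ⟨h1', h3⟩
    · rintro ⟨h1, h3⟩
      have h1' : (path (fun n ω => (T n ω, Y n ω)) n ω, Y n ω + incr m i) ∈ S := h1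
      rw [← h3] at h1'
      exact ⟨h1', h3⟩
  rw [s1, s2, e1]
  refine Eq.trans ?_ (congrArg _ e2.symm)
  rw [← lintegral_const_mul']
  · refine lintegral_congr_ae (ae_restrict_of_ae ?_)
    filter_upwards [h.ae_mem_reach hm n] with ω hω
    rw [← ENNReal.ofReal_mul (Real.exp_pos _).le, hω.2]
    change _ = ENNReal.ofReal (_ * (gaps (Y n ω) i / totalGaps (Y n ω)))
    rw [hω.2]
  · exact ENNReal.ofReal_ne_top

lemma IsJumpChain.map_restrict (hm : 0 < m) (h : IsJumpChain P m T Y) (n : ℕ)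
    {S : Set ((Fin (n + 1) → ℝ × (Fin m → ℤ)) × (Fin m → ℤ))} (hS : MeasurableSet S) :
    (P.restrict ((fun ω => (path (fun n ω => (T n ω, Y n ω)) n ω, Y (n + 1) ω)) ⁻¹' S)).map
        (fun ω => T (n + 1) ω - T n ω)
      = P ((fun ω => (path (fun n ω => (T n ω, Y n ω)) n ω, Y (n + 1) ω)) ⁻¹' S)
        • expMeasure (m + n) := by
  have hr : (0 : ℝ) < m + n := by positivity
  have := isProbabilityMeasure_expMeasure hr
  have hΔ : Measurable fun ω => T (n + 1) ω - T n ω :=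
    (h.measurable_time _).sub (h.measurable_time _)
  have : IsFiniteMeasure (P ((fun ω => (path (fun n ω => (T n ω, Y n ω)) n ω, Y (n + 1) ω)) ⁻¹' S)
        • expMeasure (m + n)) := Measure.smul_finite _ (measure_ne_top _ _)
  refine measure_ext_of_Ioi (fun a ha => ?_) ?_ ?_
  · rw [Measure.map_apply hΔ measurableSet_Ioi, Measure.restrict_apply (hΔ measurableSet_Ioi),
      Measure.smul_apply, expMeasure_Ioi hr ha, smul_eq_mul, mul_comm, ← h.measure_inter_lt hm n ha hS,
      Set.inter_comm]
    rfl
  · rw [Measure.map_apply hΔ measurableSet_Iic, ← nonpos_iff_eq_zero]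
    refine (Measure.restrict_apply_le _ _).trans (le_of_eq ?_)
    have h1 : ∀ᵐ ω ∂P, ¬ ω ∈ (fun ω => T (n + 1) ω - T n ω) ⁻¹' Set.Iic 0 := by
      filter_upwards [h.ae_lt hm] with ω hω h0
      have h0' : T (n + 1) ω - T n ω ≤ 0 := h0
      linarith [hω n]
    exact measure_eq_zero_iff_ae_notMem.2 h1
  · rw [Measure.smul_apply, expMeasure_Iic_zero hr, smul_zero]

lemma IsJumpChain.map_sub (hm : 0 < m) (h : IsJumpChain P m T Y) (n : ℕ) :
    P.map (fun ω => T (n + 1) ω - T n ω) = expMeasure (m + n) := by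
  simpa using h.map_restrict hm n MeasurableSet.univ

lemma IsJumpChain.indepFun (hm : 0 < m) (h : IsJumpChain P m T Y) (n : ℕ) :
    IndepFun (fun ω => (path (fun n ω => (T n ω, Y n ω)) n ω, Y (n + 1) ω))
      (fun ω => T (n + 1) ω - T n ω) P := by
  have hΔ : Measurable fun ω => T (n + 1) ω - T n ω :=
    (h.measurable_time _).sub (h.measurable_time _)
  rw [indepFun_iff_measure_inter_preimage_eq_mul]
  intro S E hS hE
  have e := congrArg (fun μ => μ E) (h.map_restrict hm n hS)
  simp only [Measure.smul_apply] at e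
  rw [Measure.map_apply hΔ hE, Measure.restrict_apply (hΔ hE), ← h.map_sub hm n,
    Measure.map_apply hΔ hE, Set.inter_comm] at e
  exact e

end Jump

/-! ### Exponential moments of the jump times -/

section Jump

variable {Ω : Type*} [MeasurableSpace Ω] {P : Measure Ω} [IsProbabilityMeasure P] {m : ℕ}
  {T : ℕ → Ω → ℝ} {Y : ℕ → Ω → Fin m → ℤ}

lemma IsJumpChain.integral_mul_exp (hm : 0 < m) (h : IsJumpChain P m T Y) (n : ℕ) {z : ℂ}
    (hz : -(m : ℝ) < z.re) {F : (Fin (n + 1) → ℝ × (Fin m → ℤ)) × (Fin m → ℤ) → ℂ}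
    (hF : Measurable F) :
    ∫ ω, F (path (fun n ω => (T n ω, Y n ω)) n ω, Y (n + 1) ω)
        * Complex.exp (-(z * (T (n + 1) ω - T n ω : ℝ))) ∂P
      = (∫ ω, F (path (fun n ω => (T n ω, Y n ω)) n ω, Y (n + 1) ω) ∂P) * ((m + n) / (m + n + z)) := by
  have hr : (0 : ℝ) < m + n := by positivity
  have hn : (0 : ℝ) ≤ n := n.cast_nonneg
  have hΔ : Measurable fun ω => T (n + 1) ω - T n ω :=
    (h.measurable_time _).sub (h.measurable_time _)
  have hR : Measurable fun ω => (path (fun n ω => (T n ω, Y n ω)) n ω, Y (n + 1) ω) :=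
    (h.measurable_path n).prodMk (h.measurable_state _)
  have hg : Measurable fun t : ℝ => Complex.exp (-(z * t)) := by fun_prop
  rw [(h.indepFun hm n).integral_fun_comp_mul_comp (f := F) (g := fun t : ℝ => Complex.exp (-(z * t)))
    hR.aemeasurable hΔ.aemeasurable hF.aestronglyMeasurable hg.aestronglyMeasurable]
  congr 1
  have e := integral_map (μ := P) hΔ.aemeasurable (f := fun t : ℝ => Complex.exp (-(z * t)))
    hg.aestronglyMeasurable
  rw [← e, h.map_sub hm n, (integral_expMeasure hr z (by linarith)).2]
  push_cast
  rfl

lemma IsJumpChain.integrable_exp (hm : 0 < m) (h : IsJumpChain P m T Y) {z : ℂ}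
    (hz : -(m : ℝ) < z.re) (n : ℕ) : Integrable (fun ω => Complex.exp (-(z * T n ω))) P := by
  induction n with
  | zero =>
    refine (integrable_const (1 : ℂ)).congr ?_
    filter_upwards [h.init] with ω hω
    rw [hω.1]
    simp
  | succ n ih =>
    have hr : (0 : ℝ) < m + n := by positivity
    have hn : (0 : ℝ) ≤ n := n.cast_nonneg
    have hΔ : Measurable fun ω => T (n + 1) ω - T n ω :=
      (h.measurable_time _).sub (h.measurable_time _)
    have hg : Measurable fun t : ℝ => Complex.exp (-(z * t)) := by fun_prop
    have hF : Measurable fun q : (Fin (n + 1) → ℝ × (Fin m → ℤ)) × (Fin m → ℤ) =>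
      Complex.exp (-(z * (q.1 (Fin.last n)).1)) := by fun_prop
    have i2 := (integral_expMeasure hr z (by linarith)).1
    rw [← h.map_sub hm n] at i2
    have i3 := ((h.indepFun hm n).comp hF hg).integrable_mul ih (i2.comp_measurable hΔ)
    refine i3.congr (Eventually.of_forall fun ω => ?_)
    change Complex.exp (-(z * T n ω)) * Complex.exp (-(z * (T (n + 1) ω - T n ω : ℝ))) = _
    rw [← Complex.exp_add]
    push_cast
    ring_nf

/-- The product form expresses that `T n` and `Y n` are independent; the first factor is the Laplace
transform of a sum of independent exponentials of rates `m, …, m + n - 1`. -/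
lemma IsJumpChain.integral_exp_mul (hm : 0 < m) (h : IsJumpChain P m T Y) {z : ℂ}
    (hz : -(m : ℝ) < z.re) (n : ℕ) (f : (Fin m → ℤ) → ℂ) :
    ∫ ω, Complex.exp (-(z * T n ω)) * f (Y n ω) ∂P
      = (gammaProd m z n)⁻¹ * (kern m)^[n] f (e1 m) := by
  induction n generalizing f with
  | zero =>
    have : ∀ᵐ ω ∂P, Complex.exp (-(z * T 0 ω)) * f (Y 0 ω) = f (e1 m) := by
      filter_upwards [h.init] with ω hω
      rw [hω.1, hω.2]
      simp
    rw [integral_congr_ae this]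
    simp [gammaProd]
  | succ n ih =>
    have e1' : ∀ ω, Complex.exp (-(z * T (n + 1) ω)) * f (Y (n + 1) ω)
        = (Complex.exp (-(z * T n ω)) * f (Y (n + 1) ω))
          * Complex.exp (-(z * (T (n + 1) ω - T n ω : ℝ))) := fun ω => by
      have : -(z * (T (n + 1) ω : ℂ)) = -(z * T n ω) + -(z * (T (n + 1) ω - T n ω : ℝ)) := by
        push_cast; ring
      rw [this, Complex.exp_add]
      ring
    have hF : Measurable fun q : (Fin (n + 1) → ℝ × (Fin m → ℤ)) × (Fin m → ℤ) =>
        Complex.exp (-(z * (q.1 (Fin.last n)).1)) * f q.2 :=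
      (by fun_prop : Measurable fun q : (Fin (n + 1) → ℝ × (Fin m → ℤ)) × (Fin m → ℤ) =>
        Complex.exp (-(z * (q.1 (Fin.last n)).1))).mul
          ((measurable_of_countable f).comp measurable_snd)
    have e2 := h.integral_mul_exp hm n hz hF
    have e3 := (h.isStep hm n).integral_eq hm (h.measurable_path n) (by fun_prop)
      (h.measurable_state _) (h.ae_mem_reach hm n)
      (h := fun q => Complex.exp (-(z * (q (Fin.last n)).1))) (by fun_prop)
      (h.integrable_exp hm hz n) f
    simp_rw [e1']
    refine e2.trans ?_
    refine (congrArg (fun w => w * ((m + n) / (m + n + z))) (e3.trans (ih (kern m f)))).trans ?_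
    rw [gammaProd, gammaProd, Finset.prod_range_succ, mul_inv, inv_div, Function.iterate_succ_apply]
    ring

lemma IsJumpChain.integral_exp (hm : 0 < m) (h : IsJumpChain P m T Y) {z : ℂ}
    (hz : -(m : ℝ) < z.re) (n : ℕ) :
    ∫ ω, Complex.exp (-(z * T n ω)) ∂P = (gammaProd m z n)⁻¹ := by
  have e := h.integral_exp_mul hm hz n fun _ => 1
  have e2 := (h.isFringeChain hm).integral_eq_iterate hm n fun _ => 1
  simp only [mul_one] at e
  rw [e, ← e2]
  simp

lemma IsJumpChain.integral_real_exp (hm : 0 < m) (h : IsJumpChain P m T Y) {s : ℝ}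
    (hs : -(m : ℝ) < s) (n : ℕ) :
    Integrable (fun ω => Real.exp (-(s * T n ω))) P ∧
    ((∫ ω, Real.exp (-(s * T n ω)) ∂P : ℝ) : ℂ) = (gammaProd m s n)⁻¹ := by
  have e : ∀ ω, Complex.exp (-((s : ℂ) * T n ω)) = ((Real.exp (-(s * T n ω)) : ℝ) : ℂ) := fun ω => by
    push_cast; rfl
  have i := h.integrable_exp hm (z := s) (by simpa using hs) n
  constructor
  · exact i.re.congr (Eventually.of_forall fun ω => by simp only [e]; exact Complex.ofReal_re _)
  · rw [← h.integral_exp hm (z := s) (by simpa using hs) n, ← integral_complex_ofReal]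
    simp_rw [e]

lemma gammaProd_one (hm : 0 < m) (n : ℕ) : gammaProd m 1 n = (m + n) / m := by
  have hm0 : (m : ℂ) ≠ 0 := by exact_mod_cast hm.ne'
  induction n with
  | zero => simp [gammaProd, hm0]
  | succ n ih =>
    have : (m + n : ℂ) ≠ 0 := by exact_mod_cast (by omega)
    rw [gammaProd, Finset.prod_range_succ, ← gammaProd, ih]
    push_cast
    field_simp
    ring

/-- `(m + n) exp (-T n)` is a positive martingale of mean `m`, and replacing `m + n` by `n` does not
affect the limit. -/
lemma IsJumpChain.ae_exists_tendsto_mul_exp (hm : 0 < m) (h : IsJumpChain P m T Y) :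
    ∀ᵐ ω ∂P, ∃ x, Tendsto (fun n : ℕ => Real.exp (Real.log n - T n ω)) atTop (𝓝 x) := by
  have hm' : (0 : ℝ) < m := by exact_mod_cast hm
  have h1 : -(m : ℝ) < (1 : ℂ).re := by simp; linarith
  have hconv := ae_tendsto_of_path (P := P) h.measurable_pair
    (d := fun n q => (m + n) * Complex.exp (-(1 * (q (Fin.last n)).1))) (C := m)
    (fun n => by fun_prop) (fun n => (h.integrable_exp hm h1 n).const_mul _) (fun n A hA => by
      have hA' := h.measurable_path n hA
      rw [← integral_indicator hA', ← integral_indicator hA']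
      have hF : Measurable fun q : (Fin (n + 1) → ℝ × (Fin m → ℤ)) × (Fin m → ℤ) =>
          A.indicator (fun q => (m + n + 1 : ℂ) * Complex.exp (-(1 * (q (Fin.last n)).1))) q.1 :=
        (Measurable.indicator (by fun_prop) hA).comp measurable_fst
      have e := h.integral_mul_exp hm n h1 hF
      have hne : (m + n + 1 : ℂ) ≠ 0 := by exact_mod_cast (show m + n + 1 ≠ 0 by omega)
      refine Eq.trans (integral_congr_ae (Eventually.of_forall fun ω => ?_)) (e.trans ?_)
      · by_cases hω : path (fun n ω => (T n ω, Y n ω)) n ω ∈ A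
        · simp only [Set.indicator_of_mem hω]
          rw [Set.indicator_of_mem (by exact hω), mul_assoc, ← Complex.exp_add]
          simp only [path, Fin.val_last]
          push_cast
          ring_nf
        · simp only [Set.indicator_of_notMem hω]
          rw [Set.indicator_of_notMem (by exact hω), zero_mul]
      · rw [← integral_mul_const]
        refine integral_congr_ae (Eventually.of_forall fun ω => ?_)
        by_cases hω : path (fun n ω => (T n ω, Y n ω)) n ω ∈ A
        · simp only [Set.indicator_of_mem hω]
          rw [Set.indicator_of_mem (by exact hω)]
          field_simp
        · simp only [Set.indicator_of_notMem hω]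
          rw [Set.indicator_of_notMem (by exact hω), zero_mul])
    (fun n => by
      have hs : -(m : ℝ) < (1 : ℝ) := by linarith
      have e := (h.integral_real_exp hm hs n).2
      rw [Complex.ofReal_one, gammaProd_one hm, inv_div] at e
      have e' : ∫ ω, Real.exp (-(1 * T n ω)) ∂P = m / (m + n) :=
        Complex.ofReal_injective (e.trans (by push_cast; rfl))
      have hn : ∀ ω, ‖(m + n : ℂ) * Complex.exp (-(1 * (path (fun n ω => (T n ω, Y n ω)) n ω
          (Fin.last n)).1))‖ = (m + n) * Real.exp (-(1 * T n ω)) := fun ω => by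
        have : ‖(m + n : ℂ)‖ = m + n := by
          rw [← Nat.cast_add, Complex.norm_natCast, Nat.cast_add]
        rw [norm_mul, Complex.norm_exp, this]
        simp [path]
      simp_rw [hn]
      rw [integral_const_mul, e', mul_div_cancel₀]
      positivity)
  filter_upwards [hconv] with ω ⟨c, hc⟩
  refine ⟨c.re, ?_⟩
  have h2 : Tendsto (fun n : ℕ => (n / (m + n) : ℝ)) atTop (𝓝 1) := by
    have := tendsto_add_mul_div_add_mul_atTop_nhds (𝕜 := ℝ) 0 m 1 (one_ne_zero)
    simpa using this
  have h3 := h2.mul ((Complex.continuous_re.tendsto c).comp hc)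
  rw [one_mul] at h3
  refine h3.congr' ?_
  filter_upwards [eventually_gt_atTop 0] with n hn
  have hn' : (0 : ℝ) < n := by exact_mod_cast hn
  have e : (m + n : ℂ) * Complex.exp (-(1 * (path (fun n ω => (T n ω, Y n ω)) n ω
      (Fin.last n)).1)) = (((m + n) * Real.exp (-T n ω) : ℝ) : ℂ) := by
    simp [path]
  simp only [Function.comp]
  rw [e, Complex.ofReal_re, Real.exp_sub, Real.exp_log hn', Real.exp_neg]
  field_simp

/-- It remains to see that the limit of `n exp (-T n)` is not zero. Its moments of order `-1/2` are
bounded, by the same Gamma asymptotics, available because `-1/2 > -m`; Fatou's lemma then excludes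
the value zero. -/
lemma IsJumpChain.ae_exists_tendsto_log (hm : 0 < m) (h : IsJumpChain P m T Y) :
    ∀ᵐ ω ∂P, ∃ x, Tendsto (fun n : ℕ => Real.log n - T n ω) atTop (𝓝 x) := by
  have hm1 : (1 : ℝ) ≤ m := by exact_mod_cast hm
  have hs : 0 < (m : ℂ).re := by simp; linarith
  have hsl : 0 < ((m : ℂ) + ((-(1 / 2) : ℝ) : ℂ)).re := by
    simp only [Complex.add_re, Complex.natCast_re, Complex.ofReal_re]; linarith
  have hlt : -(m : ℝ) < -(1 / 2) := by linarith
  have ht := (tendsto_gammaProd hs hsl).inv₀ (div_ne_zero (Complex.Gamma_ne_zero_of_re_pos hs)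
    (Complex.Gamma_ne_zero_of_re_pos hsl))
  obtain ⟨C, hC⟩ := ht.norm.bddAbove_range
  have hbound : ∀ n : ℕ, 0 < n →
      ∫⁻ ω, ENNReal.ofReal (Real.exp (Real.log n - T n ω)) ^ (-(1 / 2) : ℝ) ∂P ≤ ENNReal.ofReal C := by
    intro n hn
    have hn' : (0 : ℝ) < n := by exact_mod_cast hn
    obtain ⟨hi, he⟩ := h.integral_real_exp hm hlt n
    have e : ∀ ω, ENNReal.ofReal (Real.exp (Real.log n - T n ω)) ^ (-(1 / 2) : ℝ)
        = ENNReal.ofReal ((n : ℝ) ^ (-(1 / 2) : ℝ) * Real.exp (-(-(1 / 2) * T n ω))) := fun ω => by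
      rw [ENNReal.ofReal_rpow_of_pos (Real.exp_pos _), Real.rpow_def_of_pos (Real.exp_pos _),
        Real.rpow_def_of_pos hn', Real.log_exp, ← Real.exp_add]
      congr 2
      ring
    simp_rw [e]
    rw [← ofReal_integral_eq_lintegral_ofReal (hi.const_mul _)
      (Eventually.of_forall fun ω => by positivity), integral_const_mul]
    refine ENNReal.ofReal_le_ofReal ?_
    refine le_trans ?_ (hC ⟨n, rfl⟩)
    simp only
    rw [norm_inv, norm_mul, mul_inv, Complex.norm_natCast_cpow_of_pos hn, ← norm_inv (gammaProd _ _ _),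
      ← he, Complex.norm_real, Complex.neg_re, Complex.ofReal_re, ← Real.rpow_neg hn'.le]
    rw [neg_neg]
    exact mul_le_mul_of_nonneg_left (le_abs_self _) (by positivity)
  have hmeas : ∀ n : ℕ, Measurable fun ω =>
      ENNReal.ofReal (Real.exp (Real.log n - T n ω)) ^ (-(1 / 2) : ℝ) := fun n =>
    ((measurable_const.sub (h.measurable_time n)).exp.ennreal_ofReal).pow_const _
  have hfin : ∫⁻ ω, liminf (fun n : ℕ =>
      ENNReal.ofReal (Real.exp (Real.log n - T n ω)) ^ (-(1 / 2) : ℝ)) atTop ∂P ≤ ENNReal.ofReal C := by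
    refine (lintegral_liminf_le hmeas).trans ?_
    refine (liminf_le_liminf ?_).trans (liminf_const _).le
    filter_upwards [eventually_gt_atTop 0] with n hn using hbound n hn
  filter_upwards [h.ae_exists_tendsto_mul_exp hm, ae_lt_top (Measurable.liminf hmeas)
    (ne_top_of_le_ne_top ENNReal.ofReal_ne_top hfin)] with ω ⟨x, hx⟩ h2
  have h3 := (ENNReal.continuous_rpow_const (y := -(1 / 2))).tendsto _ |>.comp
    (ENNReal.tendsto_ofReal hx)
  rw [show liminf (fun n : ℕ => ENNReal.ofReal (Real.exp (Real.log n - T n ω)) ^ (-(1 / 2) : ℝ)) atTop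
    = _ from h3.liminf_eq] at h2
  have hx0 : 0 < x := by
    by_contra hx0
    -- In `ℝ≥0∞` a negative power of `0` is `∞`, against the finite `liminf`.
    rw [ENNReal.ofReal_of_nonpos (not_lt.1 hx0), ENNReal.zero_rpow_of_neg (by norm_num)] at h2
    exact lt_irrefl _ h2
  refine ⟨Real.log x, ((Real.continuousAt_log hx0.ne').tendsto.comp hx).congr fun n => ?_⟩
  simp

end Jump

/-! ### The limit of the continuous-time process -/

section Jump

variable {Ω : Type*} [MeasurableSpace Ω] {P : Measure Ω} [IsProbabilityMeasure P] {m : ℕ}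
  {T : ℕ → Ω → ℝ} {Y : ℕ → Ω → Fin m → ℤ} {l : ℂ} {D : Ω → ℂ} {X : Ω → ℝ}

/-- The Mellin transform of the `Gamma(m)` law on the imaginary axis. -/
def logMoment (m : ℕ) (s : ℝ) : ℂ :=
  Complex.Gamma (m + s * Complex.I) / Complex.Gamma m

/-- The joint characteristic function factors at each finite `n` by `integral_exp_mul`, and the
factorisation survives the limit. Its time factor is the Mellin transform of Gamma(m). -/
lemma IsJumpChain.integral_exp_mul_limit (hm : 0 < m) (h : IsJumpChain P m T Y)
    (hD : Measurable D) (hlim : IsDiscreteLimit P m l Y D)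
    (hX : ∀ᵐ ω ∂P, Tendsto (fun n : ℕ => Real.log n - T n ω) atTop (𝓝 (X ω))) (s : ℝ) (z : ℂ) :
    ∫ ω, Complex.exp ((s * X ω : ℝ) * Complex.I) * Complex.exp ((inner ℝ (D ω) z : ℝ) * Complex.I) ∂P
      = logMoment m s * charFun (P.map D) z := by
  have hm' : (0 : ℝ) < m := by exact_mod_cast hm
  have hs : 0 < (m : ℂ).re := by simpa using hm'
  have hsl : 0 < ((m : ℂ) + s * Complex.I).re := by simpa using hm'
  have hz : -(m : ℝ) < (s * Complex.I : ℂ).re := by simpa using hm'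
  have hY := h.isFringeChain hm
  have hexp : Continuous fun x : ℝ => Complex.exp ((s * x : ℝ) * Complex.I) := by fun_prop
  have hcont : Continuous fun w : ℂ => Complex.exp ((inner ℝ w z : ℝ) * Complex.I) := by fun_prop
  set c : ℕ → (Fin m → ℤ) → ℂ := fun n x =>
    Complex.exp ((inner ℝ ((n : ℂ) ^ (-l) * uGap m l x) z : ℝ) * Complex.I) with hc
  have hcm : ∀ n, Measurable fun ω => c n (Y n ω) := fun n =>
    (measurable_of_countable (c n)).comp (h.measurable_state n)
  have hcl : Tendsto (fun n => ∫ ω, c n (Y n ω) ∂P) atTop (𝓝 (charFun (P.map D) z)) := by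
    rw [charFun_apply, integral_map hD.aemeasurable (by fun_prop)]
    refine tendsto_integral_of_dominated_convergence (fun _ => 1)
      (fun n => (hcm n).aestronglyMeasurable) (integrable_const _)
      (fun n => Eventually.of_forall fun ω => (Complex.norm_exp_ofReal_mul_I _).le) ?_
    filter_upwards [hlim] with ω hω using (hcont.tendsto _).comp hω
  have hleft : Tendsto (fun n : ℕ => ∫ ω, Complex.exp ((s * (Real.log n - T n ω) : ℝ) * Complex.I)
      * c n (Y n ω) ∂P) atTop (𝓝 (∫ ω, Complex.exp ((s * X ω : ℝ) * Complex.I)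
        * Complex.exp ((inner ℝ (D ω) z : ℝ) * Complex.I) ∂P)) := by
    refine tendsto_integral_of_dominated_convergence (fun _ => 1) (fun n => ?_) (integrable_const _)
      (fun n => Eventually.of_forall fun ω => ?_) ?_
    · have := h.measurable_time n
      exact (Measurable.mul (by fun_prop) (hcm n)).aestronglyMeasurable
    · rw [norm_mul, Complex.norm_exp_ofReal_mul_I, Complex.norm_exp_ofReal_mul_I, one_mul]
    · filter_upwards [hlim, hX] with ω h1 h2
      exact ((hexp.tendsto _).comp h2).mul ((hcont.tendsto _).comp h1)
  refine tendsto_nhds_unique hleft ?_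
  have ht := ((tendsto_gammaProd hs hsl).inv₀ (div_ne_zero (Complex.Gamma_ne_zero_of_re_pos hs)
    (Complex.Gamma_ne_zero_of_re_pos hsl))).mul hcl
  rw [inv_div] at ht
  refine ht.congr' ?_
  filter_upwards [eventually_gt_atTop 0] with n hn
  have hn0 : (n : ℂ) ≠ 0 := by exact_mod_cast hn.ne'
  have e : ∀ ω, Complex.exp ((s * (Real.log n - T n ω) : ℝ) * Complex.I) * c n (Y n ω)
      = (n : ℂ) ^ (s * Complex.I) * (Complex.exp (-(s * Complex.I * T n ω)) * c n (Y n ω)) :=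
    fun ω => by
      generalize c n (Y n ω) = w
      rw [Complex.cpow_def_of_ne_zero hn0, ← mul_assoc, ← Complex.exp_add, ← Complex.natCast_log]
      push_cast
      ring_nf
  simp_rw [e]
  rw [integral_const_mul, h.integral_exp_mul hm hz, ← hY.integral_eq_iterate hm, mul_inv,
    Complex.cpow_neg, inv_inv]
  ring

lemma IsJumpChain.charFun_log (hm : 0 < m) (h : IsJumpChain P m T Y)
    (hD : Measurable D) (hlim : IsDiscreteLimit P m l Y D) (hXm : Measurable X)
    (hX : ∀ᵐ ω ∂P, Tendsto (fun n : ℕ => Real.log n - T n ω) atTop (𝓝 (X ω))) (s : ℝ) :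
    charFun (P.map X) s = logMoment m s := by
  have := Measure.isProbabilityMeasure_map (μ := P) hD.aemeasurable
  have e := h.integral_exp_mul_limit hm hD hlim hX s 0
  rw [charFun_zero] at e
  rw [charFun_apply_real, integral_map hXm.aemeasurable (by fun_prop)]
  simpa using e

lemma IsJumpChain.indepFun_limit (hm : 0 < m) (h : IsJumpChain P m T Y)
    (hD : Measurable D) (hlim : IsDiscreteLimit P m l Y D) (hXm : Measurable X)
    (hX : ∀ᵐ ω ∂P, Tendsto (fun n : ℕ => Real.log n - T n ω) atTop (𝓝 (X ω))) :
    IndepFun X D P := by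
  rw [indepFun_iff_charFun_prod hXm.aemeasurable hD.aemeasurable]
  intro t
  rw [h.charFun_log hm hD hlim hXm hX, ← h.integral_exp_mul_limit hm hD hlim hX, charFun_apply,
    integral_map (by fun_prop) (by fun_prop)]
  refine integral_congr_ae (Eventually.of_forall fun ω => ?_)
  simp only
  rw [WithLp.prod_inner_apply, ← Complex.exp_add]
  have e : (inner ℝ (X ω) t.ofLp.1 : ℝ) = t.ofLp.1 * X ω := by simp
  push_cast
  rw [e, add_mul]
  push_cast
  rfl

omit [IsProbabilityMeasure P] in
lemma tendsto_exp_mul_uGap (hlim : IsDiscreteLimit P m l Y D)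
    (hX : ∀ᵐ ω ∂P, Tendsto (fun n : ℕ => Real.log n - T n ω) atTop (𝓝 (X ω))) :
    ∀ᵐ ω ∂P, Tendsto (fun n => Complex.exp (-(l * T n ω)) * uGap m l (Y n ω)) atTop
      (𝓝 (Complex.exp (l * X ω) * D ω)) := by
  filter_upwards [hlim, hX] with ω h1 h2
  have hexp : Continuous fun x : ℝ => Complex.exp (l * x) := by fun_prop
  refine (((hexp.tendsto _).comp h2).mul h1).congr' ?_
  filter_upwards [eventually_gt_atTop 0] with n hn
  have hn0 : (n : ℂ) ≠ 0 := by exact_mod_cast hn.ne'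
  simp only [Function.comp]
  rw [Complex.cpow_def_of_ne_zero hn0, ← mul_assoc, ← Complex.exp_add, ← Complex.natCast_log]
  push_cast
  ring_nf

/-- By independence the second moment is that of `u(l)` divided by `gammaProd m (2 Re l) n`; both
have order at most `n ^ (2 Re l)`, and the divisor exactly this order. -/
lemma IsJumpChain.exists_bound (hm : 0 < m) (h : IsJumpChain P m T Y) (hl : (chi m).IsRoot l)
    (hr : 1 / 2 < l.re) :
    (∀ n, MemLp (fun ω => Complex.exp (-(l * T n ω)) * uGap m l (Y n ω)) 2 P) ∧
    ∃ C, ∀ n, ∫ ω, ‖Complex.exp (-(l * T n ω)) * uGap m l (Y n ω)‖ ^ 2 ∂P ≤ C := by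
  have hm' : (0 : ℝ) < m := by exact_mod_cast hm
  have hs : 0 < (m : ℂ).re := by simpa using hm'
  have hsl : 0 < ((m : ℂ) + l).re := by simp; linarith
  have hs2 : 0 < ((m : ℂ) + (2 * l.re : ℝ)).re := by
    simp only [Complex.add_re, Complex.natCast_re, Complex.ofReal_re]; linarith
  have hz : -(m : ℝ) < ((2 * l.re : ℝ) : ℂ).re := by rw [Complex.ofReal_re]; linarith
  have hY := h.isFringeChain hm
  have e : ∀ n ω, ((‖Complex.exp (-(l * T n ω)) * uGap m l (Y n ω)‖ ^ 2 : ℝ) : ℂ)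
      = Complex.exp (-((2 * l.re : ℝ) * T n ω)) * ((‖uGap m l (Y n ω)‖ ^ 2 : ℝ) : ℂ) := fun n ω => by
    rw [norm_mul, mul_pow, Complex.norm_exp, ← Real.exp_nat_mul]
    push_cast
    congr 2
    simp
    ring
  have hi : ∀ n, Integrable
      (fun ω => ((‖Complex.exp (-(l * T n ω)) * uGap m l (Y n ω)‖ ^ 2 : ℝ) : ℂ)) P := fun n => by
    simp_rw [e]
    exact integrable_mul_of_ae_mem (h.integrable_exp hm hz n) (h.measurable_state n)
      (finite_reach hm n) (h.ae_mem_reach hm n) fun x => ((‖uGap m l x‖ ^ 2 : ℝ) : ℂ)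
  constructor
  · intro n
    have h1 := h.measurable_time n
    have h2 : Measurable fun ω => uGap m l (Y n ω) :=
      (measurable_of_countable (uGap m l)).comp (h.measurable_state n)
    refine (memLp_two_iff_integrable_sq_norm (by fun_prop)).2 ?_
    exact (hi n).re.congr (Eventually.of_forall fun ω => Complex.ofReal_re _)
  · obtain ⟨C, hC⟩ := hY.exists_bound hm hl hr
    have hg := gammaProd_ne_zero hs hsl
    have hC0 : 0 ≤ C := (integral_nonneg fun ω => by positivity).trans (hC 0)
    have ht : Tendsto (fun n => ‖gammaProd m l n‖ ^ 2 / ‖gammaProd m (2 * l.re : ℝ) n‖) atTop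
        (𝓝 (‖Complex.Gamma m / Complex.Gamma (m + l)‖ ^ 2
          / ‖Complex.Gamma m / Complex.Gamma (m + (2 * l.re : ℝ))‖)) := by
      have h1 := ((tendsto_gammaProd hs hsl).norm.pow 2).div (tendsto_gammaProd hs hs2).norm
        (norm_ne_zero_iff.2 (div_ne_zero (Complex.Gamma_ne_zero_of_re_pos hs)
          (Complex.Gamma_ne_zero_of_re_pos hs2)))
      refine h1.congr' ?_
      filter_upwards [eventually_gt_atTop 0] with n hn
      have hn' : (0 : ℝ) < n := by exact_mod_cast hn
      have e1 : ‖(n : ℂ) ^ (-l)‖ ^ 2 = ‖(n : ℂ) ^ (-((2 * l.re : ℝ) : ℂ))‖ := by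
        rw [Complex.norm_natCast_cpow_of_pos hn, Complex.norm_natCast_cpow_of_pos hn,
          ← Real.rpow_natCast, ← Real.rpow_mul hn'.le]
        congr 1
        simp
        ring
      have e2 : ‖(n : ℂ) ^ (-((2 * l.re : ℝ) : ℂ))‖ ≠ 0 := by
        rw [Complex.norm_natCast_cpow_of_pos hn]
        exact (Real.rpow_pos_of_pos hn' _).ne'
      simp only [Pi.div_apply]
      rw [norm_mul, norm_mul, mul_pow, e1, mul_div_mul_left _ _ e2]
    obtain ⟨B, hB⟩ := ht.bddAbove_range
    refine ⟨B * C, fun n => ?_⟩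
    have e3 : ((∫ ω, ‖Complex.exp (-(l * T n ω)) * uGap m l (Y n ω)‖ ^ 2 ∂P : ℝ) : ℂ)
        = (gammaProd m (2 * l.re : ℝ) n)⁻¹ * ((∫ ω, ‖uGap m l (Y n ω)‖ ^ 2 ∂P : ℝ) : ℂ) := by
      rw [← integral_complex_ofReal, ← integral_complex_ofReal]
      simp_rw [e]
      rw [h.integral_exp_mul hm hz n fun x => ((‖uGap m l x‖ ^ 2 : ℝ) : ℂ),
        hY.integral_eq_iterate hm n fun x => ((‖uGap m l x‖ ^ 2 : ℝ) : ℂ)]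
    have e4 : ∫ ω, ‖uGap m l (Y n ω)‖ ^ 2 ∂P
        = ‖gammaProd m l n‖ ^ 2 * ∫ ω, ‖uGap m l (Y n ω) / gammaProd m l n‖ ^ 2 ∂P := by
      rw [← integral_const_mul]
      refine integral_congr_ae (Eventually.of_forall fun ω => ?_)
      simp only
      rw [← mul_pow, ← norm_mul, mul_div_cancel₀ _ (hg n)]
    have hI : 0 ≤ ∫ ω, ‖uGap m l (Y n ω) / gammaProd m l n‖ ^ 2 ∂P :=
      integral_nonneg fun ω => by positivity
    calc _ ≤ ‖((∫ ω, ‖Complex.exp (-(l * T n ω)) * uGap m l (Y n ω)‖ ^ 2 ∂P : ℝ) : ℂ)‖ := by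
          rw [Complex.norm_real]; exact le_abs_self _
      _ = ‖gammaProd m l n‖ ^ 2 / ‖gammaProd m (2 * l.re : ℝ) n‖
          * ∫ ω, ‖uGap m l (Y n ω) / gammaProd m l n‖ ^ 2 ∂P := by
        rw [e3, e4, norm_mul, norm_inv, Complex.norm_real, Real.norm_of_nonneg (by positivity)]
        ring
      _ ≤ B * C := mul_le_mul (hB ⟨n, rfl⟩) (hC n) hI ((by positivity : (0 : ℝ) ≤ _).trans (hB ⟨n, rfl⟩))

lemma IsJumpChain.integral_limit (hm : 0 < m) (h : IsJumpChain P m T Y) (hl : (chi m).IsRoot l)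
    (hr : 1 / 2 < l.re) (hlim : IsDiscreteLimit P m l Y D)
    (hX : ∀ᵐ ω ∂P, Tendsto (fun n : ℕ => Real.log n - T n ω) atTop (𝓝 (X ω))) :
    MemLp (fun ω => Complex.exp (l * X ω) * D ω) 2 P ∧
      ∫ ω, Complex.exp (l * X ω) * D ω ∂P = m := by
  have hm' : (0 : ℝ) < m := by exact_mod_cast hm
  have hs : 0 < (m : ℂ).re := by simpa using hm'
  have hsl : 0 < ((m : ℂ) + l).re := by simp; linarith
  obtain ⟨h1, C, hC⟩ := h.exists_bound hm hl hr
  have ht := tendsto_exp_mul_uGap hlim hX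
  refine ⟨(memLp_two_of_tendsto_ae h1 hC ht).1, ?_⟩
  refine tendsto_nhds_unique (tendsto_integral_of_sq_bounded h1 hC ht) ?_
  have e : ∀ n, ∫ ω, Complex.exp (-(l * T n ω)) * uGap m l (Y n ω) ∂P = m := fun n => by
    have hY := h.isFringeChain hm
    rw [h.integral_exp_mul hm (by linarith), ← hY.integral_eq_iterate hm, hY.integral_uGap hm hl]
    have := gammaProd_ne_zero hs hsl n
    field_simp
  simp_rw [e]
  exact tendsto_const_nhds

end Jump

/-! ### From the smoothing equation of the discrete limit to that of the continuous limit -/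

section BetaGamma

variable {m : ℕ}

lemma ofReal_cpow_eq_exp_log {x : ℝ} (hx : 0 < x) (z : ℂ) :
    (x : ℂ) ^ z = Complex.exp (z * Real.log x) := by
  rw [Complex.cpow_def_of_ne_zero (by exact_mod_cast hx.ne'), ← Complex.ofReal_log hx.le, mul_comm]

lemma integral_exp_log_beta (hm : 0 < m) (s t : ℝ) :
    ∫ b : ℝ, Complex.exp ((s * Real.log b + t * Real.log (1 - b) : ℝ) * Complex.I)
        ∂betaMeasure (m : ℝ) (m : ℝ)
      = betaMoment m (s * Complex.I) (t * Complex.I) := by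
  have hm' : (0 : ℝ) < m := by exact_mod_cast hm
  rw [← integral_beta_eq hm _ _ (by simpa using hm') (by simpa using hm')]
  refine integral_congr_ae ?_
  filter_upwards [ae_mem_Ioo_beta m] with b hb
  rw [ofReal_cpow_eq_exp_log hb.1, ofReal_cpow_eq_exp_log (by linarith [hb.2]), ← Complex.exp_add]
  push_cast
  ring_nf

lemma betaMoment_mul_logMoment (hm : 0 < m) (s t : ℝ) :
    betaMoment m ((s + t : ℝ) * Complex.I) 0 * (logMoment m s * logMoment m t)
      = betaMoment m (s * Complex.I) (t * Complex.I) * logMoment m (s + t) := by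
  have hm' : (0 : ℝ) < m := by exact_mod_cast hm
  have g : Complex.Gamma m ≠ 0 := Complex.Gamma_ne_zero_of_re_pos (by simpa using hm')
  simp only [betaMoment, logMoment, add_zero]
  push_cast
  rw [show (2 * m + s * Complex.I + t * Complex.I : ℂ) = 2 * m + (s + t) * Complex.I by ring]
  field_simp

/-- If `ξ₁`, `ξ₂`, `ξ` follow the `Gamma(m)` law and `B` the `Beta(m, m)` law, all independent, then
`(B ξ₁, B ξ₂)` and `(B ξ, (1 - B) ξ)` have the same law (in logarithmic coordinates). -/
lemma map_beta_gamma (hm : 0 < m) {γ : Measure ℝ} [IsProbabilityMeasure γ]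
    (hγ : ∀ s, charFun γ s = logMoment m s) :
    ((betaMeasure (m : ℝ) (m : ℝ)).prod (γ.prod γ)).map
        (fun p => (Real.log p.1 + p.2.1, Real.log p.1 + p.2.2))
      = ((betaMeasure (m : ℝ) (m : ℝ)).prod γ).map
        (fun p => (Real.log p.1 + p.2, Real.log (1 - p.1) + p.2)) := by
  have := isProbabilityMeasure_beta hm
  have m1 : Measurable fun p : ℝ × ℝ × ℝ => (Real.log p.1 + p.2.1, Real.log p.1 + p.2.2) := by fun_prop
  have m2 : Measurable fun p : ℝ × ℝ => (Real.log p.1 + p.2, Real.log (1 - p.1) + p.2) := by fun_prop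
  have := Measure.isProbabilityMeasure_map (μ := (betaMeasure (m : ℝ) (m : ℝ)).prod (γ.prod γ))
    m1.aemeasurable
  have := Measure.isProbabilityMeasure_map (μ := (betaMeasure (m : ℝ) (m : ℝ)).prod γ)
    m2.aemeasurable
  refine Measure.ext_of_charFunDual (funext fun L => ?_)
  obtain ⟨s, t, hst⟩ : ∃ s t : ℝ, ∀ x y, L (x, y) = s * x + t * y := by
    refine ⟨L (1, 0), L (0, 1), fun x y => ?_⟩
    have e : ((x, y) : ℝ × ℝ) = x • (1, 0) + y • (0, 1) := by ext <;> simp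
    rw [e, map_add, map_smul, map_smul]
    simp only [smul_eq_mul]
    ring
  rw [charFunDual_apply, charFunDual_apply, integral_map m1.aemeasurable (by fun_prop),
    integral_map m2.aemeasurable (by fun_prop)]
  simp_rw [hst]
  have e1 : ∀ p : ℝ × ℝ × ℝ, Complex.exp ((s * (Real.log p.1 + p.2.1)
        + t * (Real.log p.1 + p.2.2) : ℝ) * Complex.I)
      = Complex.exp (((s + t) * Real.log p.1 + 0 * Real.log (1 - p.1) : ℝ) * Complex.I)
        * (Complex.exp (s * p.2.1 * Complex.I) * Complex.exp (t * p.2.2 * Complex.I)) := fun p => by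
    rw [← Complex.exp_add, ← Complex.exp_add]
    push_cast
    ring_nf
  have e2 : ∀ p : ℝ × ℝ, Complex.exp ((s * (Real.log p.1 + p.2)
        + t * (Real.log (1 - p.1) + p.2) : ℝ) * Complex.I)
      = Complex.exp ((s * Real.log p.1 + t * Real.log (1 - p.1) : ℝ) * Complex.I)
        * Complex.exp ((s + t : ℝ) * p.2 * Complex.I) := fun p => by
    rw [← Complex.exp_add]
    push_cast
    ring_nf
  simp_rw [e1, e2]
  rw [integral_prod_mul (fun b : ℝ => Complex.exp (((s + t) * Real.log b
      + 0 * Real.log (1 - b) : ℝ) * Complex.I)) (fun q : ℝ × ℝ =>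
      Complex.exp (s * q.1 * Complex.I) * Complex.exp (t * q.2 * Complex.I)),
    integral_prod_mul (fun x : ℝ => Complex.exp (s * x * Complex.I))
      (fun x : ℝ => Complex.exp (t * x * Complex.I)),
    integral_prod_mul (fun b : ℝ => Complex.exp ((s * Real.log b + t * Real.log (1 - b) : ℝ)
      * Complex.I)) (fun x : ℝ => Complex.exp ((s + t : ℝ) * x * Complex.I)),
    ← charFun_apply_real, ← charFun_apply_real, ← charFun_apply_real,
    integral_exp_log_beta hm, integral_exp_log_beta hm, hγ, hγ, hγ]
  simpa using betaMoment_mul_logMoment hm s t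

lemma charFun_exp_mul {γ : Measure ℝ} [IsProbabilityMeasure γ] {ν : Measure ℂ}
    [IsProbabilityMeasure ν] (l z : ℂ) :
    charFun ((γ.prod ν).map fun p => Complex.exp (l * p.1) * p.2) z
      = ∫ x : ℝ, charFun ν (conj (Complex.exp (l * x)) * z) ∂γ := by
  rw [charFun_apply, integral_map (by fun_prop) (by fun_prop), integral_prod]
  · refine integral_congr_ae (Eventually.of_forall fun x => ?_)
    simp only [charFun_apply, inner_mul_left_eq]
  · refine Integrable.of_bound (by fun_prop) 1 (Eventually.of_forall fun p => ?_)
    rw [Complex.norm_exp_ofReal_mul_I]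

/-- With `ξ = e^X`: `B^l (ξ₁^l D₁ + ξ₂^l D₂)` has the law of `(Bξ)^l D₁ + ((1-B)ξ)^l D₂ = ξ^l (B^l
D₁ + (1-B)^l D₂)` by the beta-gamma identity, and the last bracket has the law of `D`. -/
theorem smoothBeta_exp_mul (hm : 0 < m) {γ : Measure ℝ} [IsProbabilityMeasure γ]
    (hγ : ∀ s, charFun γ s = logMoment m s) {ν : Measure ℂ} [IsProbabilityMeasure ν] {l : ℂ}
    (hν : smoothDirichlet m l ν = ν) :
    smoothBeta m l ((γ.prod ν).map fun p => Complex.exp (l * p.1) * p.2)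
      = (γ.prod ν).map fun p => Complex.exp (l * p.1) * p.2 := by
  have := isProbabilityMeasure_beta hm
  set μ : Measure ℂ := (γ.prod ν).map fun p => Complex.exp (l * p.1) * p.2 with hμ
  have hμp : IsProbabilityMeasure μ := Measure.isProbabilityMeasure_map (by fun_prop)
  have hmw := measurable_betaWeights l
  have hmd := measurable_dirichletWeights l
  have : IsProbabilityMeasure (betaKernel m l) := Measure.isProbabilityMeasure_map hmw.aemeasurable
  have : IsProbabilityMeasure (dirichletKernel m l) :=
    Measure.isProbabilityMeasure_map hmd.aemeasurable
  have hcν : Continuous (charFun ν) := continuous_charFun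
  have hcμ : Continuous (charFun μ) := continuous_charFun
  rw [smoothBeta_eq]
  refine Measure.ext_of_charFun (funext fun z => ?_)
  set H : ℝ × ℝ → ℂ := fun q => charFun ν (conj (Complex.exp (l * q.1)) * z)
    * charFun ν (conj (Complex.exp (l * q.2)) * z) with hH
  have hHc : Continuous H := by fun_prop
  have hH1 : ∀ q, ‖H q‖ ≤ 1 := fun q => by
    rw [hH, norm_mul]
    exact mul_le_one₀ (norm_charFun_le_one _) (norm_nonneg _) (norm_charFun_le_one _)
  have m1 : Measurable fun p : ℝ × ℝ × ℝ => (Real.log p.1 + p.2.1, Real.log p.1 + p.2.2) := by fun_prop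
  have m2 : Measurable fun p : ℝ × ℝ => (Real.log p.1 + p.2, Real.log (1 - p.1) + p.2) := by fun_prop
  -- The two sides are unfolded in opposite orders: the Beta variable outside on the left, and
  -- inside on the right, where the Dirichlet equation is applied for a fixed value of the Gamma
  -- variable.
  have key := congrArg (fun ρ => ∫ q, H q ∂ρ) (map_beta_gamma hm hγ)
  rw [integral_map m1.aemeasurable hHc.aestronglyMeasurable,
    integral_map m2.aemeasurable hHc.aestronglyMeasurable, integral_prod, integral_prod_symm] at key
  rotate_left
  · exact Integrable.of_bound (hHc.measurable.comp m2).aestronglyMeasurable 1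
      (Eventually.of_forall fun p => hH1 _)
  · exact Integrable.of_bound (hHc.measurable.comp m1).aestronglyMeasurable 1
      (Eventually.of_forall fun p => hH1 _)
  have hexp : ∀ {b : ℝ}, 0 < b → ∀ x : ℝ, conj (Complex.exp (l * x)) * (conj ((b : ℂ) ^ l) * z)
      = conj (Complex.exp (l * (Real.log b + x : ℝ))) * z := fun {b} hb x => by
    rw [ofReal_cpow_eq_exp_log hb, ← mul_assoc, ← map_mul, ← Complex.exp_add]
    push_cast
    ring_nf
  have hexp' : ∀ {b : ℝ}, 0 < b → ∀ x : ℝ, conj ((b : ℂ) ^ l) * (conj (Complex.exp (l * x)) * z)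
      = conj (Complex.exp (l * (Real.log b + x : ℝ))) * z := fun {b} hb x => by
    rw [← hexp hb]
    ring
  have hl : charFun (smooth (betaKernel m l) μ) z = ∫ b : ℝ, ∫ q : ℝ × ℝ,
      H (Real.log b + q.1, Real.log b + q.2) ∂γ.prod γ ∂betaMeasure (m : ℝ) (m : ℝ) := by
    rw [charFun_smooth, betaKernel, integral_map hmw.aemeasurable (by fun_prop)]
    refine integral_congr_ae ?_
    filter_upwards [ae_mem_Ioo_beta m] with b hb
    rw [hμ, charFun_exp_mul]
    simp_rw [hexp hb.1]
    exact (integral_prod_mul _ _).symm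
  have hr : charFun μ z = ∫ x : ℝ, ∫ b : ℝ,
      H (Real.log b + x, Real.log (1 - b) + x) ∂betaMeasure (m : ℝ) (m : ℝ) ∂γ := by
    rw [hμ, charFun_exp_mul]
    refine integral_congr_ae (Eventually.of_forall fun x => ?_)
    have e := charFun_smooth (dirichletKernel m l) ν (conj (Complex.exp (l * x)) * z)
    rw [← smoothDirichlet_eq, hν, dirichletKernel, integral_map hmd.aemeasurable (by fun_prop)] at e
    refine e.trans (integral_congr_ae ?_)
    filter_upwards [ae_mem_Ioo_beta m] with b hb
    simp only [hH]
    rw [hexp' hb.1, hexp' (sub_pos.2 hb.2)]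
  rw [hl, hr]
  exact key

end BetaGamma

/-! ### The limit variables -/

/-- Convergence of `log n - T n` forces `T n → ∞` and `T (n + 1) - T n → 0`. So every time lies in
one jump interval, and the exponential factor varies negligibly across it. -/
lemma tendsto_interpolate {S : Type*} {T : ℕ → ℝ} {Y : ℕ → S} {X : ℝ≥0 → S} {l : ℂ} {u : S → ℂ} {w : ℂ}
    {x : ℝ} (h0 : T 0 = 0) (hT : ∀ n, T n < T (n + 1))
    (hx : Tendsto (fun n : ℕ => Real.log n - T n) atTop (𝓝 x))
    (hX : ∀ (n : ℕ) (t : ℝ≥0), T n ≤ t → (t : ℝ) < T (n + 1) → X t = Y n)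
    (hw : Tendsto (fun n => Complex.exp (-(l * T n)) * u (Y n)) atTop (𝓝 w)) :
    Tendsto (fun t : ℝ≥0 => Complex.exp (-(l * (t : ℝ))) * u (X t)) atTop (𝓝 w) := by
  have hmono : Monotone T := monotone_nat_of_le_succ fun n => (hT n).le
  have hlog : Tendsto (fun n : ℕ => Real.log n) atTop atTop :=
    Real.tendsto_log_atTop.comp tendsto_natCast_atTop_atTop
  have htop : Tendsto T atTop atTop := by
    have := tendsto_atTop_add_right_of_le' atTop (C := -(x + 1)) hlog
      (g := fun n : ℕ => -(Real.log n - T n)) (by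
        filter_upwards [hx.eventually_le_const (lt_add_one x)] with n hn using neg_le_neg hn)
    refine this.congr fun n => ?_
    ring
  have hgap : Tendsto (fun n => T (n + 1) - T n) atTop (𝓝 0) := by
    have h1 := (hx.sub ((tendsto_add_atTop_iff_nat 1).2 hx))
    have h2 : Tendsto (fun n : ℕ => Real.log (n + 1 : ℕ) - Real.log n) atTop (𝓝 0) := by
      have := Real.tendsto_log_nat_add_one_sub_log
      simpa using this
    have h3 := h2.add h1
    rw [sub_self, add_zero] at h3
    refine h3.congr fun n => ?_
    ring
  have hex : ∀ t : ℝ≥0, ∃ n, T n ≤ t ∧ (t : ℝ) < T (n + 1) := fun t => by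
    classical
    obtain ⟨N, hN⟩ := (htop.eventually_gt_atTop (t : ℝ)).exists
    have hP : ∃ n, (t : ℝ) < T n := ⟨N, hN⟩
    have hpos : Nat.find hP ≠ 0 := fun h => by
      have := Nat.find_spec hP
      rw [h, h0] at this
      exact absurd this (not_lt.2 t.2)
    obtain ⟨k, hk⟩ := Nat.exists_eq_succ_of_ne_zero hpos
    refine ⟨k, not_lt.1 (Nat.find_min hP (by omega)), ?_⟩
    have := Nat.find_spec hP
    rwa [hk] at this
  choose N hN1 hN2 using hex
  have hNtop : Tendsto N atTop atTop := by
    refine tendsto_atTop.2 fun k => ?_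
    filter_upwards [eventually_ge_atTop (T k).toNNReal] with t ht
    by_contra hk
    have h1 : T (N t + 1) ≤ T k := hmono (by omega)
    exact absurd (hN2 t) (not_lt.2 (h1.trans (Real.toNNReal_le_iff_le_coe.1 ht)))
  have hdiff : Tendsto (fun t : ℝ≥0 => (t : ℝ) - T (N t)) atTop (𝓝 0) :=
    squeeze_zero (fun t => sub_nonneg.2 (hN1 t)) (fun t => sub_le_sub_right (hN2 t).le _)
      (hgap.comp hNtop)
  have hexp : Continuous fun r : ℝ => Complex.exp (-(l * r)) := by fun_prop
  have h1 := ((hexp.tendsto 0).comp hdiff).mul (hw.comp hNtop)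
  simp only [Complex.ofReal_zero, mul_zero, neg_zero, Complex.exp_zero, one_mul] at h1
  refine h1.congr fun t => ?_
  simp only [Function.comp]
  rw [← mul_assoc, ← Complex.exp_add, hX _ t (hN1 t) (hN2 t)]
  push_cast
  ring_nf

variable {m : ℕ} {Ω : Type*} [MeasurableSpace Ω] {P : Measure Ω} [IsProbabilityMeasure P] {l : ℂ}

theorem exists_continuousLimit (hm : 0 < m) (hl : (chi m).IsRoot l) (hr : 1 / 2 < l.re)
    {X : ℝ≥0 → Ω → Fin m → ℤ} (h : IsFringeJumpProcess P m (e1 m) X) :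
    ∃ W : Ω → ℂ, Measurable W ∧ IsContinuousLimit P m l X W ∧
      P.map W ∈ M2 (m : ℂ) ∧ smoothBeta m l (P.map W) = P.map W := by
  obtain ⟨T, Y, hTm, hYm, hinit, hX, hjump⟩ := h.jumps
  have hj : IsJumpChain P m T Y := ⟨hTm, hYm, hinit, hjump⟩
  have hY := hj.isFringeChain hm
  obtain ⟨D, hD, hlim, hD2, -, hD1⟩ := hY.exists_limit hm hl hr
  obtain ⟨Z, hZ, hZlim⟩ := measurable_limit_of_tendsto_metrizable_ae
    (fun n : ℕ => (measurable_const.sub (hTm n)).aemeasurable) (hj.ae_exists_tendsto_log hm)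
  obtain ⟨hW2, hWm⟩ := hj.integral_limit hm hl hr hlim hZlim
  have hW : Measurable fun ω => Complex.exp (l * Z ω) * D ω := by fun_prop
  have := Measure.isProbabilityMeasure_map (μ := P) hZ.aemeasurable
  have := Measure.isProbabilityMeasure_map (μ := P) hD.aemeasurable
  have hmap : P.map (fun ω => Complex.exp (l * Z ω) * D ω)
      = ((P.map Z).prod (P.map D)).map fun p => Complex.exp (l * p.1) * p.2 := by
    rw [← (indepFun_iff_map_prod_eq_prod_map_map hZ.aemeasurable hD.aemeasurable).1
      (hj.indepFun_limit hm hD hlim hZ hZlim), Measure.map_map (by fun_prop) (by fun_prop)]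
    rfl
  refine ⟨_, hW, ?_, hWm ▸ map_mem_M2 hW hW2, ?_⟩
  · filter_upwards [hinit, hj.ae_lt hm, hZlim, hX, tendsto_exp_mul_uGap hlim hZlim]
      with ω h1 h2 h3 h4 h5
    exact tendsto_interpolate (u := uGap m l) (Y := fun n => Y n ω) h1.1 h2 h3 h4 h5
  · rw [hmap]
    exact smoothBeta_exp_mul hm (hj.charFun_log hm hD hlim hZ hZlim)
      (hY.smoothDirichlet_limit hm (by linarith) hD hlim hD2 hD1)

theorem exists_discreteLimit (hm : 0 < m) (hl : (chi m).IsRoot l) (hr : 1 / 2 < l.re)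
    {L : ℕ → Ω → Fin m → ℤ} (h : IsFringeChain P m (e1 m) L) :
    ∃ W : Ω → ℂ, Measurable W ∧ IsDiscreteLimit P m l L W ∧
      P.map W ∈ M2 ((m ! : ℂ) / Complex.Gamma (m + l)) ∧ smoothDirichlet m l (P.map W) = P.map W := by
  obtain ⟨W, hW, hlim, hW2, hmean, hW1⟩ := h.exists_limit hm hl hr
  exact ⟨W, hW, hlim, hmean ▸ map_mem_M2 hW hW2,
    h.smoothDirichlet_limit hm (by linarith) hW hlim hW2 hW1⟩

lemma iff_eq_of_existsUnique {α : Sort*} {p : α → Prop} (h : ∃! a, p a) {b : α} (hb : p b) (a : α) :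
    p a ↔ a = b :=
  ⟨fun ha => h.unique ha hb, fun e => e ▸ hb⟩

end

end BTreeUrn

/-! ### Assembly of the statement -/

theorem mainTheorem7 (m : ℕ) (hm : 2 ≤ m) :
    -- unique solutions of both smoothing equations
    (∀ l : ℂ, (BTreeUrn.chi m).IsRoot l → 1 / 2 < l.re → ∀ A : ℂ,
      (∃! μ : Measure ℂ, μ ∈ BTreeUrn.M2 A ∧ BTreeUrn.smoothDirichlet m l μ = μ) ∧
      (∃! μ : Measure ℂ, μ ∈ BTreeUrn.M2 A ∧ BTreeUrn.smoothBeta m l μ = μ)) ∧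
    (60 ≤ m →
      (∃! l : ℂ, BTreeUrn.IsLambda2 m l) ∧
      ∀ l : ℂ, BTreeUrn.IsLambda2 m l →
      ∀ (Ω : Type*) [MeasurableSpace Ω] (P : Measure Ω) [IsProbabilityMeasure P],
        -- the limit variable of the B-tree (discrete time)
        (∀ L : ℕ → Ω → Fin m → ℤ, BTreeUrn.IsFringeChain P m (BTreeUrn.e1 m) L →
          ∃ W : Ω → ℂ, Measurable W ∧ BTreeUrn.IsDiscreteLimit P m l L W ∧
            (∀ W' : Ω → ℂ, BTreeUrn.HasDiscreteExpansion P m l L W' → W' =ᵐ[P] W) ∧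
            ∀ ν : Measure ℂ,
              (ν ∈ BTreeUrn.M2 ((m ! : ℂ) / Complex.Gamma (m + l)) ∧
                BTreeUrn.smoothDirichlet m l ν = ν) ↔ ν = P.map W) ∧
        -- the limit variable of the continuous-time process
        (∀ X : ℝ≥0 → Ω → Fin m → ℤ, BTreeUrn.IsFringeJumpProcess P m (BTreeUrn.e1 m) X →
          ∃ W : Ω → ℂ, Measurable W ∧ BTreeUrn.IsContinuousLimit P m l X W ∧
            (∀ W' : Ω → ℂ, BTreeUrn.HasContinuousExpansion P m l X W' → W' =ᵐ[P] W) ∧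
            ∀ ν : Measure ℂ,
              (ν ∈ BTreeUrn.M2 (m : ℂ) ∧ BTreeUrn.smoothBeta m l ν = ν) ↔ ν = P.map W)) := by
  have hm0 : 0 < m := by omega
  refine ⟨fun l hl hr A => ⟨BTreeUrn.existsUnique_smoothDirichlet hm0 hl hr A,
    BTreeUrn.existsUnique_smoothBeta hm0 hl hr A⟩, fun hm60 =>
    ⟨BTreeUrn.existsUnique_isLambda2 hm60, fun l hl2 Ω _ P _ => ?_⟩⟩
  have hr := BTreeUrn.half_lt_re_of_isLambda2 hm60 hl2
  have hr0 : 0 < l.re := by linarith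
  obtain ⟨hl, hi, -⟩ := hl2
  refine ⟨fun L hL => ?_, fun X hX => ?_⟩
  · obtain ⟨W, hW, hlim, hM, hfix⟩ := BTreeUrn.exists_discreteLimit hm0 hl hr hL
    exact ⟨W, hW, hlim, fun W' h' => (h'.isDiscreteLimit hm0 hl hr0 hi).ae_eq hlim,
      BTreeUrn.iff_eq_of_existsUnique (BTreeUrn.existsUnique_smoothDirichlet hm0 hl hr _) ⟨hM, hfix⟩⟩
  · obtain ⟨W, hW, hlim, hM, hfix⟩ := BTreeUrn.exists_continuousLimit hm0 hl hr hX
    exact ⟨W, hW, hlim, fun W' h' => (h'.isContinuousLimit hm0 hl hr0 hi).ae_eq hlim,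
      BTreeUrn.iff_eq_of_existsUnique (BTreeUrn.existsUnique_smoothBeta hm0 hl hr _) ⟨hM, hfix⟩⟩
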